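/- Conventions. For a C*-algebra $A$ let $\mathcal P(A)$ be the set of pure states with the weak-* uniformity, $\hat A$ the set of unitary equivalence classes of nonzero irreducible representations with the Jacobson topology, and $p_A:\mathcal P(A)\to\hat A$ the map sending a pure state to the class of its GNS representation. The fiber $\mathcal P_{A,[\pi]}=p_A^{-1}([\pi])$ has the Kähler structure for which $\omega=\langle x_\omega,\pi(\cdot)x_\omega\rangle\mapsto[x_\omega]$ is a Kähler isomorphism onto the projective space of $\mathcal H_\pi$ with the Fubini–Study metric of distance $\sqrt2\arccos|\langle x,y\rangle|$ (unit vectors $x,y$). A uniform Kähler bundle (UKB) is a continuous open surjection from a uniform space onto a topological space whose fibers are Kähler manifolds; $(\mathcal P(A),p_A,\hat A)$ is the UKB of $A$. A Kähler subbundle $(E,p|_E,X)$ of a UKB is given by a subset $E$ of the total space and a subset $X$ of the base with $p(E)\subseteq X$, such that each fiber of $E$ over a point of $X$ is a closed Kähler submanifold of the corresponding fiber of the UKB (closed in the manifold topology, and a closed linear subspace in suitable holomorphic charts) and such that it is itself a UKB with the induced topologies and Kähler structures. The restriction of a UKB to $U\subseteq X$ is $(p^{-1}(U),p,U)$. A uniform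 Kähler isomorphism is a pair of homeomorphisms of the total spaces and of the base spaces that intertwines the projections and restricts to holomorphic Kähler isometries of the fibers. Theorem. Let $B$ be a nonzero hereditary C*-subalgebra of a C*-algebra $A$, and let $\hat A^B=\{[\pi]\in\hat A:\pi(B)\ne0\}$. Each $\tau\in\mathcal P(B)$ has a unique extension $\Xi(\tau)$ to a state of $A$, and it is pure; and $[\pi]\mapsto[\pi_B]$, where $\pi_B$ is the representation of $B$ by $\pi$ on the closed span of $\pi(B)\mathcal H_\pi$, is a homeomorphism from $\hat A^B$ onto $\hat B$. Moreover: (a) $(\Xi(\mathcal P(B)),p_A,\hat A^B)$ is a Kähler subbundle of $(\mathcal P(A),p_A,\hat A)$, and $\Xi(\mathcal P_{B,[\pi_B]})$ is a closed Kähler submanifold of $\mathcal P_{A,[\pi]}$ for all $[\pi]\in\hat A^B$. The map $\Xi$ together with $[\pi_B]\mapsto[\pi]$ is a uniform Kähler isomorphism of the UKB $(\mathcal P(B),p_B,\hat B)$ onto $(\Xi(\mathcal P(B)),p_A,\hat A^B)$. (b) $B$ is a closed (two-sided) ideal of $A$ if and only if $(\Xi(\mathcal P(B)),p_A,\hat A^B)$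 is equal to the restriction $(p_A^{-1}(\hat A^B),p_A,\hat A^B)$ of the UKB of $A$ to $\hat A^B$. -/

import Mathlib

open scoped ComplexOrder InnerProductSpace
universe u v

section GNS
open Filter Topology UniformSpace

variable {A : Type u} [NonUnitalCStarAlgebra A] [PartialOrder A] [StarOrderedRing A]

theorem gns_bound (f : A →ₚ[ℂ] ℂ) : ∃ C : ℝ, ∀ a, ‖f a‖ ≤ C * ‖f.toPreGNS a‖ := by
  obtain ⟨C, hC⟩ := f.exists_norm_apply_le
  have hcont : Continuous f :=
    (f.toLinearMap.mkContinuous C hC).continuous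
  have key : ∀ e a : A, ‖e‖ ≤ 1 → ‖f (star e * a)‖ ≤ √C * ‖f.toPreGNS a‖ := by
    intro e a he
    have h1 : ‖f (star e * a)‖ ≤ ‖f.toPreGNS e‖ * ‖f.toPreGNS a‖ :=
      norm_inner_le_norm (𝕜 := ℂ) (f.toPreGNS e) (f.toPreGNS a)
    refine h1.trans (mul_le_mul_of_nonneg_right ?_ (norm_nonneg _))
    rw [f.preGNS_norm_def]
    refine Real.sqrt_le_sqrt ((Complex.re_le_norm _).trans ((hC _).trans ?_))
    have h2 : ‖star e * e‖ ≤ 1 := by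
      rw [CStarRing.norm_star_mul_self]; nlinarith [norm_nonneg e]
    calc (C : ℝ) * ‖star e * e‖ ≤ C * 1 := by gcongr
      _ = C := mul_one _
  refine ⟨√C, fun a => ?_⟩
  have hl := CStarAlgebra.increasingApproximateUnit (A := A)
  have ht : Tendsto (fun e : A => ‖f (e * a)‖) (CStarAlgebra.approximateUnit A) (𝓝 ‖f a‖) :=
    ((hcont.tendsto a).comp (hl.tendsto_mul_right a)).norm
  refine le_of_tendsto ht ?_
  filter_upwards [hl.eventually_norm, hl.eventually_star_eq] with e he hs
  have := key e a he
  rwa [hs] at this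

/-- The canonical cyclic vector of the GNS representation. -/
theorem exists_gns_vector (f : A →ₚ[ℂ] ℂ) : ∃ ζ : f.GNS,
    (∀ a, ⟪ζ, (f.toPreGNS a : f.GNS)⟫_ℂ = f a) ∧
    ∀ a, f.gnsNonUnitalStarAlgHom a ζ = (f.toPreGNS a : f.GNS) := by
  obtain ⟨C, hC⟩ := gns_bound f
  let g : f.PreGNS →L[ℂ] ℂ := (f.toLinearMap ∘ₗ f.ofPreGNS.toLinearMap).mkContinuous C hC
  let e : f.PreGNS →L[ℂ] f.GNS := Completion.toComplL
  let G : f.GNS →L[ℂ] ℂ := g.extend e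
  have hG : ∀ x : f.PreGNS, G (x : f.GNS) = g x := fun x =>
    g.extend_eq (e := e) Completion.denseRange_coe
      (Completion.isUniformInducing_coe _) x
  have h1 : ∀ a, ⟪(InnerProductSpace.toDual ℂ f.GNS).symm G, (f.toPreGNS a : f.GNS)⟫_ℂ = f a := by
    intro a
    rw [InnerProductSpace.toDual_symm_apply, hG]
    rfl
  refine ⟨(InnerProductSpace.toDual ℂ f.GNS).symm G, h1, fun a => ?_⟩
  refine ext_inner_left ℂ fun v => ?_
  induction v using Completion.induction_on with
  | hp => apply isClosed_eq <;> fun_prop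
  | ih v =>
    have hs : f.gnsNonUnitalStarAlgHom a =
        ContinuousLinearMap.adjoint (f.gnsNonUnitalStarAlgHom (star a)) := by
      rw [map_star]; simp [ContinuousLinearMap.star_eq_adjoint]
    rw [hs, ContinuousLinearMap.adjoint_inner_right,
      f.gnsNonUnitalStarAlgHom_apply_coe, ← inner_conj_symm]
    have h2 := h1 (star a * f.ofPreGNS v)
    have h3 : f.toPreGNS (star a * f.ofPreGNS v) = f.leftMulMapPreGNS (star a) v := rfl
    rw [h3] at h2
    rw [h2, Completion.inner_coe, f.preGNS_inner_def, ← Complex.star_def, ← map_star]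
    simp

end GNS

section Representations

/-- A representation of the C*-algebra `A` on a complex Hilbert space. (Every irreducible
representation acts on a space that is isomorphic to a quotient of `A`, so that for the spectrum
of `A` it suffices to use Hilbert spaces in the universe of `A`.) -/
structure HilbertRep (A : Type u) [NonUnitalCStarAlgebra A] : Type (u + 1) where
  space : Type u
  [normed : NormedAddCommGroup space]
  [inner : InnerProductSpace ℂ space]
  [complete : CompleteSpace space]
  hom : A →⋆ₙₐ[ℂ] (space →L[ℂ] space)

attribute [instance] HilbertRep.normed HilbertRep.inner HilbertRep.complete

variable {A : Type u} [NonUnitalCStarAlgebra A]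

/-- Unitary equivalence of representations. -/
def HilbertRep.UnitarilyEquiv (π ρ : HilbertRep A) : Prop :=
  ∃ U : π.space ≃ₗᵢ[ℂ] ρ.space, ∀ a v, U (π.hom a v) = ρ.hom a (U v)

theorem HilbertRep.UnitarilyEquiv.refl (π : HilbertRep A) : π.UnitarilyEquiv π :=
  ⟨LinearIsometryEquiv.refl ℂ _, fun _ _ => rfl⟩

theorem HilbertRep.UnitarilyEquiv.symm {π ρ : HilbertRep A} (h : π.UnitarilyEquiv ρ) :
    ρ.UnitarilyEquiv π := by
  obtain ⟨U, hU⟩ := h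
  exact ⟨U.symm, fun a v => by rw [LinearIsometryEquiv.symm_apply_eq, hU]; simp⟩

theorem HilbertRep.UnitarilyEquiv.trans {π ρ σ : HilbertRep A} (h : π.UnitarilyEquiv ρ)
    (h' : ρ.UnitarilyEquiv σ) : π.UnitarilyEquiv σ := by
  obtain ⟨U, hU⟩ := h
  obtain ⟨V, hV⟩ := h'
  exact ⟨U.trans V, fun a v => by simp [hU, hV]⟩

/-- A nonzero representation without nontrivial closed invariant subspaces. -/
def HilbertRep.IsIrreducible (π : HilbertRep A) : Prop :=
  (∃ a, π.hom a ≠ 0) ∧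
    ∀ K : Submodule ℂ π.space, IsClosed (K : Set π.space) →
      (∀ a, ∀ v ∈ K, π.hom a v ∈ K) → K = ⊥ ∨ K = ⊤

/-- The nonzero irreducible representations of `A`. -/
def IrredRep (A : Type u) [NonUnitalCStarAlgebra A] : Type (u + 1) :=
  {π : HilbertRep A // π.IsIrreducible}

/-- Unitary equivalence of irreducible representations. -/
instance IrredRep.setoid (A : Type u) [NonUnitalCStarAlgebra A] : Setoid (IrredRep A) where
  r π ρ := π.1.UnitarilyEquiv ρ.1
  iseqv := ⟨fun π => .refl π.1, fun h => h.symm, fun h h' => h.trans h'⟩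

/-- The spectrum of `A`: the unitary equivalence classes of nonzero irreducible
representations. -/
def CStarSpectrum (A : Type u) [NonUnitalCStarAlgebra A] : Type (u + 1) :=
  Quotient (IrredRep.setoid A)

/-- The class `[π]` in the spectrum. -/
def IrredRep.toSpectrum (π : IrredRep A) : CStarSpectrum A := Quotient.mk _ π

/-- The primitive ideal `ker π` of a point `[π]` of the spectrum. -/
def CStarSpectrum.ker (x : CStarSpectrum A) : Set A :=
  Quotient.lift (fun π : IrredRep A => {a : A | π.1.hom a = 0}) (by
    have key : ∀ π ρ : IrredRep A, π ≈ ρ → ∀ a, π.1.hom a = 0 → ρ.1.hom a = 0 := by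
      rintro π ρ ⟨U, hU⟩ a ha
      ext v
      have := hU a (U.symm v)
      simp only [ha, zero_apply, map_zero,
        LinearIsometryEquiv.apply_symm_apply] at this
      simpa using this.symm
    intro π ρ h
    ext a
    exact ⟨key π ρ h a, key ρ π (Setoid.symm h) a⟩) x

/-- Kernels of irreducible representations are prime. -/
theorem CStarSpectrum.ker_prime (x : CStarSpectrum A) {a b : A} (ha : a ∉ x.ker)
    (hb : b ∉ x.ker) : ∃ c, a * c * b ∉ x.ker := by
  induction x using Quotient.inductionOn with
  | h π =>
    obtain ⟨⟨c₀, hc₀⟩, hirr⟩ := π.2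
    have ha : π.1.hom a ≠ 0 := ha
    have hb : π.1.hom b ≠ 0 := hb
    by_contra! hcon
    have hcon : ∀ c, π.1.hom (a * c * b) = 0 := hcon
    obtain ⟨v, hv⟩ : ∃ v, π.1.hom b v ≠ 0 := by
      by_contra! h
      exact hb (ContinuousLinearMap.ext h)
    -- the vectors `w` with `π(a) π(c) w = 0` for all `c`, and the vectors killed by `π(A)`
    let K : Submodule ℂ π.1.space := ⨅ c : A, LinearMap.ker (π.1.hom (a * c)).toLinearMap
    have hK : ∀ w, w ∈ K ↔ ∀ c, π.1.hom (a * c) w = 0 := fun w => by simp [K]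
    have hKc : IsClosed (K : Set π.1.space) := by
      have : (K : Set π.1.space) = ⋂ c, {w | π.1.hom (a * c) w = 0} := by
        ext w; simp [hK]
      rw [this]
      exact isClosed_iInter fun c => isClosed_eq (π.1.hom (a * c)).continuous continuous_const
    let N : Submodule ℂ π.1.space := ⨅ c : A, LinearMap.ker (π.1.hom c).toLinearMap
    have hN : ∀ w, w ∈ N ↔ ∀ c, π.1.hom c w = 0 := fun w => by simp [N]
    have hNc : IsClosed (N : Set π.1.space) := by
      have : (N : Set π.1.space) = ⋂ c, {w | π.1.hom c w = 0} := by
        ext w; simp [hN]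
      rw [this]
      exact isClosed_iInter fun c => isClosed_eq (π.1.hom c).continuous continuous_const
    have hN0 : N = ⊥ := by
      refine (hirr N hNc fun d w hw => ?_).resolve_right fun h => ?_
      · rw [(hN w).1 hw d]; exact N.zero_mem
      · exact hc₀ (ContinuousLinearMap.ext fun w => (hN w).1 (h ▸ Submodule.mem_top) c₀)
    have hbv : π.1.hom b v ∈ K := (hK _).2 fun c => by
      have := congrArg (fun T => T v) (hcon c)
      simpa [map_mul] using this
    have hK1 : K = ⊤ := by
      refine (hirr K hKc fun d w hw => (hK _).2 fun c => ?_).resolve_left fun h => ?_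
      · have := (hK w).1 hw (c * d)
        simpa [map_mul, mul_assoc] using this
      · rw [h] at hbv; exact hv (by simpa using hbv)
    -- so `π(a)` kills `π(A)H`; hence `π(a*)` maps into `N = 0`
    have hz : ∀ c, π.1.hom (a * c) = 0 := fun c =>
      ContinuousLinearMap.ext fun w => (hK w).1 (hK1 ▸ Submodule.mem_top) c
    have hstar : π.1.hom (star a) = 0 := by
      ext w
      have : π.1.hom (star a) w ∈ N := (hN _).2 fun c => by
        have h := hz (star c)
        have h2 : π.1.hom (c * star a) = 0 := by
          have := congrArg star h
          rwa [star_zero, ← map_star, star_mul, star_star] at this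
        simpa [map_mul] using congrArg (fun T => T w) h2
      rw [hN0] at this
      simpa using this
    apply ha
    have := congrArg star hstar
    rwa [star_zero, ← map_star, star_star] at this

/-- The Jacobson (hull-kernel) topology: the closed sets are the sets
`{[π] : S ⊆ ker π}` for subsets `S` of `A`. -/
instance CStarSpectrum.topology : TopologicalSpace (CStarSpectrum A) :=
  TopologicalSpace.ofClosed {F | ∃ S : Set A, F = {x | S ⊆ x.ker}}
    ⟨Set.univ, by
      ext x
      simp only [Set.mem_empty_iff_false, Set.mem_ofPred_eq, false_iff]
      intro h
      induction x using Quotient.inductionOn with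
      | h π =>
        obtain ⟨c, hc⟩ := π.2.1
        exact hc (h (Set.mem_univ c))⟩
    (by
      intro 𝓕 h𝓕
      refine ⟨⋃₀ {S | {x : CStarSpectrum A | S ⊆ x.ker} ∈ 𝓕}, ?_⟩
      ext x
      simp only [Set.mem_sInter, Set.mem_ofPred_eq, Set.sUnion_subset_iff]
      constructor
      · intro h S hS
        exact h _ hS
      · intro h F hF
        obtain ⟨S, rfl⟩ := h𝓕 hF
        exact h S hF)
    (by
      rintro _ ⟨S, rfl⟩ _ ⟨T, rfl⟩
      refine ⟨{d | ∃ s ∈ S, ∃ c, ∃ t ∈ T, d = s * c * t}, ?_⟩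
      ext x
      simp only [Set.mem_union, Set.mem_ofPred_eq]
      constructor
      · rintro (h | h) _ ⟨s, hs, c, t, ht, rfl⟩
        · have hs := h hs
          induction x using Quotient.inductionOn with
          | h π =>
            have hs : π.1.hom s = 0 := hs
            change π.1.hom (s * c * t) = 0
            simp [map_mul, hs]
        · have ht := h ht
          induction x using Quotient.inductionOn with
          | h π =>
            have ht : π.1.hom t = 0 := ht
            change π.1.hom (s * c * t) = 0
            simp [map_mul, ht]
      · intro h
        by_contra! hcon
        obtain ⟨s, hs, hs'⟩ := Set.not_subset.1 hcon.1
        obtain ⟨t, ht, ht'⟩ := Set.not_subset.1 hcon.2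
        obtain ⟨c, hc⟩ := x.ker_prime hs' ht'
        exact hc (h ⟨s, hs, c, t, ht, rfl⟩))

end Representations

section PureStates

/-- Positivity of a bounded functional: `φ(a* a) ≥ 0` for all `a`. -/
def IsPositiveFunctional {A : Type u} [NonUnitalCStarAlgebra A] (φ : A →L[ℂ] ℂ) : Prop :=
  ∀ a : A, 0 ≤ φ (star a * a)

/-- States: positive functionals of norm one. -/
def IsState {A : Type u} [NonUnitalCStarAlgebra A] (φ : A →L[ℂ] ℂ) : Prop :=
  IsPositiveFunctional φ ∧ ‖φ‖ = 1

/-- Pure states: the states `φ` such that each positive functional `τ ≤ φ` is of the form `t φ`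
with `t ∈ [0, 1]`. -/
def IsPureState {A : Type u} [NonUnitalCStarAlgebra A] (φ : A →L[ℂ] ℂ) : Prop :=
  IsState φ ∧ ∀ τ : A →L[ℂ] ℂ, IsPositiveFunctional τ → IsPositiveFunctional (φ - τ) →
    ∃ t : ℝ, 0 ≤ t ∧ t ≤ 1 ∧ τ = (t : ℂ) • φ

/-- The set of pure states of `A`. -/
@[ext]
structure PureState (A : Type u) [NonUnitalCStarAlgebra A] : Type u where
  functional : A →L[ℂ] ℂ
  isPure : IsPureState functional

/-- The weak-* uniformity (and with it the weak-* topology) on the pure states. -/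
noncomputable instance PureState.uniformSpace (A : Type u) [NonUnitalCStarAlgebra A] :
    UniformSpace (PureState A) :=
  UniformSpace.comap (fun (ω : PureState A) (a : A) => ω.functional a) inferInstance

variable {A : Type u} [NonUnitalCStarAlgebra A]

attribute [local instance] CStarAlgebra.spectralOrder CStarAlgebra.spectralOrderedRing

/-- A pure state as a positive linear functional. -/
noncomputable def PureState.toPositive (ω : PureState A) : A →ₚ[ℂ] ℂ where
  toLinearMap := ω.functional.toLinearMap
  monotone' := by
    intro a b hab
    have h : 0 ≤ b - a := sub_nonneg.2 hab
    obtain ⟨c, hc⟩ := CStarAlgebra.nonneg_iff_eq_star_mul_self.1 h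
    have := ω.isPure.1.1 c
    rw [← hc, map_sub] at this
    exact sub_nonneg.1 this

theorem PureState.toPositive_apply (ω : PureState A) (a : A) :
    ω.toPositive a = ω.functional a := rfl

/-- The GNS representation of a pure state. -/
noncomputable def PureState.gns (ω : PureState A) : HilbertRep A where
  space := ω.toPositive.GNS
  hom := ω.toPositive.gnsNonUnitalStarAlgHom

/-- A pure state is the vector state of a vector of its GNS representation. -/
theorem PureState.exists_gns_vector (ω : PureState A) : ∃ ζ : ω.gns.space,
    (∀ a, ω.functional a = ⟪ζ, ω.gns.hom a ζ⟫_ℂ) ∧ DenseRange fun a => ω.gns.hom a ζ := by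
  obtain ⟨ζ, h1, h2⟩ := _root_.exists_gns_vector ω.toPositive
  refine ⟨ζ, fun a => ?_, ?_⟩
  · change _ = ⟪ζ, ω.toPositive.gnsNonUnitalStarAlgHom a ζ⟫_ℂ
    rw [h2, h1]; rfl
  · have : (fun a => ω.gns.hom a ζ) =
        (fun v : ω.toPositive.PreGNS => (v : ω.toPositive.GNS)) ∘ ω.toPositive.toPreGNS :=
      funext h2
    rw [this]
    exact UniformSpace.Completion.denseRange_coe.comp ω.toPositive.toPreGNS.surjective.denseRange
      (UniformSpace.Completion.continuous_coe _)

/-- A representation with a cyclic vector whose vector state is pure is irreducible. -/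
theorem HilbertRep.isIrreducible_of_pure (π : HilbertRep A) (ω : PureState A) (ζ : π.space)
    (hζ : ∀ a, ω.functional a = ⟪ζ, π.hom a ζ⟫_ℂ) (hd : DenseRange fun a => π.hom a ζ) :
    π.IsIrreducible := by
  have hω : ω.functional ≠ 0 := by
    intro h
    have := ω.isPure.1.2
    rw [h, norm_zero] at this
    exact zero_ne_one this
  refine ⟨?_, fun K hK hinv => ?_⟩
  · by_contra! h
    exact hω (ContinuousLinearMap.ext fun a => by simp [hζ, h])
  have : CompleteSpace K := hK.completeSpace_coe
  let P : π.space →L[ℂ] π.space := K.starProjection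
  have hadj : ∀ (a : A) (v w : π.space),
      ⟪π.hom (star a) v, w⟫_ℂ = ⟪v, π.hom a w⟫_ℂ := by
    intro a v w
    rw [map_star, ContinuousLinearMap.star_eq_adjoint, ContinuousLinearMap.adjoint_inner_left]
  have hPs : ∀ v w, ⟪P v, w⟫_ℂ = ⟪v, P w⟫_ℂ := fun v w =>
    K.inner_starProjection_left_eq_right v w
  have hPP : ∀ v, P (P v) = P v := fun v =>
    K.starProjection_eq_self_iff.2 (K.starProjection_apply_mem v)
  -- `P` commutes with the representation
  have hcomm : ∀ (a : A) (v : π.space), P (π.hom a v) = π.hom a (P v) := by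
    intro a v
    have h1 : P (π.hom a (P v)) = π.hom a (P v) :=
      K.starProjection_eq_self_iff.2 (hinv a _ (K.starProjection_apply_mem v))
    have h2 : P (π.hom a (v - P v)) = 0 := by
      refine ext_inner_right ℂ fun w => ?_
      rw [hPs, ← star_star a, hadj, inner_zero_left]
      have h3 : P (π.hom (star a) (P w)) = π.hom (star a) (P w) :=
        K.starProjection_eq_self_iff.2 (hinv _ _ (K.starProjection_apply_mem w))
      rw [← h3, ← hPs, map_sub, hPP, sub_self, inner_zero_left]
    rw [map_sub, map_sub, sub_eq_zero] at h2
    rw [h2, h1]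
  -- the functional `a ↦ ⟨ζ, P π(a) ζ⟩`
  have hbd : ∀ a : A, ‖π.hom a ζ‖ ≤ ‖ζ‖ * ‖a‖ := fun a => by
    rw [mul_comm]
    refine ((π.hom a).le_opNorm ζ).trans ?_
    gcongr
    exact NonUnitalStarAlgHom.norm_apply_le _ a
  let orb : A →L[ℂ] π.space := LinearMap.mkContinuous
    { toFun := fun a => π.hom a ζ
      map_add' := fun a b => by simp
      map_smul' := fun c a => by simp } ‖ζ‖ hbd
  let τ : A →L[ℂ] ℂ := (innerSL ℂ ζ).comp (P.comp orb)
  have hτ : ∀ a, τ a = ⟪ζ, P (π.hom a ζ)⟫_ℂ := fun a => rfl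
  have hmul : ∀ (T : π.space →L[ℂ] π.space),
      (∀ (a : A) (v : π.space), T (π.hom a v) = π.hom a (T v)) → ∀ a b : A,
      ⟪ζ, T (π.hom (star b * a) ζ)⟫_ℂ = ⟪π.hom b ζ, T (π.hom a ζ)⟫_ℂ := by
    intro T hT a b
    have : π.hom (star b * a) ζ = π.hom (star b) (π.hom a ζ) := by
      rw [map_mul]; rfl
    rw [this, hT, ← hadj, star_star]
  have hid : ∀ a b : A, ω.functional (star b * a) = ⟪π.hom b ζ, π.hom a ζ⟫_ℂ :=
    fun a b => by
      rw [hζ]; exact hmul (ContinuousLinearMap.id ℂ _) (fun _ _ => rfl) a b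
  have hP0 : ∀ v, 0 ≤ ⟪v, P v⟫_ℂ := fun v => by
    rw [← hPP, ← hPs, inner_self_eq_norm_sq_to_K]
    exact pow_nonneg (RCLike.ofReal_nonneg.2 (norm_nonneg _)) 2
  have hQ0 : ∀ v, 0 ≤ ⟪v, v - P v⟫_ℂ := fun v => by
    have : ⟪v, v - P v⟫_ℂ = ⟪v - P v, v - P v⟫_ℂ := by
      have h0 : ⟪P v, v - P v⟫_ℂ = 0 := by
        rw [hPs, map_sub, hPP, sub_self, inner_zero_right]
      rw [inner_sub_left v (P v) (v - P v), h0, sub_zero]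
    rw [this, inner_self_eq_norm_sq_to_K]
    exact pow_nonneg (RCLike.ofReal_nonneg.2 (norm_nonneg _)) 2
  obtain ⟨t, -, -, ht⟩ := ω.isPure.2 τ
    (fun a => by rw [hτ, hmul P hcomm]; exact hP0 _)
    (fun a => by
      rw [sub_apply, hτ, hmul P hcomm, hid, ← inner_sub_right]
      exact hQ0 _)
  have hPt : ∀ v, P v = (t : ℂ) • v := by
    have e1 : ∀ a : A, P (π.hom a ζ) = (t : ℂ) • π.hom a ζ := by
      intro a
      refine ext_inner_left ℂ fun w => ?_
      refine hd.induction_on w (isClosed_eq (by fun_prop) (by fun_prop)) fun b => ?_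
      have := congrArg (fun φ : A →L[ℂ] ℂ => φ (star b * a)) ht
      simp only [hτ, hmul P hcomm] at this
      rw [this, smul_apply, hid, inner_smul_right, smul_eq_mul]
    intro v
    exact hd.induction_on v (isClosed_eq (by fun_prop) (by fun_prop)) e1
  by_cases h0 : K = ⊥
  · exact Or.inl h0
  right
  obtain ⟨v, hv, hv0⟩ := (Submodule.ne_bot_iff K).1 h0
  have h1 : (t : ℂ) = 1 := by
    have e1 : P v = v := K.starProjection_eq_self_iff.2 hv
    rw [hPt] at e1
    have : ((t : ℂ) - 1) • v = 0 := by rw [sub_smul, e1, one_smul, sub_self]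
    exact sub_eq_zero.1 ((smul_eq_zero.1 this).resolve_right hv0)
  rw [Submodule.eq_top_iff']
  intro w
  have e1 := hPt w
  rw [h1, one_smul] at e1
  exact e1 ▸ K.starProjection_apply_mem w

/-- The GNS representation of a pure state is irreducible. -/
theorem PureState.gns_isIrreducible (ω : PureState A) : ω.gns.IsIrreducible := by
  obtain ⟨ζ, hζ, hd⟩ := ω.exists_gns_vector
  exact ω.gns.isIrreducible_of_pure ω ζ hζ hd

/-- The natural projection from the pure states onto the spectrum: a pure state is sent to the
class of its GNS representation. -/
noncomputable def gnsProj (ω : PureState A) : CStarSpectrum A :=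
  IrredRep.toSpectrum ⟨ω.gns, ω.gns_isIrreducible⟩

/-- If the class of `π` is the class of the GNS representation of `ω`, then `ω` is a vector state
of `π`. -/
theorem exists_vector_of_gnsProj_eq (ω : PureState A) (π : IrredRep A)
    (h : gnsProj ω = π.toSpectrum) :
    ∃ v : π.1.space, v ≠ 0 ∧ ∀ a, ω.functional a = ⟪v, π.1.hom a v⟫_ℂ := by
  obtain ⟨U, hU⟩ := Quotient.exact h
  obtain ⟨ζ, hζ, -⟩ := ω.exists_gns_vector
  have key : ∀ a, ω.functional a = ⟪U ζ, π.1.hom a (U ζ)⟫_ℂ := fun a => by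
    rw [← hU, LinearIsometryEquiv.inner_map_map]; exact hζ a
  refine ⟨U ζ, fun h0 => ?_, key⟩
  have h1 := ω.isPure.1.2
  have h2 : ω.functional = 0 := ContinuousLinearMap.ext fun a => by simp [key, h0]
  rw [h2, norm_zero] at h1
  exact zero_ne_one h1

end PureStates

section KahlerManifolds

/-- A chart `(V, b_V, H_V)` of a Kähler manifold `M`: a subset `V = source` of `M`, a map `b_V` from
`V` into a complex Hilbert space `H_V = model` (only the values on `source` matter), and the
Hermitian metric of `M`, written in this chart: `metric z v w` is the Hermitian inner product
(conjugate-linear in `v`) of the tangent vectors `v`, `w` at the point with coordinate `z`.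
The laws are in `KahlerChart.IsKahler`. -/
structure KahlerChart (M : Type u) : Type (u + 1) where
  model : Type u
  [normed : NormedAddCommGroup model]
  [inner : InnerProductSpace ℂ model]
  [complete : CompleteSpace model]
  source : Set M
  toFun : M → model
  metric : model → model →L⋆[ℂ] model →L[ℂ] ℂ

attribute [instance] KahlerChart.normed KahlerChart.inner KahlerChart.complete

variable {M N : Type u}

/-- The laws of a single chart: it is a bijection from its source onto an open subset of the
model, on which `metric` is a smooth Hermitian metric, with closed fundamental form
`Im metric z v w`. -/
structure KahlerChart.IsKahler (c : KahlerChart M) : Prop where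
  injOn : Set.InjOn c.toFun c.source
  isOpen_image : IsOpen (c.toFun '' c.source)
  hermitian : ∀ z ∈ c.toFun '' c.source, ∀ v w,
    c.metric z v w = (starRingEnd ℂ) (c.metric z w v)
  pos : ∀ z ∈ c.toFun '' c.source, ∃ r : ℝ, 0 < r ∧ ∀ v, r * ‖v‖ ^ 2 ≤ (c.metric z v v).re
  smooth : ContDiffOn ℝ (⊤ : ℕ∞) c.metric (c.toFun '' c.source)
  closed : ∀ z ∈ c.toFun '' c.source, ∀ u v w : c.model,
    fderiv ℝ (fun y => (c.metric y v w).im) z u + fderiv ℝ (fun y => (c.metric y w u).im) z v +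
      fderiv ℝ (fun y => (c.metric y u v).im) z w = 0

/-- In the charts `c` of `M` and `d` of `N`, the map `f : M → N` is holomorphic, with
open domain, and pulls the metric of `N` back to the metric of `M`. -/
def KahlerChart.IsHolomorphicIsometric (c : KahlerChart M) (d : KahlerChart N) (f : M → N) :
    Prop :=
  IsOpen (c.toFun '' (c.source ∩ f ⁻¹' d.source)) ∧
    ∃ τ : c.model → d.model, DifferentiableOn ℂ τ (c.toFun '' (c.source ∩ f ⁻¹' d.source)) ∧
      ∀ m ∈ c.source ∩ f ⁻¹' d.source, τ (c.toFun m) = d.toFun (f m) ∧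
        ∀ v w, d.metric (d.toFun (f m)) (fderiv ℂ τ (c.toFun m) v) (fderiv ℂ τ (c.toFun m) w) =
          c.metric (c.toFun m) v w

/-- The open sets of the manifold topology that a set of charts defines. -/
def IsAtlasOpen (K : Set (KahlerChart M)) (U : Set M) : Prop :=
  ∀ c ∈ K, IsOpen (c.toFun '' (c.source ∩ U))

/-- `M` with the atlas `K` is a (Hilbert) Kähler manifold. -/
structure IsKahlerManifold (K : Set (KahlerChart M)) : Prop where
  covers : ∀ m, ∃ c ∈ K, m ∈ c.source
  isKahler : ∀ c ∈ K, c.IsKahler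
  compatible : ∀ c ∈ K, ∀ d ∈ K, c.IsHolomorphicIsometric d id
  hausdorff : ∀ m n, m ≠ n → ∃ U V, IsAtlasOpen K U ∧ IsAtlasOpen K V ∧ m ∈ U ∧ n ∈ V ∧
    Disjoint U V

/-- The maximal atlas: the charts that are compatible with all charts of `K`. -/
def maximalKahlerAtlas (K : Set (KahlerChart M)) : Set (KahlerChart M) :=
  {c | c.IsKahler ∧ ∀ d ∈ K, c.IsHolomorphicIsometric d id ∧ d.IsHolomorphicIsometric c id}

/-- In the chart `c`, the subset `N` of `M` is the closed linear subspace `E`. -/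
def KahlerChart.IsAdapted (c : KahlerChart M) (N : Set M) (E : Submodule ℂ c.model) : Prop :=
  IsClosed (E : Set c.model) ∧
    c.toFun '' (c.source ∩ N) = (E : Set c.model) ∩ c.toFun '' c.source

/-- A closed Kähler submanifold `N` of the Kähler manifold `M` with atlas `K`: a subset that is
closed in the manifold topology and that is a closed linear subspace in suitable charts. -/
def IsClosedKahlerSubmanifold (K : Set (KahlerChart M)) (N : Set M) : Prop :=
  IsAtlasOpen K Nᶜ ∧
    ∀ m ∈ N, ∃ c ∈ maximalKahlerAtlas K, m ∈ c.source ∧ ∃ E, c.IsAdapted N E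

/-- A holomorphic Kähler isometry between Kähler manifolds. -/
def IsHolomorphicKahlerIsometry (K : Set (KahlerChart M)) (L : Set (KahlerChart N)) (f : M ≃ N) :
    Prop :=
  ∀ c ∈ K, ∀ d ∈ L, c.IsHolomorphicIsometric d f ∧ d.IsHolomorphicIsometric c f.symm

/-- The pullback of a chart along a map. -/
def KahlerChart.pullback (c : KahlerChart M) (f : N → M) : KahlerChart N where
  model := c.model
  source := f ⁻¹' c.source
  toFun := c.toFun ∘ f
  metric := c.metric

open scoped Classical in
/-- The chart that `c` induces on `N`, if `ι : N → M` is the inclusion of a subset that is the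
closed subspace `E` in the chart `c`. -/
noncomputable def KahlerChart.restrict (c : KahlerChart M) (E : Submodule ℂ c.model)
    (hE : IsClosed (E : Set c.model)) (ι : N → M) : KahlerChart N where
  model := E
  complete := hE.completeSpace_coe
  source := ι ⁻¹' c.source
  toFun n := if h : c.toFun (ι n) ∈ E then ⟨c.toFun (ι n), h⟩ else 0
  metric z := (c.metric z).bilinearComp E.subtypeL E.subtypeL

/-- The Kähler structure that `M` induces on a submanifold with inclusion map `ι : N → M`. -/
def inducedKahlerAtlas (K : Set (KahlerChart M)) (ι : N → M) : Set (KahlerChart N) :=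
  {e | ∃ c ∈ maximalKahlerAtlas K, ∃ E, ∃ h : c.IsAdapted (Set.range ι) E,
    e = c.restrict E h.1 ι}

end KahlerManifolds

section ProjectiveSpace

open scoped LinearAlgebra.Projectivization

variable {H : Type u} [NormedAddCommGroup H] [InnerProductSpace ℂ H]

/-- The Fubini-Study metric
`2 (⟨v, w⟩ / (1 + ‖z‖²) - ⟨v, z⟩⟨z, w⟩ / (1 + ‖z‖²)²)` in an affine chart of projective space. Its
distance is `√2 arccos |⟨x, y⟩|` for unit vectors `x`, `y`. -/
noncomputable def fubiniStudy (z : H) : H →L⋆[ℂ] H →L[ℂ] ℂ :=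
  (2 / (1 + (‖z‖ : ℂ) ^ 2)) • innerSL ℂ -
    (2 / (1 + (‖z‖ : ℂ) ^ 2) ^ 2) •
      ((ContinuousLinearMap.toSpanSingleton ℂ (innerSL ℂ z)).comp ((innerSL ℂ (E := H)).flip z))

theorem fubiniStudy_apply (z v w : H) :
    fubiniStudy z v w = 2 / (1 + (‖z‖ : ℂ) ^ 2) * ⟪v, w⟫_ℂ -
      2 / (1 + (‖z‖ : ℂ) ^ 2) ^ 2 * (⟪v, z⟫_ℂ * ⟪z, w⟫_ℂ) := by
  simp [fubiniStudy]

/-- The canonical chart of the projective space of `H` at a unit vector `ξ`: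
`[x] ↦ x / ⟨ξ, x⟩ - ξ ∈ {ξ}ᗮ`, for `⟨ξ, x⟩ ≠ 0`; this vector is the component orthogonal to `ξ` of
`x / ⟨ξ, x⟩`. -/
noncomputable def projectiveChart [CompleteSpace H] (ξ : H) : KahlerChart (ℙ ℂ H) where
  model := (ℂ ∙ ξ)ᗮ
  source := {q | ⟪ξ, q.rep⟫_ℂ ≠ 0}
  toFun q := (ℂ ∙ ξ)ᗮ.orthogonalProjectionOnto ((⟪ξ, q.rep⟫_ℂ)⁻¹ • q.rep)
  metric := fubiniStudy

/-- The Kähler structure of the projective space of a Hilbert space. -/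
def projectiveAtlas (H : Type u) [NormedAddCommGroup H] [InnerProductSpace ℂ H]
    [CompleteSpace H] : Set (KahlerChart (ℙ ℂ H)) :=
  {c | ∃ ξ : H, ‖ξ‖ = 1 ∧ c = projectiveChart ξ}

end ProjectiveSpace

section KahlerBundles

/-- The data of a bundle of Kähler manifolds: a uniform space `Total`, a topological space `Base`,
a projection, and an atlas of Kähler charts on each fiber. The laws are in
`KahlerBundle.IsUniformKahlerBundle`. -/
structure KahlerBundle : Type (max (u + 1) (v + 1)) where
  Total : Type u
  [uniform : UniformSpace Total]
  Base : Type v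
  [topology : TopologicalSpace Base]
  proj : Total → Base
  atlas : ∀ x : Base, Set (KahlerChart {e : Total // proj e = x})

attribute [instance] KahlerBundle.uniform KahlerBundle.topology

/-- Uniform Kähler bundles: the projection is a continuous open surjection, and the fibers are
Kähler manifolds. -/
structure KahlerBundle.IsUniformKahlerBundle (D : KahlerBundle.{u, v}) : Prop where
  continuous_proj : Continuous D.proj
  isOpenMap_proj : IsOpenMap D.proj
  surjective_proj : Function.Surjective D.proj
  isKahlerManifold : ∀ x, IsKahlerManifold (D.atlas x)

/-- A subbundle: subsets of the total space and of the base, the first of which is mapped into the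
second by the projection. -/
@[ext]
structure KahlerBundle.Sub (D : KahlerBundle.{u, v}) : Type (max u v) where
  total : Set D.Total
  base : Set D.Base
  mapsTo : ∀ e ∈ total, D.proj e ∈ base

/-- The inclusion of a fiber of a subbundle into the fiber of the bundle. -/
def KahlerBundle.Sub.fiberInclusion {D : KahlerBundle.{u, v}} (S : D.Sub) (x : S.base)
    (e : {e : S.total // (⟨D.proj e, S.mapsTo e e.2⟩ : S.base) = x}) :
    {e : D.Total // D.proj e = x} :=
  ⟨e.1, congrArg Subtype.val e.2⟩

/-- A subbundle as a bundle, with the induced topologies and the induced Kähler structures on the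
fibers. -/
def KahlerBundle.Sub.toBundle {D : KahlerBundle.{u, v}} (S : D.Sub) : KahlerBundle.{u, v} where
  Total := S.total
  Base := S.base
  proj e := ⟨D.proj e, S.mapsTo e e.2⟩
  atlas x := inducedKahlerAtlas (D.atlas x) (S.fiberInclusion x)

/-- The restriction of a bundle to a subset of its base. -/
def KahlerBundle.restrict (D : KahlerBundle.{u, v}) (U : Set D.Base) : D.Sub where
  total := D.proj ⁻¹' U
  base := U
  mapsTo _ he := he

/-- A Kähler subbundle of a uniform Kähler bundle `D`: a subbundle whose fibers are closed Kähler
submanifolds of the fibers of `D`, and that is a uniform Kähler bundle with the induced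
structure. -/
structure KahlerBundle.Sub.IsKahlerSubbundle {D : KahlerBundle.{u, v}} (S : D.Sub) : Prop where
  ambient : D.IsUniformKahlerBundle
  isUniformKahlerBundle : S.toBundle.IsUniformKahlerBundle
  fiber : ∀ x ∈ S.base,
    IsClosedKahlerSubmanifold (D.atlas x) {e : {e : D.Total // D.proj e = x} | e.1 ∈ S.total}

/-- A uniform Kähler isomorphism between bundles: a pair of homeomorphisms that intertwine the
projections and restrict to holomorphic Kähler isometries of the fibers. -/
def IsUniformKahlerIso (D D' : KahlerBundle.{u, v}) (ψ : D.Total ≃ₜ D'.Total)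
    (φ : D.Base ≃ₜ D'.Base) : Prop :=
  (∀ e, D'.proj (ψ e) = φ (D.proj e)) ∧
    ∀ x, ∃ f : {e : D.Total // D.proj e = x} ≃ {e : D'.Total // D'.proj e = φ x},
      (∀ e, (f e).1 = ψ e.1) ∧ IsHolomorphicKahlerIsometry (D.atlas x) (D'.atlas (φ x)) f

end KahlerBundles

section PureStateBundle

open scoped LinearAlgebra.Projectivization

variable {A : Type u} [NonUnitalCStarAlgebra A]

/-- For `[π] = x`, the map from the fiber over `x` to the projective space of the space of `π`
that sends `ω` to `[v]`, where `ω = ⟨v, π(·) v⟩`. -/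
noncomputable def fiberToProjective (x : CStarSpectrum A) (π : IrredRep A)
    (h : π.toSpectrum = x) (ω : {ω : PureState A // gnsProj ω = x}) : ℙ ℂ π.1.space :=
  Projectivization.mk ℂ (exists_vector_of_gnsProj_eq ω.1 π (ω.2.trans h.symm)).choose
    (exists_vector_of_gnsProj_eq ω.1 π (ω.2.trans h.symm)).choose_spec.1

/-- The uniform Kähler bundle of `A`: the pure states over the spectrum. A fiber gets its Kähler
structure from the projective space of a representation in the class (different
representations give the same structure, by unitary equivalence). -/
noncomputable def pureStateBundle (A : Type u) [NonUnitalCStarAlgebra A] :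
    KahlerBundle.{u, u + 1} where
  Total := PureState A
  Base := CStarSpectrum A
  proj := gnsProj
  atlas x := {c | ∃ d ∈ projectiveAtlas (Quotient.out x : IrredRep A).1.space,
    c = d.pullback (fiberToProjective x (Quotient.out x) (Quotient.out_eq x))}

end PureStateBundle

section Hereditary

variable {A : Type u} [NonUnitalCStarAlgebra A]

/-- Hereditary subalgebras: `0 ≤ a ≤ b` and `b ∈ B` imply `a ∈ B`. -/
def IsHereditary [PartialOrder A] (B : NonUnitalStarSubalgebra ℂ A) : Prop :=
  ∀ a b : A, 0 ≤ a → a ≤ b → b ∈ B → a ∈ B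

/-- Two-sided ideals. -/
def IsTwoSidedIdeal (B : NonUnitalStarSubalgebra ℂ A) : Prop :=
  ∀ a b : A, b ∈ B → a * b ∈ B ∧ b * a ∈ B

/-- The set of the classes `[π]` in the spectrum of `A` with `π(B) ≠ 0`. -/
def nonvanishingOn (B : NonUnitalStarSubalgebra ℂ A) : Set (CStarSpectrum A) :=
  {x | ∃ b ∈ B, b ∉ x.ker}

/-- The closed linear span of `π(B)H`. -/
def HilbertRep.essentialSpace (π : HilbertRep A) (B : NonUnitalStarSubalgebra ℂ A) :
    Submodule ℂ π.space :=
  (Submodule.span ℂ {w | ∃ b ∈ B, ∃ v, w = π.hom b v}).topologicalClosure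

theorem HilbertRep.hom_mem_essentialSpace (π : HilbertRep A) (B : NonUnitalStarSubalgebra ℂ A)
    {b : A} (hb : b ∈ B) (v : π.space) : π.hom b v ∈ π.essentialSpace B :=
  Submodule.le_topologicalClosure _ (Submodule.subset_span ⟨b, hb, v, rfl⟩)

/-- The representation `π_B` of `B` on the closed linear span of `π(B)H`. -/
noncomputable def HilbertRep.essentialRestriction (π : HilbertRep A)
    (B : NonUnitalStarSubalgebra ℂ A) [IsClosed (B : Set A)] : HilbertRep B where
  space := π.essentialSpace B
  complete := (Submodule.isClosed_topologicalClosure _).completeSpace_coe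
  hom :=
    haveI : CompleteSpace (π.essentialSpace B) :=
      (Submodule.isClosed_topologicalClosure _).completeSpace_coe
    { toFun := fun b => ((π.hom (b : A)).comp (π.essentialSpace B).subtypeL).codRestrict
        (π.essentialSpace B) fun v => by
          exact π.hom_mem_essentialSpace B b.2 (v : π.space)
      map_smul' := fun c b => by ext v; simp; rfl
      map_zero' := by ext v; simp
      map_add' := fun b c => by ext v; simp; rfl
      map_mul' := fun b c => by ext v; simp; rfl
      map_star' := fun b => by
        refine (ContinuousLinearMap.eq_adjoint_iff _ _).mpr fun v w => ?_
        change ⟪π.hom (star (b : A)) (v : π.space), (w : π.space)⟫_ℂ =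
          ⟪(v : π.space), π.hom (b : A) (w : π.space)⟫_ℂ
        rw [map_star, ContinuousLinearMap.star_eq_adjoint,
          ContinuousLinearMap.adjoint_inner_left] }

/-- `Ξ τ` is a pure state of `A` that extends `τ`, and it is the only state of `A` that
extends `τ`. -/
def IsUniqueExtensionMap (B : NonUnitalStarSubalgebra ℂ A) [IsClosed (B : Set A)]
    (Ξ : PureState B → PureState A) : Prop :=
  ∀ τ : PureState B, (∀ b : B, (Ξ τ).functional b = τ.functional b) ∧
    ∀ ρ : A →L[ℂ] ℂ, IsState ρ → (∀ b : B, ρ b = τ.functional b) → ρ = (Ξ τ).functional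

end Hereditary

/-!
# The bundle of pure states of a hereditary subalgebra

*The bundle of pure states.* By the GNS construction, a pure state is a vector state of an
irreducible representation, and by Schur's lemma two unit vectors of such a representation give the
same state only if they are proportional. Hence the fiber over `[π]` is the projective space of the
space of `π` (`fiberToProjective_bijective`). The affine charts of a projective space are Kähler
charts, because the Fubini-Study metric is closed and has a form in homogeneous coordinates that
does not depend on the chart (`isKahlerManifold_projectiveAtlas`). The projection is continuous,
because the kernel of a GNS representation is described by equations in the state. It is open
(`isOpenMap_gnsProj`): if the kernel of `π_ω` contains the intersection of the kernels of a set of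
irreducible representations, then `ω` lies in the closed convex hull of `0` and of the pure states
over this set, hence, by Milman's theorem, in the closure of these pure states.

*Extension of pure states.* Let `B` be a hereditary subalgebra of `A`, so that `BAB ⊆ B`, and let
`e` run through an approximate unit of `B`. A positive functional `ρ` on `A` that attains its norm
on `B` satisfies `ρ(a) = lim ρ(eae)`, so it is determined by its restriction to `B`
(`IsHereditary.functional_ext`). This gives the uniqueness of the extension, its purity and,
together with the compactness of the set of quasi-states, its continuity; the limit of `τ(eae)`
gives the existence. Thus `Ξ` is the embedding `pureExtension`.

*The spectrum.* If `π` is irreducible and `π(B) ≠ 0`, the same limits show that `π_B` is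
irreducible, and that the extension of a vector state of `π_B` is the state of the same vector in
`π`. All vectors of `π` that implement extended states arise in this way, so the extension of pure
states covers the bijection `[π_B] ↦ [π]` (`gnsProj_pureExtension_eq_iff`). This bijection is a
homeomorphism, because kernels of irreducible representations are prime: a set `S` lies in the
kernel of `π` if and only if `BASAB ⊆ B` does (`isInducing_spectrumExtension`).

*The Kähler structure.* On the fibers, the extension of pure states is the map of projective spaces
given by an isometric linear map `V`, the inclusion of the essential space. In the charts at `ξ`
and `V ξ`, this map is the restriction of `V` to the orthogonal complement of `ξ`, so its image is
a closed linear subspace and the map is a holomorphic isometry onto it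
(`isClosedKahlerSubmanifold_range`, `isHolomorphicKahlerIsometry_projectiveMap`). A subset that is
a closed linear subspace in suitable charts inherits a Kähler structure
(`IsKahlerManifold.induced`).

*Ideals.* The extended states of the fiber over `[π]` are the vector states of the essential space
of `B`. If `B` is an ideal, this space is invariant under `A`, so it is the whole space.
Conversely, if `B` is not an ideal, there is a positive element `d ∉ B` of the ideal generated by
`B`, and by the Hahn-Banach and Krein-Milman theorems a pure state that vanishes on `B` but not at
`d` (`IsHereditary.exists_pureState`). It lies over a point of the spectrum where `B` does not
vanish, but it is not an extended state.
-/

/-! ### Milman's theorem -/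

section Milman

open Set

/-- The convex hull of a finite union of compact convex sets is compact. -/
theorem isCompact_convexHull_biUnion {E ι : Type*} [AddCommGroup E] [Module ℝ E]
    [TopologicalSpace E] [IsTopologicalAddGroup E] [ContinuousSMul ℝ E]
    (s : Finset ι) (C : ι → Set E) (hc : ∀ i ∈ s, IsCompact (C i))
    (hconv : ∀ i ∈ s, Convex ℝ (C i)) : IsCompact (convexHull ℝ (⋃ i ∈ s, C i)) := by
  classical
  induction s using Finset.induction_on with
  | empty => simp
  | insert i s hi ih =>
    rw [Finset.set_biUnion_insert, ← convexHull_convexHull_union_right]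
    have h1 := hc i (by simp)
    have h2 := ih (fun j hj => hc j (by simp [hj])) fun j hj => hconv j (by simp [hj])
    have h3 := hconv i (by simp)
    rcases (C i).eq_empty_or_nonempty with h0 | h0
    · simpa [h0] using h2
    rcases (⋃ j ∈ s, C j).eq_empty_or_nonempty with h0' | h0'
    · simpa [h0', h3.convexHull_eq] using h1
    rw [h3.convexHull_union (convex_convexHull ℝ _) h0 h0'.convexHull]
    have : convexJoin ℝ (C i) (convexHull ℝ (⋃ j ∈ s, C j)) =
        (fun p : ℝ × E × E => (1 - p.1) • p.2.1 + p.1 • p.2.2) ''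
          (Icc 0 1 ×ˢ (C i) ×ˢ (convexHull ℝ (⋃ j ∈ s, C j))) := by
      ext x
      simp only [mem_convexJoin, segment_eq_image, mem_image, mem_prod, Prod.exists]
      constructor
      · rintro ⟨a, ha, b, hb, t, ht, rfl⟩
        exact ⟨t, a, b, ⟨ht, ha, hb⟩, rfl⟩
      · rintro ⟨t, a, b, ⟨ht, ha, hb⟩, rfl⟩
        exact ⟨a, ha, b, hb, t, ht, rfl⟩
    rw [this]
    exact (isCompact_Icc.prod (h1.prod h2)).image (by fun_prop)

/-- **Milman's theorem**: if the closed convex hull `C` of `V` is compact, then the extreme points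
of `C` belong to the closure of `V`. -/
theorem extremePoints_closure_convexHull_subset {E : Type*} [AddCommGroup E] [Module ℝ E]
    [TopologicalSpace E] [IsTopologicalAddGroup E] [ContinuousSMul ℝ E] [LocallyConvexSpace ℝ E]
    [T2Space E] {V : Set E} (hV : IsCompact (closure (convexHull ℝ V))) :
    (closure (convexHull ℝ V)).extremePoints ℝ ⊆ closure V := by
  intro x hx
  set C := closure (convexHull ℝ V) with hC
  have hVC : closure V ⊆ C := closure_mono (subset_convexHull ℝ V)
  have hcV : IsCompact (closure V) := hV.of_isClosed_subset isClosed_closure hVC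
  have hCc : Convex ℝ C := (convex_convexHull ℝ V).closure
  rw [← closure_closure, mem_closure_iff_nhds_zero]
  intro U hU
  have hU' : -U ∈ nhds (0 : E) := by
    have := continuous_neg.tendsto (0 : E)
    rw [neg_zero] at this
    exact this hU
  obtain ⟨W, ⟨hW, hWcl⟩, hWU⟩ := (closed_nhds_basis (0 : E)).mem_iff.1 hU'
  obtain ⟨D, ⟨hD, hDc⟩, hDW⟩ := (LocallyConvexSpace.convex_basis_zero ℝ E).mem_iff.1 hW
  have hDU : closure D ⊆ -U := (closure_minimal hDW hWcl).trans hWU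
  obtain ⟨t, ht, htV⟩ := hcV.elim_nhds_subcover (fun y => (fun z => z - y) ⁻¹' closure D)
    fun y _ => by
      have : Filter.Tendsto (fun z => z - y) (nhds y) (nhds 0) := by
        have h := (continuous_id.sub continuous_const : Continuous fun z : E => z - y).tendsto y
        simpa [Function.comp_def] using! h
      exact this (Filter.mem_of_superset hD subset_closure)
  let K : E → Set E := fun y => C ∩ (fun z => z - y) ⁻¹' closure D
  have hKcl : ∀ y, IsClosed ((fun z : E => z - y) ⁻¹' closure D) := fun y =>
    isClosed_closure.preimage (by fun_prop)
  have hKc : IsCompact (convexHull ℝ (⋃ y ∈ t, K y)) :=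
    isCompact_convexHull_biUnion t K (fun y _ => hV.inter_right (hKcl y)) fun y _ => by
      refine hCc.inter ?_
      have := hDc.closure.translate_preimage_left (-y)
      simpa only [← sub_eq_add_neg] using this
  have hKC : (⋃ y ∈ t, K y) ⊆ C := iUnion₂_subset fun y _ => inter_subset_left
  have hsub : C ⊆ convexHull ℝ (⋃ y ∈ t, K y) := by
    refine closure_minimal (convexHull_mono fun z hz => ?_) hKc.isClosed
    have h1 := htV (subset_closure hz)
    simp only [mem_iUnion] at h1 ⊢
    obtain ⟨y, hy, h⟩ := h1
    exact ⟨y, hy, hVC (subset_closure hz), h⟩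
  have hx' : x ∈ (convexHull ℝ (⋃ y ∈ t, K y)).extremePoints ℝ :=
    inter_extremePoints_subset_extremePoints_of_subset (convexHull_min hKC hCc)
      ⟨hsub hx.1, hx⟩
  have := extremePoints_convexHull_subset hx'
  simp only [mem_iUnion] at this
  obtain ⟨y, hy, -, hxy⟩ := this
  refine ⟨y, ht y hy, ?_⟩
  have := hDU hxy
  simpa using this

end Milman

/-! ### Representations, vector functionals and pure states -/

section Representations

open Filter Topology

/-- Every C*-algebra has an approximate unit of self-adjoint contractions. -/
theorem exists_selfAdjoint_approximateUnit (A : Type u) [NonUnitalCStarAlgebra A] :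
    ∃ l : Filter A, l.IsApproximateUnit ∧ (∀ᶠ e in l, star e = e) ∧ ∀ᶠ e in l, ‖e‖ ≤ 1 :=
  let := CStarAlgebra.spectralOrder A
  have := CStarAlgebra.spectralOrderedRing A
  have h := CStarAlgebra.increasingApproximateUnit A
  ⟨_, h.toIsApproximateUnit, h.eventually_star_eq, h.eventually_norm⟩

theorem exists_norm_eq_one (H : Type*) [NormedAddCommGroup H] [NormedSpace ℂ H] [Nontrivial H] :
    ∃ x : H, ‖x‖ = 1 := by
  obtain ⟨x, hx⟩ := exists_ne (0 : H)
  exact ⟨((‖x‖⁻¹ : ℝ) : ℂ) • x, by simp [norm_smul, hx]⟩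

variable {A : Type u} [NonUnitalCStarAlgebra A]

namespace HilbertRep

variable (π ρ : HilbertRep A)

theorem hom_mul_apply (a b : A) (v : π.space) : π.hom (a * b) v = π.hom a (π.hom b v) := by
  rw [map_mul]; rfl

theorem inner_hom_star_left (a : A) (v w : π.space) :
    ⟪π.hom (star a) v, w⟫_ℂ = ⟪v, π.hom a w⟫_ℂ := by
  rw [map_star, ContinuousLinearMap.star_eq_adjoint, ContinuousLinearMap.adjoint_inner_left]

theorem inner_hom_star_right (a : A) (v w : π.space) :
    ⟪v, π.hom (star a) w⟫_ℂ = ⟪π.hom a v, w⟫_ℂ := by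
  rw [← inner_hom_star_left, star_star]

theorem norm_hom_apply_le (a : A) (v : π.space) : ‖π.hom a v‖ ≤ ‖a‖ * ‖v‖ := by
  refine ((π.hom a).le_opNorm v).trans ?_
  gcongr
  exact NonUnitalStarAlgHom.norm_apply_le _ a

/-- The orbit map `a ↦ π(a)v` of a vector. -/
noncomputable def orbit (v : π.space) : A →L[ℂ] π.space := LinearMap.mkContinuous
  { toFun := fun a => π.hom a v
    map_add' := fun a b => by simp
    map_smul' := fun c a => by simp } ‖v‖ fun a => by
      rw [mul_comm]; exact π.norm_hom_apply_le a v

@[simp]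
theorem orbit_apply (v : π.space) (a : A) : π.orbit v a = π.hom a v := rfl

/-- The functional `a ↦ ⟨v, π(a)v⟩`. -/
noncomputable def vectorFunctional (v : π.space) : A →L[ℂ] ℂ := (innerSL ℂ v).comp (π.orbit v)

theorem vectorFunctional_apply (v : π.space) (a : A) :
    π.vectorFunctional v a = ⟪v, π.hom a v⟫_ℂ := rfl

theorem vectorFunctional_star_mul (v : π.space) (a b : A) :
    π.vectorFunctional v (star a * b) = ⟪π.hom a v, π.hom b v⟫_ℂ := by
  rw [vectorFunctional_apply, hom_mul_apply, inner_hom_star_right]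

theorem isPositiveFunctional_vectorFunctional (v : π.space) :
    IsPositiveFunctional (π.vectorFunctional v) := fun a => by
  rw [vectorFunctional_star_mul, inner_self_eq_norm_sq_to_K]
  exact pow_nonneg (RCLike.ofReal_nonneg.2 (norm_nonneg _)) 2

/-- The vectors on which a net of contractions `π(e)` converges to the identity form a closed
set. -/
theorem isClosed_setOf_tendsto {l : Filter A} (hl : ∀ᶠ e in l, ‖e‖ ≤ 1) :
    IsClosed {w : π.space | Tendsto (fun e => π.hom e w) l (𝓝 w)} := by
  rw [← isSeqClosed_iff_isClosed]
  intro x w hx hxw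
  change Tendsto _ _ _
  rw [Metric.tendsto_nhds]
  intro ε hε
  obtain ⟨n, hn⟩ := (Metric.tendsto_nhds.1 hxw (ε / 3) (by positivity)).exists
  have h1 : Tendsto (fun e => π.hom e (x n)) l (𝓝 (x n)) := hx n
  filter_upwards [hl, Metric.tendsto_nhds.1 h1 (ε / 3) (by positivity)] with e he h2
  have h3 : dist (π.hom e w) (π.hom e (x n)) ≤ dist (x n) w := by
    rw [dist_eq_norm, dist_comm, dist_eq_norm, ← map_sub]
    refine (π.norm_hom_apply_le _ _).trans ?_
    calc _ ≤ 1 * ‖w - x n‖ := by gcongr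
      _ = _ := one_mul _
  calc dist (π.hom e w) w ≤ dist (π.hom e w) (π.hom e (x n)) + dist (π.hom e (x n)) (x n) +
        dist (x n) w := dist_triangle4 _ _ _ _
    _ < ε / 3 + ε / 3 + ε / 3 := by
      have := h3.trans_lt hn
      linarith
    _ = ε := by ring

theorem tendsto_hom_approximateUnit {l : Filter A} (hl : l.IsApproximateUnit)
    (hl1 : ∀ᶠ e in l, ‖e‖ ≤ 1) {v : π.space} (hv : DenseRange fun a => π.hom a v) (w : π.space) :
    Tendsto (fun e => π.hom e w) l (𝓝 w) := by
  refine hv.induction_on w (π.isClosed_setOf_tendsto hl1) fun a => ?_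
  have h := ((π.orbit v).continuous.tendsto a).comp (hl.tendsto_mul_right a)
  refine h.congr fun e => ?_
  simp

/-- If `π(e)v → v`, then the values at `e` of the vector functional of `v` converge to `‖v‖²`. -/
theorem tendsto_vectorFunctional {l : Filter A} {v : π.space}
    (h : Tendsto (fun e => π.hom e v) l (𝓝 v)) :
    Tendsto (fun e => π.vectorFunctional v e) l (𝓝 ((‖v‖ : ℂ) ^ 2)) := by
  have h1 := (tendsto_const_nhds (x := v)).inner (𝕜 := ℂ) h
  rwa [inner_self_eq_norm_sq_to_K] at h1

theorem norm_vectorFunctional_le (v : π.space) : ‖π.vectorFunctional v‖ ≤ ‖v‖ ^ 2 := by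
  refine ContinuousLinearMap.opNorm_le_bound _ (by positivity) fun a => ?_
  rw [vectorFunctional_apply]
  calc _ ≤ ‖v‖ * ‖π.hom a v‖ := norm_inner_le_norm _ _
    _ ≤ ‖v‖ * (‖a‖ * ‖v‖) := by gcongr; exact π.norm_hom_apply_le a v
    _ = _ := by ring

/-- If `π(e)v → v` for a net of contractions, then the vector functional of `v` has the norm `‖v‖²`.
Some such hypothesis is necessary, because `π` may be degenerate. -/
theorem norm_vectorFunctional {l : Filter A} [l.NeBot] (hl1 : ∀ᶠ e in l, ‖e‖ ≤ 1) {v : π.space}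
    (h : Tendsto (fun e => π.hom e v) l (𝓝 v)) : ‖π.vectorFunctional v‖ = ‖v‖ ^ 2 := by
  refine le_antisymm (π.norm_vectorFunctional_le v) ?_
  have h1 := (π.tendsto_vectorFunctional h).norm
  have h2 : ‖((‖v‖ : ℂ) ^ 2)‖ = ‖v‖ ^ 2 := by simp
  rw [h2] at h1
  refine le_of_tendsto h1 ?_
  filter_upwards [hl1] with e he
  calc _ ≤ ‖π.vectorFunctional v‖ * ‖e‖ := ContinuousLinearMap.le_opNorm _ _
    _ ≤ ‖π.vectorFunctional v‖ * 1 := by gcongr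
    _ = _ := mul_one _

theorem norm_vectorFunctional_of_denseRange {v : π.space}
    (hv : DenseRange fun a => π.hom a v) : ‖π.vectorFunctional v‖ = ‖v‖ ^ 2 := by
  obtain ⟨l, hl, -, hl1⟩ := exists_selfAdjoint_approximateUnit A
  have := hl.neBot
  exact π.norm_vectorFunctional hl1 (π.tendsto_hom_approximateUnit hl hl1 hv v)

variable {π ρ}

/-- Nonzero vectors of irreducible representations are cyclic. -/
theorem IsIrreducible.denseRange (hπ : π.IsIrreducible) {v : π.space} (hv : v ≠ 0) :
    DenseRange fun a => π.hom a v := by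
  let K : Submodule ℂ π.space := (LinearMap.range (π.orbit v).toLinearMap).topologicalClosure
  have hK : ∀ a, ∀ w ∈ K, π.hom a w ∈ K := by
    intro a w hw
    have h1 : Set.MapsTo (π.hom a) (LinearMap.range (π.orbit v).toLinearMap : Set π.space)
        (LinearMap.range (π.orbit v).toLinearMap : Set π.space) := by
      rintro _ ⟨b, rfl⟩
      exact ⟨a * b, π.hom_mul_apply a b v⟩
    exact h1.closure (π.hom a).continuous hw
  rcases hπ.2 K (Submodule.isClosed_topologicalClosure _) hK with h | h
  · exfalso
    have h0 : ∀ a, π.hom a v = 0 := fun a => by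
      have : π.hom a v ∈ K := Submodule.le_topologicalClosure _ ⟨a, rfl⟩
      rw [h] at this
      simpa using this
    have h1 := hπ.2 (ℂ ∙ v) (Submodule.closed_of_finiteDimensional _) fun a w hw => by
      obtain ⟨c, rfl⟩ := Submodule.mem_span_singleton.1 hw
      simp [h0]
    rcases h1 with h1 | h1
    · exact hv (by simpa using h1)
    · obtain ⟨a, ha⟩ := hπ.1
      refine ha (ContinuousLinearMap.ext fun w => ?_)
      have hw : w ∈ ℂ ∙ v := h1 ▸ Submodule.mem_top
      obtain ⟨c, rfl⟩ := Submodule.mem_span_singleton.1 hw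
      simp [h0]
  · intro w
    have : w ∈ K := h ▸ Submodule.mem_top
    exact this

theorem IsIrreducible.norm_vectorFunctional (hπ : π.IsIrreducible) (v : π.space) :
    ‖π.vectorFunctional v‖ = ‖v‖ ^ 2 := by
  rcases eq_or_ne v 0 with rfl | hv
  · have : π.vectorFunctional 0 = 0 := by ext; simp [vectorFunctional_apply]
    simp [this]
  · exact π.norm_vectorFunctional_of_denseRange (hπ.denseRange hv)

/-- If `‖ρ(a)w‖ ≤ ‖π(a)v‖` for all `a`, where `v` is cyclic, then `π(a)v ↦ ρ(a)w` extends to a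
contraction that intertwines `π` and `ρ`. -/
theorem exists_intertwiner {v : π.space} (hv : DenseRange fun a => π.hom a v) {w : ρ.space}
    (h : ∀ a, ‖ρ.hom a w‖ ≤ ‖π.hom a v‖) (hw : w ∈ closure (Set.range fun a => ρ.hom a w)) :
    ∃ W : π.space →L[ℂ] ρ.space, (∀ x, ‖W x‖ ≤ ‖x‖) ∧ W v = w ∧
      ∀ a x, W (π.hom a x) = ρ.hom a (W x) := by
  have h' : ∀ a, ‖(ρ.orbit w).toLinearMap a‖ ≤ 1 * ‖(π.orbit v).toLinearMap a‖ := fun a => by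
    simpa using h a
  have hW : ∀ a, (ρ.orbit w).toLinearMap.extendOfNorm (π.orbit v).toLinearMap (π.hom a v) =
      ρ.hom a w := LinearMap.extendOfNorm_eq hv ⟨1, h'⟩
  have hWb := LinearMap.norm_extendOfNorm_apply_le hv 1 h'
  set W := (ρ.orbit w).toLinearMap.extendOfNorm (π.orbit v).toLinearMap
  have hint : ∀ a x, W (π.hom a x) = ρ.hom a (W x) := fun a x =>
    hv.induction_on x (isClosed_eq (by fun_prop) (by fun_prop)) fun b => by
      rw [← hom_mul_apply, hW, hom_mul_apply, hW]
  refine ⟨W, fun x => by simpa using hWb x, ?_, hint⟩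
  obtain ⟨l, hl, -, hl1⟩ := exists_selfAdjoint_approximateUnit A
  have := hl.neBot
  have h1 := (W.continuous.tendsto v).comp (π.tendsto_hom_approximateUnit hl hl1 hv v)
  have h2 : Tendsto (fun e => ρ.hom e w) l (𝓝 w) := by
    refine closure_minimal ?_ (ρ.isClosed_setOf_tendsto hl1) hw
    rintro _ ⟨a, rfl⟩
    have h := ((ρ.orbit w).continuous.tendsto a).comp (hl.tendsto_mul_right a)
    exact h.congr fun e => by simp
  refine tendsto_nhds_unique h1 (h2.congr fun e => ?_)
  simp [hW]

/-- Cyclic representations with the same vector functional are unitarily equivalent. -/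
theorem exists_unitary_of_vectorFunctional_eq {v : π.space}
    (hv : DenseRange fun a => π.hom a v) {w : ρ.space} (hw : DenseRange fun a => ρ.hom a w)
    (h : π.vectorFunctional v = ρ.vectorFunctional w) :
    ∃ U : π.space ≃ₗᵢ[ℂ] ρ.space, (∀ a x, U (π.hom a x) = ρ.hom a (U x)) ∧ U v = w := by
  have hn : ∀ a, ‖ρ.hom a w‖ = ‖π.hom a v‖ := fun a => by
    have h1 := congrArg (fun φ : A →L[ℂ] ℂ => φ (star a * a)) h
    simp only [vectorFunctional_star_mul, inner_self_eq_norm_sq_to_K] at h1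
    have h2 : ‖π.hom a v‖ ^ 2 = ‖ρ.hom a w‖ ^ 2 := by exact_mod_cast h1
    exact ((sq_eq_sq₀ (norm_nonneg _) (norm_nonneg _)).1 h2).symm
  obtain ⟨W, hW1, hWv, hWi⟩ := exists_intertwiner hv (fun a => (hn a).le) (hw w)
  obtain ⟨W', hW1', hWv', hWi'⟩ := exists_intertwiner hw (fun a => (hn a).ge) (hv v)
  have e1 : ∀ x, W' (W x) = x := fun x =>
    hv.induction_on x (isClosed_eq (by fun_prop) (by fun_prop)) fun a => by
      rw [hWi, hWv, hWi', hWv']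
  have e2 : ∀ x, W (W' x) = x := fun x =>
    hw.induction_on x (isClosed_eq (by fun_prop) (by fun_prop)) fun a => by
      rw [hWi', hWv', hWi, hWv]
  let U : π.space ≃ₗᵢ[ℂ] ρ.space :=
    { toLinearEquiv := LinearEquiv.ofLinearMap W.toLinearMap W'.toLinearMap
        (LinearMap.ext e2) (LinearMap.ext e1)
      norm_map' := fun x => le_antisymm (hW1 x) (by
        conv_lhs => rw [← e1 x]
        exact hW1' _) }
  exact ⟨U, hWi, hWv⟩

/-- **Schur's lemma** for self-adjoint operators: the kernels of the negative parts `(T - c)⁻` are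
invariant, so `T - c` is positive or negative for each real number `c`, which leaves only one value
for the quadratic form of `T` on unit vectors. -/
theorem IsIrreducible.exists_eq_smul_of_isSelfAdjoint (hπ : π.IsIrreducible)
    {T : π.space →L[ℂ] π.space} (hT : IsSelfAdjoint T)
    (hc : ∀ a x, T (π.hom a x) = π.hom a (T x)) : ∃ c : ℝ, ∀ x, T x = (c : ℂ) • x := by
  -- `T - c` is positive or negative, for each real number `c`
  have key : ∀ c : ℝ, 0 ≤ T - (c : ℂ) • 1 ∨ 0 ≤ -(T - (c : ℂ) • 1) := by
    intro c
    set D := T - (c : ℂ) • (1 : π.space →L[ℂ] π.space) with hD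
    have hDs : IsSelfAdjoint D := by
      refine hT.sub (IsSelfAdjoint.smul ?_ (IsSelfAdjoint.one _))
      simp [isSelfAdjoint_iff]
    have hDc : ∀ a, Commute D (π.hom a) := fun a =>
      ContinuousLinearMap.ext fun x => by simp [hD, hc]
    have hNc : ∀ a, Commute D⁻ (π.hom a) := fun a => by
      rw [CFC.negPart_def]
      exact (hDc a).cfcₙ_real _
    have hk := hπ.2 (LinearMap.ker D⁻.toLinearMap) (D⁻).isClosed_ker fun a v hv => by
      have h1 : D⁻ v = 0 := hv
      have h2 := congrArg (fun S => S v) (hNc a).eq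
      change D⁻ (π.hom a v) = 0
      have h3 : D⁻ (π.hom a v) = π.hom a (D⁻ v) := h2
      rw [h3, h1, map_zero]
    rcases hk with h | h
    · right
      have h1 : D⁺ = 0 := ContinuousLinearMap.ext fun x => by
        have h2 : D⁻ (D⁺ x) = 0 := congrArg (fun S => S x) (CFC.negPart_mul_posPart D)
        have h3 : D⁺ x ∈ LinearMap.ker D⁻.toLinearMap := h2
        rw [h] at h3
        simpa using h3
      have h2 := CFC.posPart_sub_negPart D
      rw [h1, zero_sub] at h2
      rw [← h2, neg_neg]
      exact CFC.negPart_nonneg D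
    · left
      have h1 : D⁻ = 0 := ContinuousLinearMap.ext fun x => by
        have h3 : x ∈ LinearMap.ker D⁻.toLinearMap := h ▸ Submodule.mem_top
        exact h3
      have h2 := CFC.posPart_sub_negPart D
      rw [h1, sub_zero] at h2
      rw [← h2]
      exact CFC.posPart_nonneg D
  have hre : ∀ x, ((⟪x, T x⟫_ℂ).re : ℂ) = ⟪x, T x⟫_ℂ := fun x => by
    rw [← Complex.conj_eq_iff_re, inner_conj_symm]
    exact ((ContinuousLinearMap.isSelfAdjoint_iff_isSymmetric.1 hT) x x)
  have key' : ∀ c : ℝ, (∀ x, c * ‖x‖ ^ 2 ≤ (⟪x, T x⟫_ℂ).re) ∨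
      ∀ x, (⟪x, T x⟫_ℂ).re ≤ c * ‖x‖ ^ 2 := by
    have hin : ∀ (c : ℝ) (x : π.space), (⟪x, (T - (c : ℂ) • (1 : π.space →L[ℂ] π.space)) x⟫_ℂ).re =
        (⟪x, T x⟫_ℂ).re - c * ‖x‖ ^ 2 := fun c x => by
      have h1 : (T - (c : ℂ) • (1 : π.space →L[ℂ] π.space)) x = T x - (c : ℂ) • x := rfl
      rw [h1, inner_sub_right, inner_smul_right, inner_self_eq_norm_sq_to_K, Complex.sub_re,
        Complex.re_ofReal_mul]
      norm_cast
    intro c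
    refine (key c).imp (fun h x => ?_) fun h x => ?_
    · have h1 := ((ContinuousLinearMap.nonneg_iff_isPositive _).1 h).re_inner_nonneg_right x
      have h2 := hin c x
      simp only [RCLike.re_eq_complex_re] at h1
      linarith
    · have h1 := ((ContinuousLinearMap.nonneg_iff_isPositive _).1 h).re_inner_nonneg_right x
      have h2 := hin c x
      simp only [RCLike.re_eq_complex_re, neg_apply, inner_neg_right,
        Complex.neg_re] at h1
      linarith
  rcases subsingleton_or_nontrivial π.space with hs | hs
  · exact ⟨0, fun x => Subsingleton.elim _ _⟩
  obtain ⟨x₀, hx₀⟩ := exists_norm_eq_one π.space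
  set c := (⟪x₀, T x₀⟫_ℂ).re with hcdef
  have hform : ∀ y, (⟪y, T y⟫_ℂ).re = c * ‖y‖ ^ 2 := by
    intro y
    rcases eq_or_ne y 0 with rfl | hy
    · simp
    have hy' : 0 < ‖y‖ ^ 2 := by positivity
    obtain ⟨d, hd⟩ : ∃ d, (⟪y, T y⟫_ℂ).re = d * ‖y‖ ^ 2 := ⟨_, (div_mul_cancel₀ _ hy'.ne').symm⟩
    rw [hd]
    congr 1
    rcases key' ((c + d) / 2) with h | h
    all_goals
      have h1 := h x₀
      have h2 := h y
      rw [hx₀] at h1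
      rw [hd] at h2
    · have h2 := le_of_mul_le_mul_right h2 hy'
      linarith
    · have h2 := le_of_mul_le_mul_right h2 hy'
      linarith
  refine ⟨c, fun x => ?_⟩
  have h0 : T - (c : ℂ) • (1 : π.space →L[ℂ] π.space) = 0 := by
    rw [← ContinuousLinearMap.coe_inj, ContinuousLinearMap.toLinearMap_zero,
      ← inner_map_self_eq_zero]
    intro x
    have h1 : (T - (c : ℂ) • (1 : π.space →L[ℂ] π.space)).toLinearMap x = T x - (c : ℂ) • x := rfl
    have h2 : ⟪x, T x - (c : ℂ) • x⟫_ℂ = 0 := by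
      rw [inner_sub_right, inner_smul_right, ← hre, hform, inner_self_eq_norm_sq_to_K]
      push_cast
      exact sub_self _
    rw [h1, ← inner_conj_symm, h2, map_zero]
  have := congrArg (fun S => S x) h0
  simpa [sub_eq_zero] using this

/-- **Schur's lemma**: a bounded operator that commutes with an irreducible representation is a
scalar. -/
theorem IsIrreducible.exists_eq_smul (hπ : π.IsIrreducible) {T : π.space →L[ℂ] π.space}
    (hc : ∀ a x, T (π.hom a x) = π.hom a (T x)) : ∃ c : ℂ, ∀ x, T x = c • x := by
  have hc' : ∀ a x, (star T) (π.hom a x) = π.hom a ((star T) x) := by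
    intro a x
    refine ext_inner_left ℂ fun y => ?_
    rw [ContinuousLinearMap.star_eq_adjoint, ContinuousLinearMap.adjoint_inner_right,
      ← inner_hom_star_left, ← inner_hom_star_left, ContinuousLinearMap.adjoint_inner_right, hc]
  obtain ⟨c, hc1⟩ := hπ.exists_eq_smul_of_isSelfAdjoint (IsSelfAdjoint.add_star_self T)
    fun a x => by
      change T _ + (star T) _ = π.hom a (T x + (star T) x)
      rw [hc, hc', map_add]
  have hs : IsSelfAdjoint (Complex.I • (T - star T)) := by
    rw [isSelfAdjoint_iff, star_smul, star_sub, star_star, Complex.star_def, Complex.conj_I,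
      neg_smul, ← smul_neg, neg_sub]
  obtain ⟨d, hd1⟩ := hπ.exists_eq_smul_of_isSelfAdjoint hs fun a x => by
      change Complex.I • (T _ - (star T) _) = π.hom a (Complex.I • (T x - (star T) x))
      rw [hc, hc', map_smul, map_sub]
  refine ⟨((c : ℂ) - Complex.I * d) / 2, fun x => ?_⟩
  have h1 : T x + (star T) x = (c : ℂ) • x := hc1 x
  have h2 : Complex.I • (T x - (star T) x) = (d : ℂ) • x := hd1 x
  have h3 : T x - (star T) x = -(Complex.I * d) • x := by
    rw [neg_smul, mul_smul, ← h2, smul_smul, Complex.I_mul_I, neg_one_smul, neg_neg]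
  have h4 : (2 : ℂ) • T x = ((c : ℂ) - Complex.I * d) • x := by
    rw [sub_eq_add_neg, add_smul, ← h1, ← h3, two_smul]
    abel
  rw [div_eq_inv_mul, mul_smul, ← h4, smul_smul]
  norm_num

/-- Vectors of an irreducible representation with the same vector functional are proportional. -/
theorem IsIrreducible.exists_smul_eq_of_vectorFunctional_eq (hπ : π.IsIrreducible)
    {v w : π.space} (hv : v ≠ 0) (hw : w ≠ 0)
    (h : π.vectorFunctional v = π.vectorFunctional w) : ∃ c : ℂ, w = c • v := by
  obtain ⟨U, hU, hUv⟩ :=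
    exists_unitary_of_vectorFunctional_eq (hπ.denseRange hv) (hπ.denseRange hw) h
  obtain ⟨c, hc⟩ := hπ.exists_eq_smul (T := U.toLinearIsometry.toContinuousLinearMap) hU
  exact ⟨c, by rw [← hUv]; exact hc v⟩

theorem vectorFunctional_smul (c : ℂ) (hc : ‖c‖ = 1) (v : π.space) :
    π.vectorFunctional (c • v) = π.vectorFunctional v := by
  ext a
  rw [vectorFunctional_apply, vectorFunctional_apply, map_smul, inner_smul_left, inner_smul_right,
    ← mul_assoc, mul_comm _ c, Complex.mul_conj, Complex.normSq_eq_norm_sq, hc]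
  simp

end HilbertRep

/-- The GNS construction: each positive functional is the vector functional of a cyclic vector. -/
theorem IsPositiveFunctional.exists_cyclic {φ : A →L[ℂ] ℂ} (hφ : IsPositiveFunctional φ) :
    ∃ (π : HilbertRep A) (v : π.space), (DenseRange fun a => π.hom a v) ∧
      φ = π.vectorFunctional v := by
  let := CStarAlgebra.spectralOrder A
  have := CStarAlgebra.spectralOrderedRing A
  let f : A →ₚ[ℂ] ℂ :=
    { toLinearMap := φ.toLinearMap
      monotone' := fun a b hab => by
        obtain ⟨c, hc⟩ := CStarAlgebra.nonneg_iff_eq_star_mul_self.1 (sub_nonneg.2 hab)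
        have := hφ c
        rw [← hc, map_sub] at this
        exact sub_nonneg.1 this }
  let π : HilbertRep A := { space := f.GNS, hom := f.gnsNonUnitalStarAlgHom }
  obtain ⟨ζ, h1, h2⟩ := exists_gns_vector f
  refine ⟨π, ζ, ?_, ?_⟩
  · have : (fun a => π.hom a ζ) = (fun v : f.PreGNS => (v : f.GNS)) ∘ f.toPreGNS := funext h2
    rw [this]
    exact UniformSpace.Completion.denseRange_coe.comp f.toPreGNS.surjective.denseRange
      (UniformSpace.Completion.continuous_coe _)
  · ext a
    rw [HilbertRep.vectorFunctional_apply]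
    change φ a = ⟪ζ, f.gnsNonUnitalStarAlgHom a ζ⟫_ℂ
    rw [h2, h1]
    rfl

/-- Unit vectors of irreducible representations give pure states. -/
theorem HilbertRep.IsIrreducible.isPureState {π : HilbertRep A} (hπ : π.IsIrreducible)
    {v : π.space} (hv : ‖v‖ = 1) : IsPureState (π.vectorFunctional v) := by
  have hv0 : v ≠ 0 := by
    rintro rfl
    simp at hv
  refine ⟨⟨π.isPositiveFunctional_vectorFunctional v, by rw [hπ.norm_vectorFunctional, hv]; simp⟩,
    fun σ hσ hσ' => ?_⟩
  obtain ⟨ρ, w, hw, rfl⟩ := hσ.exists_cyclic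
  -- the functional is given by a contraction that intertwines the representations
  obtain ⟨W, hW1, hWv, hWi⟩ := HilbertRep.exists_intertwiner (π := π) (ρ := ρ)
    (hπ.denseRange hv0) (w := w) (fun a => by
      have h1 := hσ' a
      rw [sub_apply, HilbertRep.vectorFunctional_star_mul,
        HilbertRep.vectorFunctional_star_mul, inner_self_eq_norm_sq_to_K,
        inner_self_eq_norm_sq_to_K, sub_nonneg] at h1
      have h2 : ‖ρ.hom a w‖ ^ 2 ≤ ‖π.hom a v‖ ^ 2 := by exact_mod_cast h1
      exact (sq_le_sq₀ (norm_nonneg _) (norm_nonneg _)).1 h2) (hw w)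
  let T : π.space →L[ℂ] π.space := (ContinuousLinearMap.adjoint W).comp W
  have hTin : ∀ x y, ⟪x, T y⟫_ℂ = ⟪W x, W y⟫_ℂ := fun x y => by
    change ⟪x, (ContinuousLinearMap.adjoint W) (W y)⟫_ℂ = _
    rw [ContinuousLinearMap.adjoint_inner_right]
  obtain ⟨c, hc⟩ := hπ.exists_eq_smul (T := T) fun a x => ext_inner_left ℂ fun y => by
    rw [hTin, hWi, ← HilbertRep.inner_hom_star_left, ← hWi, ← hTin,
      HilbertRep.inner_hom_star_left]
  have hcv : c = (‖w‖ : ℂ) ^ 2 := by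
    have h1 := hTin v v
    rw [hc, inner_smul_right, inner_self_eq_norm_sq_to_K, inner_self_eq_norm_sq_to_K, hWv, hv]
      at h1
    simpa using h1
  refine ⟨‖w‖ ^ 2, by positivity, ?_, ?_⟩
  · have := hW1 v
    rw [hWv, hv] at this
    exact pow_le_one₀ (norm_nonneg _) this
  · ext a
    rw [smul_apply, HilbertRep.vectorFunctional_apply, HilbertRep.vectorFunctional_apply, ← hWv,
      ← hWi, ← hTin, hc, inner_smul_right, hcv, hWv]
    simp

theorem PureState.norm_vector {π : HilbertRep A} (hπ : π.IsIrreducible) {ω : PureState A}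
    {v : π.space} (h : ω.functional = π.vectorFunctional v) : ‖v‖ = 1 := by
  have h1 := ω.isPure.1.2
  rw [h, hπ.norm_vectorFunctional] at h1
  exact (pow_eq_one_iff_of_nonneg (norm_nonneg v) two_ne_zero).1 h1

/-- A pure state lies over `[π]` if and only if it is a vector state of `π`. -/
theorem gnsProj_eq_iff {ω : PureState A} {π : IrredRep A} :
    gnsProj ω = π.toSpectrum ↔ ∃ v : π.1.space, ω.functional = π.1.vectorFunctional v := by
  constructor
  · intro h
    obtain ⟨v, -, hv⟩ := exists_vector_of_gnsProj_eq ω π h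
    exact ⟨v, ContinuousLinearMap.ext hv⟩
  · rintro ⟨v, hv⟩
    have hv1 := PureState.norm_vector π.2 hv
    obtain ⟨ζ, h1, h2⟩ := ω.exists_gns_vector
    obtain ⟨U, hU, -⟩ := HilbertRep.exists_unitary_of_vectorFunctional_eq h2
      (π.2.denseRange (v := v) (by rintro rfl; simp at hv1))
      (by rw [← hv]; exact ContinuousLinearMap.ext fun a => (h1 a).symm)
    exact Quotient.sound ⟨U, hU⟩

/-- The pure state of a unit vector of an irreducible representation. -/
noncomputable def IrredRep.pureState (π : IrredRep A) (v : π.1.space) (hv : ‖v‖ = 1) :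
    PureState A := ⟨π.1.vectorFunctional v, π.2.isPureState hv⟩

theorem IrredRep.gnsProj_pureState (π : IrredRep A) (v : π.1.space) (hv : ‖v‖ = 1) :
    gnsProj (π.pureState v hv) = π.toSpectrum := gnsProj_eq_iff.2 ⟨v, rfl⟩

theorem IrredRep.nontrivial (π : IrredRep A) : Nontrivial π.1.space := by
  obtain ⟨a, ha⟩ := π.2.1
  by_contra h
  rw [not_nontrivial_iff_subsingleton] at h
  exact ha (Subsingleton.elim _ _)

theorem CStarSpectrum.exists_rep (x : CStarSpectrum A) : ∃ π : IrredRep A, π.toSpectrum = x :=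
  Quotient.exists_rep x

theorem gnsProj_surjective : Function.Surjective (gnsProj : PureState A → CStarSpectrum A) := by
  intro x
  obtain ⟨π, rfl⟩ := x.exists_rep
  have := π.nontrivial
  obtain ⟨v, hv⟩ := exists_norm_eq_one π.1.space
  exact ⟨_, π.gnsProj_pureState v hv⟩

end Representations

/-! ### Continuity of the projection onto the spectrum -/

section Spectrum

open Filter Topology

variable {A : Type u} [NonUnitalCStarAlgebra A]

theorem IrredRep.mem_ker_toSpectrum {π : IrredRep A} {a : A} :
    a ∈ π.toSpectrum.ker ↔ π.1.hom a = 0 := Iff.rfl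

theorem CStarSpectrum.isClosed_iff {F : Set (CStarSpectrum A)} :
    IsClosed F ↔ ∃ S : Set A, F = {x | S ⊆ x.ker} := by
  rw [← isOpen_compl_iff]
  change Fᶜᶜ ∈ {F | ∃ S : Set A, F = {x | S ⊆ x.ker}} ↔ _
  rw [compl_compl]
  rfl

/-- The kernel of the GNS representation in terms of the state. This is the reason why the
projection is continuous. -/
theorem mem_ker_gnsProj {ω : PureState A} {a : A} :
    a ∈ (gnsProj ω).ker ↔ ∀ b c, ω.functional (star b * (a * c)) = 0 := by
  obtain ⟨v, hv, hd⟩ := ω.exists_gns_vector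
  have hv' : ω.functional = ω.gns.vectorFunctional v := ContinuousLinearMap.ext hv
  have key : ∀ b c, ω.functional (star b * (a * c)) =
      ⟪ω.gns.hom b v, ω.gns.hom a (ω.gns.hom c v)⟫_ℂ := fun b c => by
    rw [hv', HilbertRep.vectorFunctional_star_mul, HilbertRep.hom_mul_apply]
  simp only [key]
  change ω.gns.hom a = 0 ↔ _
  constructor
  · intro h b c
    simp [h]
  · intro h
    ext w
    refine hd.induction_on w (isClosed_eq (by fun_prop) (by fun_prop)) fun c => ?_
    refine ext_inner_left ℂ fun z => ?_
    refine hd.induction_on z (isClosed_eq (by fun_prop) (by fun_prop)) fun b => ?_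
    simpa using h b c

theorem PureState.isInducing_functional :
    IsInducing fun (ω : PureState A) (a : A) => ω.functional a := ⟨rfl⟩

theorem PureState.continuous_functional_apply (a : A) :
    Continuous fun ω : PureState A => ω.functional a :=
  (continuous_apply a).comp PureState.isInducing_functional.continuous

theorem continuous_gnsProj : Continuous (gnsProj : PureState A → CStarSpectrum A) := by
  refine continuous_iff_isClosed.2 fun F hF => ?_
  obtain ⟨S, rfl⟩ := CStarSpectrum.isClosed_iff.1 hF
  have : gnsProj ⁻¹' {x : CStarSpectrum A | S ⊆ x.ker} =
      ⋂ a ∈ S, ⋂ b, ⋂ c, {ω : PureState A | ω.functional (star b * (a * c)) = 0} := by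
    ext ω
    simp only [Set.mem_preimage, Set.mem_ofPred_eq, Set.subset_def, mem_ker_gnsProj, Set.mem_iInter]
  rw [this]
  exact isClosed_biInter fun a _ => isClosed_iInter fun b => isClosed_iInter fun c =>
    isClosed_eq (PureState.continuous_functional_apply _) continuous_const

end Spectrum

/-! ### The compact convex set of quasi-states -/

section QuasiStates

open Filter Topology

variable {A : Type u} [NonUnitalCStarAlgebra A]

/-- The norm of a positive functional is the limit of its values along an approximate unit. In
particular, the norm is additive on positive functionals. -/
theorem IsPositiveFunctional.tendsto_norm {φ : A →L[ℂ] ℂ} (hφ : IsPositiveFunctional φ)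
    {l : Filter A} (hl : l.IsApproximateUnit) (hl1 : ∀ᶠ e in l, ‖e‖ ≤ 1) :
    Tendsto φ l (𝓝 (‖φ‖ : ℂ)) := by
  obtain ⟨π, v, hv, rfl⟩ := hφ.exists_cyclic
  rw [π.norm_vectorFunctional_of_denseRange hv]
  push_cast
  exact π.tendsto_vectorFunctional (π.tendsto_hom_approximateUnit hl hl1 hv v)

theorem IsPositiveFunctional.add {φ ψ : A →L[ℂ] ℂ} (hφ : IsPositiveFunctional φ)
    (hψ : IsPositiveFunctional ψ) : IsPositiveFunctional (φ + ψ) :=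
  fun a => add_nonneg (hφ a) (hψ a)

theorem IsPositiveFunctional.smul {φ : A →L[ℂ] ℂ} (hφ : IsPositiveFunctional φ) {r : ℝ}
    (hr : 0 ≤ r) : IsPositiveFunctional (r • φ) := fun a => by
  have h1 : (r • φ) (star a * a) = (r : ℂ) * φ (star a * a) := rfl
  rw [h1]
  exact mul_nonneg (Complex.zero_le_real.2 hr) (hφ a)

theorem IsPositiveFunctional.norm_add {φ ψ : A →L[ℂ] ℂ} (hφ : IsPositiveFunctional φ)
    (hψ : IsPositiveFunctional ψ) : ‖φ + ψ‖ = ‖φ‖ + ‖ψ‖ := by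
  obtain ⟨l, hl, -, hl1⟩ := exists_selfAdjoint_approximateUnit A
  have := hl.neBot
  have h := tendsto_nhds_unique ((hφ.add hψ).tendsto_norm hl hl1)
    ((hφ.tendsto_norm hl hl1).add (hψ.tendsto_norm hl hl1))
  exact_mod_cast h

theorem IsPositiveFunctional.map_star {φ : A →L[ℂ] ℂ} (hφ : IsPositiveFunctional φ) (a : A) :
    φ (star a) = (starRingEnd ℂ) (φ a) := by
  obtain ⟨π, v, -, rfl⟩ := hφ.exists_cyclic
  rw [HilbertRep.vectorFunctional_apply, HilbertRep.inner_hom_star_right,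
    HilbertRep.vectorFunctional_apply, inner_conj_symm]

/-- A continuous functional on the space of all functions on `A` with the topology of pointwise
convergence is an evaluation on the dual of `A`. -/
theorem exists_forall_apply_eq (f : StrongDual ℂ (A → ℂ)) :
    ∃ a : A, ∀ φ : A →L[ℂ] ℂ, f φ = φ a := by
  let g : StrongDual ℂ (WeakDual ℂ A) :=
    { toFun := fun φ => f φ
      map_add' := fun φ ψ => f.map_add _ _
      map_smul' := fun c φ => f.map_smul _ _
      cont := f.continuous.comp WeakDual.coeFn_continuous }
  obtain ⟨a, ha⟩ := LinearMap.dualEmbedding_surjective (topDualPairing ℂ A) g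
  exact ⟨a, fun φ => by change g φ = _; rw [← ha]; rfl⟩

/-- The positive functionals of norm at most one, as a subset of the space of all functions on `A`
with the topology of pointwise convergence. -/
def quasiStates (A : Type u) [NonUnitalCStarAlgebra A] : Set (A → ℂ) :=
  {f | ∃ φ : A →L[ℂ] ℂ, IsPositiveFunctional φ ∧ ‖φ‖ ≤ 1 ∧ ⇑φ = f}

theorem isCompact_quasiStates : IsCompact (quasiStates A) := by
  have h : IsCompact {φ : WeakDual ℂ A | (∀ a, 0 ≤ φ (star a * a)) ∧
      φ ∈ WeakDual.toStrongDual ⁻¹' Metric.closedBall 0 1} := by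
    refine (WeakDual.isCompact_closedBall (0 : StrongDual ℂ A) 1).of_isClosed_subset ?_
      fun φ hφ => hφ.2
    refine IsClosed.inter ?_ (WeakDual.isClosed_closedBall 0 1)
    have : {φ : WeakDual ℂ A | ∀ a, 0 ≤ φ (star a * a)} =
        ⋂ a : A, {φ : WeakDual ℂ A | 0 ≤ φ (star a * a)} := by
      ext φ
      simp
    change IsClosed {φ : WeakDual ℂ A | ∀ a, 0 ≤ φ (star a * a)}
    rw [this]
    exact isClosed_iInter fun a => isClosed_le continuous_const (WeakDual.eval_continuous _)
  have h2 := h.image (f := fun (φ : WeakDual ℂ A) (a : A) => φ a) WeakDual.coeFn_continuous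
  convert h2 using 1
  ext f
  constructor
  · rintro ⟨φ, h1, h2, rfl⟩
    exact ⟨StrongDual.toWeakDual φ, ⟨h1, by simpa using h2⟩, rfl⟩
  · rintro ⟨φ, ⟨h1, h2⟩, rfl⟩
    exact ⟨WeakDual.toStrongDual φ, h1, by simpa using h2, rfl⟩

theorem convex_quasiStates : Convex ℝ (quasiStates A) := by
  rintro _ ⟨φ, hφ, hφ1, rfl⟩ _ ⟨ψ, hψ, hψ1, rfl⟩ s t hs ht hst
  refine ⟨s • φ + t • ψ, (hφ.smul hs).add (hψ.smul ht), ?_, rfl⟩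
  calc _ ≤ ‖s • φ‖ + ‖t • ψ‖ := norm_add_le _ _
    _ = s * ‖φ‖ + t * ‖ψ‖ := by
      rw [norm_smul, norm_smul, Real.norm_of_nonneg hs, Real.norm_of_nonneg ht]
    _ ≤ s * 1 + t * 1 := by gcongr
    _ = 1 := by rw [mul_one, mul_one, hst]

theorem PureState.mem_quasiStates (ω : PureState A) : ⇑ω.functional ∈ quasiStates A :=
  ⟨_, ω.isPure.1.1, ω.isPure.1.2.le, rfl⟩

theorem PureState.functional_ne_zero (ω : PureState A) : ω.functional ≠ 0 := fun h0 => by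
  have h1 := ω.isPure.1.2
  rw [h0, norm_zero] at h1
  exact zero_ne_one h1

/-- Pure states are extreme points of the set of quasi-states. -/
theorem PureState.mem_extremePoints (ω : PureState A) :
    ⇑ω.functional ∈ (quasiStates A).extremePoints ℝ := by
  rw [mem_extremePoints_iff_left]
  refine ⟨ω.mem_quasiStates, ?_⟩
  rintro _ ⟨φ, hφ, hφ1, rfl⟩ _ ⟨ψ, hψ, hψ1, rfl⟩ ⟨s, t, hs, ht, hst, h⟩
  have h : s • φ + t • ψ = ω.functional := DFunLike.coe_injective h
  -- `‖φ‖ = 1` since `s ‖φ‖ + t ‖ψ‖ = 1`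
  have hn := (hφ.smul hs.le).norm_add (hψ.smul ht.le)
  rw [h, ω.isPure.1.2, norm_smul, norm_smul, Real.norm_of_nonneg hs.le,
    Real.norm_of_nonneg ht.le] at hn
  have hφ1 : ‖φ‖ = 1 := by
    refine le_antisymm hφ1 ?_
    nlinarith
  obtain ⟨r, hr0, -, hr⟩ := ω.isPure.2 (s • φ) (hφ.smul hs.le)
    (by rw [← h, add_sub_cancel_left]; exact hψ.smul ht.le)
  have hsr : s = r := by
    have h1 := congrArg norm hr
    rw [norm_smul, norm_smul, hφ1, ω.isPure.1.2, Complex.norm_real] at h1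
    simpa [abs_of_nonneg hs.le, abs_of_nonneg hr0] using h1
  rw [← hsr] at hr
  have h2 : s • φ = s • ω.functional := hr
  exact congrArg DFunLike.coe (smul_right_injective (A →L[ℂ] ℂ) hs.ne' h2)

/-- Nonzero extreme points of the set of quasi-states are pure states. -/
theorem isPureState_of_mem_extremePoints {φ : A →L[ℂ] ℂ}
    (hφ : ⇑φ ∈ (quasiStates A).extremePoints ℝ) (h0 : φ ≠ 0) : IsPureState φ := by
  rw [mem_extremePoints_iff_left] at hφ
  obtain ⟨⟨φ', hpos, hφ1, hφφ'⟩, hφ⟩ := hφ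
  obtain rfl : φ' = φ := DFunLike.coe_injective hφφ'
  -- if `φ` is the sum of positive functionals, then these are multiples of `φ`
  have hm : ∀ χ : A →L[ℂ] ℂ, IsPositiveFunctional χ → χ ≠ 0 →
      ⇑(‖χ‖⁻¹ • χ) ∈ quasiStates A := fun χ hχ h0 => by
    refine ⟨_, hχ.smul (inv_nonneg.2 (norm_nonneg _)), ?_, rfl⟩
    rw [norm_smul, norm_inv, norm_norm, inv_mul_cancel₀ (norm_ne_zero_iff.2 h0)]
  have key : ∀ σ ψ : A →L[ℂ] ℂ, IsPositiveFunctional σ → IsPositiveFunctional ψ → σ ≠ 0 →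
      ψ ≠ 0 → ‖σ‖ + ‖ψ‖ = 1 → σ + ψ = φ' → ‖σ‖⁻¹ • σ = φ' := by
    intro σ ψ hσ hψ hσ0 hψ0 hr h
    have hσ' := norm_pos_iff.2 hσ0
    have hψ' := norm_pos_iff.2 hψ0
    refine DFunLike.coe_injective
      (hφ _ (hm σ hσ hσ0) _ (hm ψ hψ hψ0) ⟨‖σ‖, ‖ψ‖, hσ', hψ', hr, ?_⟩)
    have : ‖σ‖ • (‖σ‖⁻¹ • σ) + ‖ψ‖ • (‖ψ‖⁻¹ • ψ) = φ' := by
      rw [smul_smul, smul_smul, mul_inv_cancel₀ hσ'.ne', mul_inv_cancel₀ hψ'.ne', one_smul,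
        one_smul, h]
    exact congrArg DFunLike.coe this
  have hn0 := norm_pos_iff.2 h0
  have hn : ‖φ'‖ = 1 := by
    by_contra hne
    have hlt : ‖φ'‖ < 1 := lt_of_le_of_ne hφ1 hne
    refine h0 (DFunLike.coe_injective (hφ 0 ⟨0, fun a => le_rfl, by simp, rfl⟩ _ (hm φ' hpos h0)
      ⟨1 - ‖φ'‖, ‖φ'‖, by linarith, hn0, by ring, ?_⟩).symm)
    have : ‖φ'‖ • (‖φ'‖⁻¹ • φ') = φ' := by
      rw [smul_smul, mul_inv_cancel₀ hn0.ne', one_smul]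
    rw [smul_zero, zero_add]
    exact congrArg DFunLike.coe this
  refine ⟨⟨hpos, hn⟩, fun σ hσ hσ' => ?_⟩
  have hadd := hσ.norm_add hσ'
  rw [add_sub_cancel, hn] at hadd
  rcases eq_or_ne σ 0 with rfl | hσ0
  · exact ⟨0, le_rfl, zero_le_one, by rw [Complex.ofReal_zero]; exact (zero_smul ℂ φ').symm⟩
  rcases eq_or_ne (φ' - σ) 0 with h1 | h1
  · exact ⟨1, zero_le_one, le_rfl, by simp [(sub_eq_zero.1 h1)]⟩
  refine ⟨‖σ‖, norm_nonneg _, ?_, ?_⟩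
  · linarith [norm_nonneg (φ' - σ)]
  · have := key σ _ hσ hσ' hσ0 h1 hadd.symm (by simp)
    rw [← this]
    change σ = ‖σ‖ • (‖σ‖⁻¹ • σ)
    rw [smul_smul, mul_inv_cancel₀ (norm_ne_zero_iff.2 hσ0), one_smul]

end QuasiStates

/-! ### Openness of the projection onto the spectrum -/

section Openness

open Filter Topology

variable {A : Type u} [NonUnitalCStarAlgebra A]

/-- For `u ≥ 0`, the positive part of `h - u` lies in the kernel of `π` if and only if
`π(h) ≤ u`. -/
theorem HilbertRep.hom_cfcₙ_eq_zero_iff (π : HilbertRep A) {h : A} (hh : IsSelfAdjoint h) {u : ℝ}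
    (hu : 0 ≤ u) : π.hom (cfcₙ (fun t : ℝ => max (t - u) 0) h) = 0 ↔
      ∀ v, (⟪v, π.hom h v⟫_ℂ).re ≤ u * ‖v‖ ^ 2 := by
  have hs : IsSelfAdjoint (π.hom h) := hh.map π.hom
  have hc : Continuous π.hom := by
    refine AddMonoidHomClass.continuous_of_bound π.hom 1 fun a => ?_
    rw [one_mul]
    exact NonUnitalStarAlgHom.norm_apply_le π.hom a
  rw [NonUnitalStarAlgHom.map_cfcₙ π.hom _ h (by fun_prop) (by simp [hu]) hc hh hs]
  have h1 : (∀ v, (⟪v, π.hom h v⟫_ℂ).re ≤ u * ‖v‖ ^ 2) ↔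
      π.hom h ≤ algebraMap ℝ (π.space →L[ℂ] π.space) u := by
    rw [ContinuousLinearMap.le_def]
    have h2 : ∀ v, (⟪(algebraMap ℝ (π.space →L[ℂ] π.space) u - π.hom h) v, v⟫_ℂ).re =
        u * ‖v‖ ^ 2 - (⟪v, π.hom h v⟫_ℂ).re := fun v => by
      have h3 : (algebraMap ℝ (π.space →L[ℂ] π.space) u - π.hom h) v =
          (u : ℂ) • v - π.hom h v := rfl
      rw [h3, inner_sub_left, inner_smul_left, inner_self_eq_norm_sq_to_K, Complex.conj_ofReal,
        Complex.sub_re, Complex.re_ofReal_mul, ← inner_conj_symm v, Complex.conj_re]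
      norm_cast
    constructor
    · intro h3
      refine ⟨?_, fun v => ?_⟩
      · exact ContinuousLinearMap.isSelfAdjoint_iff_isSymmetric.1
          ((IsSelfAdjoint.algebraMap _ (IsSelfAdjoint.all u)).sub hs)
      · change 0 ≤ (⟪(algebraMap ℝ (π.space →L[ℂ] π.space) u - π.hom h) v, v⟫_ℂ).re
        rw [h2]
        exact sub_nonneg.2 (h3 v)
    · intro h3 v
      have h4 : 0 ≤ (⟪(algebraMap ℝ (π.space →L[ℂ] π.space) u - π.hom h) v, v⟫_ℂ).re := h3.2 v
      rw [h2] at h4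
      exact sub_nonneg.1 h4
  rw [h1, le_algebraMap_iff_spectrum_le hs]
  constructor
  · intro h0 t ht
    have h2 := cfcₙ_map_quasispectrum (fun t : ℝ => max (t - u) 0) (π.hom h)
    rw [h0] at h2
    have h3 : max (t - u) 0 ∈ quasispectrum ℝ (0 : π.space →L[ℂ] π.space) := by
      rw [h2]
      exact ⟨t, spectrum_subset_quasispectrum ℝ _ ht, rfl⟩
    rw [CFC.quasispectrum_zero_eq] at h3
    have h4 := le_max_left (t - u) 0
    rw [h3] at h4
    linarith
  · intro h0
    rw [← cfcₙ_zero ℝ (π.hom h)]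
    refine cfcₙ_congr fun t ht => ?_
    rw [quasispectrum_eq_spectrum_union_zero] at ht
    rcases ht with ht | rfl
    · simp [h0 t ht]
    · simp [hu]

/-- If `⋂_{x ∈ S} ker x ⊆ ker π_ω`, then the pure state `ω` is a limit of pure states over
points of `S`: by the Hahn-Banach theorem, `ω` is in the closed convex hull of `0` and of these
pure states, and by Milman's theorem, an extreme point of the hull is in the closure. -/
theorem PureState.mem_closure_preimage {S : Set (CStarSpectrum A)} {ω : PureState A}
    (h : ∀ a : A, (∀ x ∈ S, a ∈ x.ker) → a ∈ (gnsProj ω).ker) :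
    ω ∈ closure (gnsProj ⁻¹' S) := by
  -- since `0` is in `V`, the bound `u` of the separating functional is positive
  set V : Set (A → ℂ) :=
    insert 0 ((fun τ : PureState A => ⇑τ.functional) '' (gnsProj ⁻¹' S))
    with hV
  have hVQ : V ⊆ quasiStates A := by
    rintro _ (rfl | ⟨τ, -, rfl⟩)
    · exact ⟨0, fun a => le_rfl, by simp, rfl⟩
    · exact τ.mem_quasiStates
  have hCQ : closure (convexHull ℝ V) ⊆ quasiStates A :=
    closure_minimal (convexHull_min hVQ convex_quasiStates) isCompact_quasiStates.isClosed
  have hVC : V ⊆ closure (convexHull ℝ V) := (subset_convexHull ℝ V).trans subset_closure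
  have hconv : Convex ℝ (closure (convexHull ℝ V)) := (convex_convexHull ℝ V).closure
  have hω : ⇑ω.functional ∈ closure (convexHull ℝ V) := by
    by_contra hcon
    obtain ⟨f, u, hf1, hf2⟩ := RCLike.geometric_hahn_banach_closed_point (𝕜 := ℂ)
      hconv isClosed_closure hcon
    obtain ⟨a, ha⟩ := exists_forall_apply_eq f
    have hu : 0 < u := by
      have := hf1 0 (hVC (Set.mem_insert _ _))
      simpa using this
    have hre : ∀ τ : PureState A, (τ.functional (a + star a)).re =
        2 * RCLike.re (f τ.functional) := fun τ => by
      rw [ha, map_add, τ.isPure.1.1.map_star]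
      change _ = 2 * (τ.functional a).re
      simp
      ring
    -- `x(a + a*) ≤ 2 u` for `x ∈ S`, hence `π_ω(a + a*) ≤ 2 u`
    have hk := h (cfcₙ (fun t : ℝ => max (t - 2 * u) 0) (a + star a)) fun x hx => by
      obtain ⟨π, rfl⟩ := x.exists_rep
      rw [IrredRep.mem_ker_toSpectrum, HilbertRep.hom_cfcₙ_eq_zero_iff _
        (IsSelfAdjoint.add_star_self a) (by positivity)]
      intro v
      rcases eq_or_ne v 0 with rfl | hv
      · simp
      have hn : ‖((‖v‖⁻¹ : ℝ) : ℂ) • v‖ = 1 := by simp [norm_smul, hv]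
      have h1 := hf1 _ (hVC (Set.mem_insert_of_mem _ ⟨π.pureState _ hn, by
        rw [Set.mem_preimage, π.gnsProj_pureState]; exact hx, rfl⟩))
      have h2 := hre (π.pureState _ hn)
      have h3 : (π.pureState _ hn).functional (a + star a) =
          ((‖v‖⁻¹ ^ 2 : ℝ) : ℂ) * ⟪v, π.1.hom (a + star a) v⟫_ℂ := by
        change ⟪_, π.1.hom (a + star a) _⟫_ℂ = _
        rw [map_smul, inner_smul_left, inner_smul_right, Complex.conj_ofReal]
        push_cast
        ring
      rw [h3, Complex.re_ofReal_mul] at h2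
      have h4 : ‖v‖⁻¹ ^ 2 * (⟪v, π.1.hom (a + star a) v⟫_ℂ).re ≤ 2 * u := by
        rw [h2]; linarith
      have hv' := norm_pos_iff.2 hv
      rw [inv_pow, inv_mul_le_iff₀ (by positivity)] at h4
      linarith
    obtain ⟨ζ, hζ, -⟩ := ω.exists_gns_vector
    have hζ1 : ‖ζ‖ = 1 :=
      PureState.norm_vector ω.gns_isIrreducible (ContinuousLinearMap.ext hζ)
    have h5 := (HilbertRep.hom_cfcₙ_eq_zero_iff ω.gns (IsSelfAdjoint.add_star_self a)
      (u := 2 * u) (by positivity)).1 hk ζ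
    rw [← hζ, hre, hζ1] at h5
    linarith
  have hext : ⇑ω.functional ∈
      (closure (convexHull ℝ V)).extremePoints ℝ :=
    inter_extremePoints_subset_extremePoints_of_subset hCQ ⟨hω, ω.mem_extremePoints⟩
  have hcl := extremePoints_closure_convexHull_subset
    (isCompact_quasiStates.of_isClosed_subset isClosed_closure hCQ) hext
  rw [mem_closure_iff_nhds]
  intro U hU
  rw [PureState.isInducing_functional.nhds_eq_comap] at hU
  obtain ⟨O, hO, hOU⟩ := hU
  have hne : ⇑ω.functional ≠ 0 := fun h0 => ω.functional_ne_zero (DFunLike.coe_injective h0)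
  obtain ⟨φ, ⟨hφO, hφ0⟩, hφV⟩ := mem_closure_iff_nhds.1 hcl _
    (Filter.inter_mem hO (isOpen_compl_singleton.mem_nhds hne))
  rcases hφV with rfl | ⟨τ, hτ, rfl⟩
  · exact absurd rfl hφ0
  · exact ⟨τ, hOU hφO, hτ⟩

/-- If a point `π_ω` of the image of an open set `U` were in the closure of the complement of the
image, then `ω` would be a limit of pure states over that complement, of which there are none in
`U`. -/
theorem isOpenMap_gnsProj : IsOpenMap (gnsProj : PureState A → CStarSpectrum A) := by
  intro U hU
  rw [← isClosed_compl_iff, CStarSpectrum.isClosed_iff]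
  refine ⟨{a | ∀ x ∈ (gnsProj '' U)ᶜ, a ∈ x.ker}, ?_⟩
  ext x
  refine ⟨fun hx a ha => ha x hx, fun hx => ?_⟩
  rintro ⟨ω, hω, rfl⟩
  obtain ⟨τ, hτU, hτ⟩ := mem_closure_iff.1 (ω.mem_closure_preimage hx) U hU hω
  exact hτ ⟨τ, hτU, rfl⟩

end Openness

/-! ### Concentration of positive functionals -/

section PositiveFunctionals

open Filter Topology

variable {A : Type u} [NonUnitalCStarAlgebra A]

/-- A contraction `e` almost fixes `v` if the vector functional of `v` is almost `‖v‖²` at `e`. -/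
theorem HilbertRep.norm_sub_hom_le (π : HilbertRep A) {e : A} (he1 : ‖e‖ ≤ 1) (v : π.space) :
    ‖v - π.hom e v‖ ≤ √(2 * (‖v‖ ^ 2 - (π.vectorFunctional v e).re)) := by
  have hev : ‖π.hom e v‖ ≤ ‖v‖ := (π.norm_hom_apply_le e v).trans
    (mul_le_of_le_one_left (norm_nonneg v) he1)
  refine Real.le_sqrt_of_sq_le ?_
  have h2 := norm_sub_sq (𝕜 := ℂ) v (π.hom e v)
  have h3 : ‖π.hom e v‖ ^ 2 ≤ ‖v‖ ^ 2 := by gcongr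
  rw [h2, HilbertRep.vectorFunctional_apply]
  simp only [RCLike.re_eq_complex_re]
  linarith

/-- A positive functional `ρ` is almost concentrated on `e` if `ρ(e)` is almost `‖ρ‖`. -/
theorem IsPositiveFunctional.norm_sub_apply_conj_le {ρ : A →L[ℂ] ℂ} (hρ : IsPositiveFunctional ρ)
    {e : A} (he : star e = e) (he1 : ‖e‖ ≤ 1) (a : A) :
    ‖ρ a - ρ (e * a * e)‖ ≤ 2 * ‖a‖ * √‖ρ‖ * √(2 * (‖ρ‖ - (ρ e).re)) := by
  obtain ⟨π, v, hv, rfl⟩ := hρ.exists_cyclic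
  rw [π.norm_vectorFunctional_of_denseRange hv, Real.sqrt_sq (norm_nonneg v)]
  have hev : ‖π.hom e v‖ ≤ ‖v‖ := (π.norm_hom_apply_le e v).trans
    (mul_le_of_le_one_left (norm_nonneg v) he1)
  have h1 := π.norm_sub_hom_le he1 v
  have h4 : π.vectorFunctional v a - π.vectorFunctional v (e * a * e) =
      ⟪v, π.hom a (v - π.hom e v)⟫_ℂ + ⟪v - π.hom e v, π.hom a (π.hom e v)⟫_ℂ := by
    rw [HilbertRep.vectorFunctional_apply, HilbertRep.vectorFunctional_apply, map_sub,
      inner_sub_right, inner_sub_left, HilbertRep.hom_mul_apply, HilbertRep.hom_mul_apply]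
    nth_rw 1 [← he]
    rw [HilbertRep.inner_hom_star_right]
    ring
  rw [h4]
  have h5 : ‖⟪v, π.hom a (v - π.hom e v)⟫_ℂ‖ ≤ ‖v‖ * (‖a‖ * ‖v - π.hom e v‖) :=
    (norm_inner_le_norm _ _).trans (by gcongr; exact π.norm_hom_apply_le _ _)
  have h6 : ‖⟪v - π.hom e v, π.hom a (π.hom e v)⟫_ℂ‖ ≤ ‖v - π.hom e v‖ * (‖a‖ * ‖v‖) :=
    (norm_inner_le_norm _ _).trans (by
      gcongr
      exact (π.norm_hom_apply_le _ _).trans (by gcongr))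
  calc _ ≤ ‖v‖ * (‖a‖ * ‖v - π.hom e v‖) + ‖v - π.hom e v‖ * (‖a‖ * ‖v‖) :=
        (norm_add_le _ _).trans (add_le_add h5 h6)
    _ = 2 * ‖a‖ * ‖v‖ * ‖v - π.hom e v‖ := by ring
    _ ≤ _ := by gcongr

/-- If `ρ(e) → ‖ρ‖` for a net of self-adjoint contractions, then `ρ(eae) → ρ(a)`. -/
theorem IsPositiveFunctional.tendsto_conj {ι : Type*} {ρ : A →L[ℂ] ℂ}
    (hρ : IsPositiveFunctional ρ) {l : Filter ι} {e : ι → A} (he : ∀ᶠ i in l, star (e i) = e i)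
    (he1 : ∀ᶠ i in l, ‖e i‖ ≤ 1) (h : Tendsto (fun i => (ρ (e i)).re) l (𝓝 ‖ρ‖)) (a : A) :
    Tendsto (fun i => ρ (e i * a * e i)) l (𝓝 (ρ a)) := by
  rw [tendsto_iff_norm_sub_tendsto_zero]
  have h0 : Tendsto (fun i => 2 * ‖a‖ * √‖ρ‖ * √(2 * (‖ρ‖ - (ρ (e i)).re))) l (𝓝 0) := by
    have := ((Real.continuous_sqrt.tendsto _).comp
      ((h.const_sub ‖ρ‖).const_mul 2)).const_mul (2 * ‖a‖ * √‖ρ‖)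
    simpa using this
  refine squeeze_zero' (Eventually.of_forall fun i => norm_nonneg _) ?_ h0
  filter_upwards [he, he1] with i h1 h2
  rw [norm_sub_rev]
  exact hρ.norm_sub_apply_conj_le h1 h2 a

end PositiveFunctionals

/-! ### Extension of states of hereditary subalgebras -/

section HereditarySubalgebras

open Filter Topology

variable {A : Type u} [NonUnitalCStarAlgebra A]

section

variable [PartialOrder A] [StarOrderedRing A] {B : NonUnitalStarSubalgebra ℂ A}

/-- The element `b*(a*a)b` is dominated by `‖a‖² b*b`, which lies in `B`. -/
theorem IsHereditary.star_mul_mul_mem (hB : IsHereditary B) {b : A} (hb : b ∈ B) (a : A) :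
    star b * a * b ∈ B := by
  have h1 : ∀ c : A, 0 ≤ c → star b * c * b ∈ B := fun c hc => by
    refine hB _ (‖c‖ • (star b * b)) (star_left_conjugate_nonneg hc b)
      CStarAlgebra.star_left_conjugate_le_norm_smul ?_
    have : ‖c‖ • (star b * b) = (‖c‖ : ℂ) • (star b * b) := (Complex.coe_smul _ _).symm
    rw [this]
    exact SMulMemClass.smul_mem _ (mul_mem (star_mem hb) hb)
  obtain ⟨x, hx, -, ha⟩ := CStarAlgebra.exists_sum_four_nonneg a
  rw [ha, Finset.mul_sum, Finset.sum_mul]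
  refine sum_mem fun i _ => ?_
  rw [mul_smul_comm, smul_mul_assoc]
  exact SMulMemClass.smul_mem _ (h1 _ (hx i))

/-- A hereditary subalgebra `B` of `A` satisfies `B A B ⊆ B`. -/
theorem IsHereditary.mul_mul_mem (hB : IsHereditary B) {b c : A} (hb : b ∈ B) (hc : c ∈ B)
    (a : A) : b * a * c ∈ B := by
  have hb' := star_mem hb
  have key : ∀ d ∈ B, b * a * d + star d * a * star b ∈ B := fun d hd => by
    have h := sub_mem (sub_mem (hB.star_mul_mul_mem (add_mem hb' hd) a)
      (hB.star_mul_mul_mem hb' a)) (hB.star_mul_mul_mem hd a)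
    convert h using 1
    simp only [star_add, star_star, add_mul, mul_add]
    abel
  have h1 := key c hc
  have h2 := SMulMemClass.smul_mem Complex.I (key (Complex.I • c) (SMulMemClass.smul_mem _ hc))
  have h3 := SMulMemClass.smul_mem (1 / 2 : ℂ) (sub_mem h1 h2)
  convert h3 using 1
  simp only [star_smul, smul_add, mul_smul_comm, smul_mul_assoc, smul_smul, Complex.star_def,
    Complex.conj_I, Complex.I_mul_I, smul_sub]
  match_scalars <;> norm_num

end

section

variable (B : NonUnitalStarSubalgebra ℂ A) [IsClosed (B : Set A)]

/-- An approximate unit of a closed subalgebra. -/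
theorem exists_approximateUnit_subalgebra : ∃ l : Filter B, l.NeBot ∧ (∀ᶠ e in l, star e = e) ∧
    (∀ᶠ e in l, ‖e‖ ≤ 1) ∧ l.IsApproximateUnit := by
  obtain ⟨l, hl, h1, h2⟩ := exists_selfAdjoint_approximateUnit B
  exact ⟨l, hl.neBot, h1, h2, hl⟩

end

section

variable (B : NonUnitalStarSubalgebra ℂ A)

/-- The restriction of a functional to a subalgebra. -/
noncomputable def restrictFunctional (ρ : A →L[ℂ] ℂ) : B →L[ℂ] ℂ :=
  ρ.comp (B.toSubmodule.subtypeL)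

theorem restrictFunctional_apply (ρ : A →L[ℂ] ℂ) (b : B) : restrictFunctional B ρ b = ρ b := rfl

end

variable [PartialOrder A] [StarOrderedRing A] {B : NonUnitalStarSubalgebra ℂ A}
  [IsClosed (B : Set A)]

/-- A closed subalgebra contains the square roots of its positive elements. -/
theorem exists_sqrt_mem {d : A} (hd : 0 ≤ d) (hdB : d ∈ B) :
    ∃ c ∈ B, star c = c ∧ c * c = d := by
  refine ⟨CFC.sqrt d, ?_, (IsSelfAdjoint.of_nonneg (CFC.sqrt_nonneg d)).star_eq,
    CFC.sqrt_mul_sqrt_self d⟩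
  rw [CFC.sqrt_eq_real_sqrt d]
  exact cfcₙ_mem (𝕜' := ℂ) (hs := ‹IsClosed (B : Set A)›) _ hdB

/-- The states of a hereditary subalgebra extend to states. The extension is a limit of the
functionals `a ↦ τ(eae)` along an approximate unit of the subalgebra. -/
theorem IsHereditary.exists_extension (hB : IsHereditary B) {τ : B →L[ℂ] ℂ} (hτ : IsState τ) :
    ∃ ρ : A →L[ℂ] ℂ, IsState ρ ∧ ∀ b : B, ρ b = τ b := by
  obtain ⟨l, hl, hs, hn, hu⟩ := exists_approximateUnit_subalgebra B
  -- along an ultrafilter, the bounded numbers `τ(eae)` converge for all `a` at once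
  let 𝒰 := Ultrafilter.of l
  have h𝒰 : (𝒰 : Filter B) ≤ l := Ultrafilter.of_le l
  let f : A → B → ℂ := fun a e => τ ⟨e * a * e, hB.mul_mul_mem e.2 e.2 a⟩
  have hf : ∀ a, ∀ᶠ e in l, ‖f a e‖ ≤ ‖a‖ := fun a => by
    filter_upwards [hn] with e he
    have he' : ‖(e : A)‖ ≤ 1 := he
    refine (τ.le_opNorm _).trans ?_
    rw [hτ.2, one_mul]
    change ‖(e : A) * a * e‖ ≤ ‖a‖
    calc _ ≤ ‖(e : A)‖ * ‖a‖ * ‖(e : A)‖ :=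
          (norm_mul_le _ _).trans (by gcongr; exact norm_mul_le _ _)
      _ ≤ 1 * ‖a‖ * 1 := by gcongr
      _ = ‖a‖ := by ring
  have hlim : ∀ a, ∃ z : ℂ, ‖z‖ ≤ ‖a‖ ∧ Tendsto (f a) 𝒰 (𝓝 z) := fun a => by
    obtain ⟨z, hz, hz'⟩ := (isCompact_closedBall (0 : ℂ) ‖a‖).ultrafilter_le_nhds (𝒰.map (f a)) (by
      rw [le_principal_iff]
      have : ∀ᶠ e in (𝒰 : Filter B), f a e ∈ Metric.closedBall (0 : ℂ) ‖a‖ := by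
        filter_upwards [h𝒰 (hf a)] with e he
        simpa using he
      exact this)
    exact ⟨z, by simpa using hz, hz'⟩
  choose L hL1 hL using hlim
  have hLB : ∀ b : B, L b = τ b := fun b => by
    refine tendsto_nhds_unique (hL b) ?_
    have h1 : Tendsto (fun e : B => e * b * e) l (𝓝 b) := by
      have h2 : Tendsto (fun e : B => e * b * e - b * e) l (𝓝 0) := by
        have h3 : Tendsto (fun e : B => ‖e * b - b‖) l (𝓝 0) :=
          tendsto_iff_norm_sub_tendsto_zero.1 (hu.tendsto_mul_right b)
        refine squeeze_zero_norm' ?_ h3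
        filter_upwards [hn] with e he
        rw [← sub_mul]
        exact (norm_mul_le _ _).trans (mul_le_of_le_one_right (norm_nonneg _) he)
      simpa using h2.add (hu.tendsto_mul_left b)
    exact ((τ.continuous.tendsto b).comp h1).mono_left h𝒰
  let ρ : A →L[ℂ] ℂ := LinearMap.mkContinuous
    { toFun := L
      map_add' := fun a b => tendsto_nhds_unique (hL _) (((hL a).add (hL b)).congr fun e => by
        simp only [f]
        rw [← map_add]
        congr 1
        exact Subtype.ext (by simp [mul_add, add_mul]))
      map_smul' := fun c a => tendsto_nhds_unique (hL _) (((hL a).const_smul c).congr fun e => by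
        simp only [f]
        rw [← map_smul]
        congr 1
        exact Subtype.ext (by simp [mul_smul_comm, smul_mul_assoc])) } 1
    fun a => by simpa using hL1 a
  refine ⟨ρ, ⟨fun a => ?_, le_antisymm ?_ ?_⟩, hLB⟩
  · -- the element `e a* a e` is positive in `B`, because `B` contains its square root
    refine ge_of_tendsto (hL (star a * a)) ?_
    filter_upwards [h𝒰 hs] with e he
    have he' : star (e : A) = e := congrArg Subtype.val he
    obtain ⟨c, hc⟩ : ∃ c : B, τ ⟨e * (star a * a) * e, hB.mul_mul_mem e.2 e.2 _⟩ =
        τ (star c * c) := by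
      obtain ⟨c, hc, hc', h⟩ := exists_sqrt_mem (B := B) (star_mul_self_nonneg (a * (e : A)))
        (by
          rw [star_mul, he', ← mul_assoc, mul_assoc (e : A)]
          exact hB.mul_mul_mem e.2 e.2 _)
      refine ⟨⟨c, hc⟩, ?_⟩
      congr 1
      refine Subtype.ext ?_
      change (e : A) * (star a * a) * e = star c * c
      rw [hc', h, star_mul, he']
      simp only [mul_assoc]
    simp only [f]
    rw [hc]
    exact hτ.1 c
  · exact LinearMap.mkContinuous_norm_le _ zero_le_one _
  · rw [← hτ.2]
    refine ContinuousLinearMap.opNorm_le_bound _ (norm_nonneg _) fun b => ?_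
    rw [← hLB]
    exact ρ.le_opNorm b

end HereditarySubalgebras

/-! ### Unique extension of pure states -/

section PureExtension

open Filter Topology

variable {A : Type u} [NonUnitalCStarAlgebra A] {B : NonUnitalStarSubalgebra ℂ A}

theorem IsPositiveFunctional.restrictFunctional {ρ : A →L[ℂ] ℂ} (hρ : IsPositiveFunctional ρ) :
    ∀ b : B, 0 ≤ restrictFunctional B ρ (star b * b) := fun b => hρ b

theorem norm_restrictFunctional_le (ρ : A →L[ℂ] ℂ) : ‖restrictFunctional B ρ‖ ≤ ‖ρ‖ :=
  ContinuousLinearMap.opNorm_le_bound _ (norm_nonneg ρ) fun b => ρ.le_opNorm b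

variable [IsClosed (B : Set A)]

/-- If a positive functional attains its norm on `B`, it is determined by its values on the
products `eae`, where `e` runs through an approximate unit of `B`. -/
theorem IsPositiveFunctional.tendsto_conj_approximateUnit {ρ : A →L[ℂ] ℂ}
    (hρ : IsPositiveFunctional ρ) (hn : ‖_root_.restrictFunctional B ρ‖ = ‖ρ‖) {l : Filter B}
    (hl : l.IsApproximateUnit) (hs : ∀ᶠ e in l, star e = e) (h1 : ∀ᶠ e in l, ‖e‖ ≤ 1) (a : A) :
    Tendsto (fun e : B => ρ (e * a * e)) l (𝓝 (ρ a)) := by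
  refine hρ.tendsto_conj (hs.mono fun e he => congrArg Subtype.val he) h1 ?_ a
  have h2 := IsPositiveFunctional.tendsto_norm (φ := _root_.restrictFunctional B ρ)
    hρ.restrictFunctional hl h1
  have h3 := (Complex.continuous_re.tendsto _).comp h2
  rw [hn] at h3
  exact h3

/-- If `ρ` attains its norm on `B`, so does each positive functional `σ ≤ ρ`. -/
theorem IsPositiveFunctional.norm_restrictFunctional_of_le {ρ σ : A →L[ℂ] ℂ}
    (hσ : IsPositiveFunctional σ) (hσρ : IsPositiveFunctional (ρ - σ))
    (hn : ‖_root_.restrictFunctional B ρ‖ = ‖ρ‖) : ‖_root_.restrictFunctional B σ‖ = ‖σ‖ := by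
  have h1 := hσ.norm_add hσρ
  have h2 : ‖_root_.restrictFunctional B ρ‖ ≤
      ‖_root_.restrictFunctional B σ‖ + ‖_root_.restrictFunctional B (ρ - σ)‖ := by
    refine le_trans (le_of_eq ?_) (norm_add_le _ _)
    congr 1
    ext b
    simp [restrictFunctional_apply]
  have h3 := norm_restrictFunctional_le (B := B) σ
  have h4 := norm_restrictFunctional_le (B := B) (ρ - σ)
  rw [add_sub_cancel] at h1
  linarith

theorem IsState.norm_restrictFunctional {ρ : A →L[ℂ] ℂ} (hρ : IsState ρ) {τ : B →L[ℂ] ℂ}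
    (hτ : IsState τ) (h : ∀ b : B, ρ b = τ b) : ‖restrictFunctional B ρ‖ = ‖ρ‖ := by
  have : restrictFunctional B ρ = τ := ContinuousLinearMap.ext h
  rw [this, hτ.2, hρ.2]

variable [PartialOrder A] [StarOrderedRing A]

/-- Two positive functionals that attain their norms on a hereditary subalgebra `B` and agree
on `B` are equal. -/
theorem IsHereditary.functional_ext (hB : IsHereditary B) {ρ σ : A →L[ℂ] ℂ}
    (hρ : IsPositiveFunctional ρ) (hσ : IsPositiveFunctional σ)
    (hρn : ‖restrictFunctional B ρ‖ = ‖ρ‖) (hσn : ‖restrictFunctional B σ‖ = ‖σ‖)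
    (h : ∀ b ∈ B, ρ b = σ b) : ρ = σ := by
  obtain ⟨l, hl, hs, h1, hu⟩ := exists_approximateUnit_subalgebra B
  ext a
  refine tendsto_nhds_unique (hρ.tendsto_conj_approximateUnit hρn hu hs h1 a)
    ((hσ.tendsto_conj_approximateUnit hσn hu hs h1 a).congr fun e => ?_)
  rw [h _ (hB.mul_mul_mem e.2 e.2 a)]

/-- A state that extends a pure state is pure: a positive functional `σ ≤ ρ` is a multiple of `ρ` on
`B`, and both attain their norms on `B`. -/
theorem IsHereditary.isPureState_of_extends (hB : IsHereditary B) {ρ : A →L[ℂ] ℂ}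
    (hρ : IsState ρ) {τ : B →L[ℂ] ℂ} (hτ : IsPureState τ) (h : ∀ b : B, ρ b = τ b) :
    IsPureState ρ := by
  have hn := hρ.norm_restrictFunctional hτ.1 h
  refine ⟨hρ, fun σ hσ hσρ => ?_⟩
  have hr : restrictFunctional B ρ = τ := ContinuousLinearMap.ext h
  obtain ⟨t, ht0, ht1, ht⟩ := hτ.2 (restrictFunctional B σ) hσ.restrictFunctional (by
    rw [← hr]; exact hσρ.restrictFunctional)
  refine ⟨t, ht0, ht1, ?_⟩
  have hσn := hσ.norm_restrictFunctional_of_le hσρ hn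
  refine hB.functional_ext hσ (hρ.1.smul ht0) hσn ?_ fun b hb => ?_
  · change ‖(t : ℂ) • restrictFunctional B ρ‖ = ‖(t : ℂ) • ρ‖
    rw [norm_smul, norm_smul, hn]
  · have := congrArg (fun f : B →L[ℂ] ℂ => f ⟨b, hb⟩) ht
    rw [← hr] at this
    exact this

/-- The unique extension of a pure state of a hereditary subalgebra to a state of the
algebra. -/
noncomputable def pureExtension (hB : IsHereditary B) (τ : PureState B) : PureState A :=
  ⟨(hB.exists_extension τ.isPure.1).choose,
    hB.isPureState_of_extends (hB.exists_extension τ.isPure.1).choose_spec.1 τ.isPure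
      (hB.exists_extension τ.isPure.1).choose_spec.2⟩

theorem pureExtension_apply (hB : IsHereditary B) (τ : PureState B) (b : B) :
    (pureExtension hB τ).functional b = τ.functional b :=
  (hB.exists_extension τ.isPure.1).choose_spec.2 b

theorem eq_pureExtension (hB : IsHereditary B) {τ : PureState B} {ρ : A →L[ℂ] ℂ}
    (hρ : IsState ρ) (h : ∀ b : B, ρ b = τ.functional b) : ρ = (pureExtension hB τ).functional :=
  hB.functional_ext hρ.1 (pureExtension hB τ).isPure.1.1 (hρ.norm_restrictFunctional τ.isPure.1 h)
    ((pureExtension hB τ).isPure.1.norm_restrictFunctional τ.isPure.1 (pureExtension_apply hB τ))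
    fun b hb => (h ⟨b, hb⟩).trans (pureExtension_apply hB τ ⟨b, hb⟩).symm

theorem isUniqueExtensionMap_pureExtension (hB : IsHereditary B) :
    IsUniqueExtensionMap B (pureExtension hB) :=
  fun τ => ⟨pureExtension_apply hB τ, fun _ hρ h => eq_pureExtension hB hρ h⟩

theorem pureExtension_injective (hB : IsHereditary B) :
    Function.Injective (pureExtension hB) := fun τ σ h => by
  refine PureState.ext (ContinuousLinearMap.ext fun b => ?_)
  rw [← pureExtension_apply hB, ← pureExtension_apply hB, h]

/-- Limits of states `Ξ τ` are quasi-states by compactness, and if they extend a state, they are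
the unique extension. -/
theorem continuous_pureExtension (hB : IsHereditary B) : Continuous (pureExtension hB) := by
  rw [PureState.isInducing_functional.continuous_iff, continuous_iff_ultrafilter]
  intro τ g hg
  obtain ⟨f, ⟨φ, hφ, hφ1, rfl⟩, hf⟩ := isCompact_quasiStates.ultrafilter_le_nhds
    (g.map fun τ => (pureExtension hB τ).functional) (by
      rw [le_principal_iff]
      exact Filter.mem_map.2
        (Filter.univ_mem' fun τ : PureState B => (pureExtension hB τ).mem_quasiStates))
  have h1 : ∀ b : B, φ b = τ.functional b := fun b => by
    have h2 : Tendsto (fun τ => (pureExtension hB τ).functional (b : A)) g (𝓝 (φ b)) :=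
      ((continuous_apply (b : A)).tendsto _).comp hf
    have h3 : Tendsto (fun τ : PureState B => τ.functional b) g (𝓝 (τ.functional b)) :=
      ((PureState.continuous_functional_apply b).tendsto τ).mono_left hg
    exact tendsto_nhds_unique h2 (h3.congr fun τ => (pureExtension_apply hB τ b).symm)
  have h2 : φ = (pureExtension hB τ).functional := by
    refine eq_pureExtension hB ⟨hφ, le_antisymm hφ1 ?_⟩ h1
    rw [← τ.isPure.1.2]
    exact ContinuousLinearMap.opNorm_le_bound _ (norm_nonneg _) fun b => by
      rw [← h1]; exact φ.le_opNorm b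
  rw [h2] at hf
  exact hf

theorem isInducing_pureExtension (hB : IsHereditary B) : IsInducing (pureExtension hB) := by
  have hg : Continuous fun (ω : PureState A) (b : B) => ω.functional (b : A) :=
    continuous_pi fun b => PureState.continuous_functional_apply (b : A)
  refine IsInducing.of_comp (continuous_pureExtension hB) hg ?_
  have : (fun (ω : PureState A) (b : B) => ω.functional (b : A)) ∘ pureExtension hB =
      fun (τ : PureState B) (b : B) => τ.functional b :=
    funext fun τ => funext fun b => pureExtension_apply hB τ b
  rw [this]
  exact PureState.isInducing_functional

/-- The pure states of a hereditary subalgebra, as a subspace of the pure states of the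
algebra. -/
noncomputable def pureExtensionHomeomorph (hB : IsHereditary B) :
    PureState B ≃ₜ Set.range (pureExtension hB) :=
  (Topology.IsEmbedding.mk (isInducing_pureExtension hB)
    (pureExtension_injective hB)).toHomeomorph

end PureExtension

/-! ### Restriction of representations to hereditary subalgebras -/

section EssentialSpace

open Filter Topology

variable {A : Type u} [NonUnitalCStarAlgebra A] {B : NonUnitalStarSubalgebra ℂ A}

namespace HilbertRep

variable (π : HilbertRep A)

theorem isClosed_essentialSpace : IsClosed (π.essentialSpace B : Set π.space) :=
  Submodule.isClosed_topologicalClosure _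

/-- A closed subspace that contains `π(B)H` contains the essential space. -/
theorem essentialSpace_le {K : Submodule ℂ π.space} (hK : IsClosed (K : Set π.space))
    (h : ∀ b ∈ B, ∀ v, π.hom b v ∈ K) : π.essentialSpace B ≤ K :=
  Submodule.topologicalClosure_minimal _ (Submodule.span_le.2 (by
    rintro _ ⟨b, hb, v, rfl⟩
    exact h b hb v)) hK

theorem mem_essentialSpace_of_tendsto {l : Filter B} [l.NeBot] {v : π.space}
    (h : Tendsto (fun e : B => π.hom e v) l (𝓝 v)) : v ∈ π.essentialSpace B :=
  π.isClosed_essentialSpace.mem_of_tendsto h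
    (Eventually.of_forall fun e => π.hom_mem_essentialSpace B e.2 v)

variable [IsClosed (B : Set A)]

variable (B) in
/-- The inclusion of the space of `π_B` into the space of `π`. -/
noncomputable def essentialInclusion : (π.essentialRestriction B).space →ₗᵢ[ℂ] π.space :=
  (π.essentialSpace B).subtypeₗᵢ

theorem essentialInclusion_hom (b : B) (v : (π.essentialRestriction B).space) :
    π.essentialInclusion B ((π.essentialRestriction B).hom b v) =
      π.hom b (π.essentialInclusion B v) := rfl

theorem essentialInclusion_mem (v : (π.essentialRestriction B).space) :
    π.essentialInclusion B v ∈ π.essentialSpace B := Subtype.property _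

theorem exists_essentialInclusion_eq {v : π.space} (hv : v ∈ π.essentialSpace B) :
    ∃ w, π.essentialInclusion B w = v := ⟨(⟨v, hv⟩ : π.essentialSpace B), rfl⟩

theorem vectorFunctional_essentialRestriction (v : (π.essentialRestriction B).space) (b : B) :
    (π.essentialRestriction B).vectorFunctional v b =
      π.vectorFunctional (π.essentialInclusion B v) b := rfl

/-- An approximate unit of `B` converges strongly to the projection onto the essential space; here
on the essential space itself. -/
theorem tendsto_hom_of_mem_essentialSpace {l : Filter B} (hl : l.IsApproximateUnit)
    (h1 : ∀ᶠ e in l, ‖e‖ ≤ 1) {v : π.space} (hv : v ∈ π.essentialSpace B) :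
    Tendsto (fun e : B => π.hom e v) l (𝓝 v) := by
  have h2 : IsClosed {w : π.space | Tendsto (fun e : B => π.hom e w) l (𝓝 w)} := by
    have h3 : ∀ᶠ e in l.map ((↑) : B → A), ‖e‖ ≤ 1 := h1
    exact π.isClosed_setOf_tendsto h3
  let K : Submodule ℂ π.space :=
    { carrier := {w : π.space | Tendsto (fun e : B => π.hom e w) l (𝓝 w)}
      add_mem' := fun {x y} hx hy => by
        refine (Tendsto.add hx hy).congr fun e => ?_
        simp
      zero_mem' := by simpa using tendsto_const_nhds
      smul_mem' := fun c x hx => by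
        refine (Tendsto.const_smul hx c).congr fun e => ?_
        simp }
  refine π.essentialSpace_le (K := K) h2 (fun b hb w => ?_) hv
  have h3 : Tendsto (fun e : B => ((e * ⟨b, hb⟩ : B) : A)) l (𝓝 b) :=
    (continuous_subtype_val.tendsto _).comp (hl.tendsto_mul_right ⟨b, hb⟩)
  exact (((π.orbit w).continuous.tendsto b).comp h3).congr fun e => π.hom_mul_apply _ _ _

/-- The representations `π_B` and `π|_B` have the same kernel. -/
theorem essentialRestriction_hom_eq_zero_iff (b : B) :
    (π.essentialRestriction B).hom b = 0 ↔ π.hom b = 0 := by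
  constructor
  · intro h
    have h1 : ∀ v, π.hom (star (b : A)) v = 0 := fun v => by
      have h2 : π.hom b (π.hom (star (b : A)) v) = 0 := by
        obtain ⟨w, hw⟩ := π.exists_essentialInclusion_eq (B := B)
          (π.hom_mem_essentialSpace B (star_mem b.2) v)
        rw [← hw, ← essentialInclusion_hom, h]
        exact map_zero _
      rw [← inner_self_eq_zero (𝕜 := ℂ), inner_hom_star_left, h2, inner_zero_right]
    have h3 : π.hom (star (b : A)) = 0 := ContinuousLinearMap.ext h1
    rw [map_star] at h3
    exact star_eq_zero.1 h3
  · intro h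
    refine ContinuousLinearMap.ext fun v => (π.essentialInclusion B).injective ?_
    rw [essentialInclusion_hom, h]
    exact (map_zero (π.essentialInclusion B)).symm

end HilbertRep

theorem mem_nonvanishingOn_iff {π : IrredRep A} :
    π.toSpectrum ∈ nonvanishingOn B ↔ ∃ b ∈ B, π.1.hom b ≠ 0 := Iff.rfl

variable [PartialOrder A] [StarOrderedRing A] [IsClosed (B : Set A)]

/-- The restriction of an irreducible representation to a hereditary subalgebra is
irreducible: if `L` is an invariant subspace and `0 ≠ v ∈ L`, then
`π(b)π(a)v = lim π(bae)v` lies in `L`, and `π(A)v` is dense. -/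
theorem HilbertRep.IsIrreducible.essentialRestriction (hB : IsHereditary B) {π : HilbertRep A}
    (hπ : π.IsIrreducible) (h : ∃ b ∈ B, π.hom b ≠ 0) :
    (π.essentialRestriction B).IsIrreducible := by
  obtain ⟨l, hl, hs, h1, hu⟩ := exists_approximateUnit_subalgebra B
  refine ⟨?_, fun L hL hinv => ?_⟩
  · obtain ⟨b, hb, hb0⟩ := h
    exact ⟨⟨b, hb⟩, fun h0 => hb0 ((π.essentialRestriction_hom_eq_zero_iff ⟨b, hb⟩).1 h0)⟩
  by_cases h0 : L = ⊥
  · exact Or.inl h0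
  right
  obtain ⟨v, hv, hv0⟩ := (Submodule.ne_bot_iff L).1 h0
  let ι := π.essentialInclusion B
  have hι : IsClosed (ι '' (L : Set (π.essentialRestriction B).space)) :=
    ι.isometry.isClosedEmbedding.isClosedMap _ hL
  have hw0 : ι v ≠ 0 := fun h => hv0 (ι.injective (h.trans (map_zero ι).symm))
  have h2 : ∀ b ∈ B, ∀ w, π.hom b w ∈ ι '' L := fun b hb w => by
    refine (HilbertRep.IsIrreducible.denseRange hπ hw0).induction_on
      (p := fun w => π.hom b w ∈ ι '' L) w
      (hι.preimage (π.hom b).continuous) fun a => ?_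
    have h3 := ((π.hom b).continuous.tendsto _).comp (((π.hom a).continuous.tendsto _).comp
      (π.tendsto_hom_of_mem_essentialSpace hu h1 (π.essentialInclusion_mem v)))
    refine hι.mem_of_tendsto h3 (Eventually.of_forall fun e => ?_)
    refine ⟨_, hinv ⟨b * a * e, hB.mul_mul_mem hb e.2 a⟩ v hv, ?_⟩
    rw [HilbertRep.essentialInclusion_hom]
    exact (π.hom_mul_apply _ _ _).trans (π.hom_mul_apply _ _ _)
  have h3 : π.essentialSpace B ≤ L.map ι.toLinearMap := π.essentialSpace_le hι h2
  rw [Submodule.eq_top_iff']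
  intro w
  obtain ⟨w', hw', h4⟩ := h3 (π.essentialInclusion_mem w)
  exact ι.injective h4 ▸ hw'

/-- The irreducible representation `π_B`. -/
noncomputable def IrredRep.essentialRestriction (hB : IsHereditary B) (π : IrredRep A)
    (h : π.toSpectrum ∈ nonvanishingOn B) : IrredRep B :=
  ⟨π.1.essentialRestriction B, π.2.essentialRestriction hB h⟩

theorem pureExtension_pureState (hB : IsHereditary B) (π : IrredRep A)
    (h : π.toSpectrum ∈ nonvanishingOn B) (v : (π.1.essentialRestriction B).space) (hv : ‖v‖ = 1)
    (hv' : ‖π.1.essentialInclusion B v‖ = 1) :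
    pureExtension hB ((π.essentialRestriction hB h).pureState v hv) =
      π.pureState (π.1.essentialInclusion B v) hv' :=
  PureState.ext (eq_pureExtension hB (π.pureState _ hv').isPure.1 fun _ => rfl).symm

/-- A vector of `π` that implements the extension of a state of `B` lies in the essential
space. -/
theorem mem_essentialSpace_of_pureExtension_eq (hB : IsHereditary B) {τ : PureState B}
    {π : IrredRep A} {v : π.1.space}
    (h : (pureExtension hB τ).functional = π.1.vectorFunctional v) :
    v ∈ π.1.essentialSpace B := by
  obtain ⟨l, hl, hs, h1, hu⟩ := exists_approximateUnit_subalgebra B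
  have hv := PureState.norm_vector π.2 h
  refine π.1.mem_essentialSpace_of_tendsto (l := l) ?_
  rw [tendsto_iff_norm_sub_tendsto_zero]
  have h2 := (Complex.continuous_re.tendsto _).comp (τ.isPure.1.1.tendsto_norm hu h1)
  have h3 : Tendsto (fun e : B => √(2 * (‖v‖ ^ 2 - (π.1.vectorFunctional v (e : A)).re))) l
      (𝓝 0) := by
    have h4 : Tendsto (fun e : B => √(2 * (1 - (τ.functional e).re))) l (𝓝 0) := by
      have := (Real.continuous_sqrt.tendsto _).comp ((h2.const_sub 1).const_mul 2)
      simpa only [τ.isPure.1.2, Complex.ofReal_one, Complex.one_re, sub_self, mul_zero,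
        Real.sqrt_zero, Function.comp_def, Complex.reCLM_apply] using this
    refine h4.congr fun e => ?_
    rw [hv, one_pow, ← h, pureExtension_apply]
  refine squeeze_zero' (Eventually.of_forall fun e => norm_nonneg _) ?_ h3
  filter_upwards [h1] with e he
  rw [norm_sub_rev]
  exact π.1.norm_sub_hom_le he v

/-- The extension of pure states is compatible with the correspondence of `π` and `π_B`. -/
theorem gnsProj_pureExtension_eq_iff (hB : IsHereditary B) {τ : PureState B} {π : IrredRep A} :
    gnsProj (pureExtension hB τ) = π.toSpectrum ↔ ∃ h : π.toSpectrum ∈ nonvanishingOn B,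
      gnsProj τ = (π.essentialRestriction hB h).toSpectrum := by
  constructor
  · intro h
    obtain ⟨v, hv⟩ := gnsProj_eq_iff.1 h
    obtain ⟨w, rfl⟩ := π.1.exists_essentialInclusion_eq
      (mem_essentialSpace_of_pureExtension_eq hB hv)
    have h1 : τ.functional = (π.1.essentialRestriction B).vectorFunctional w :=
      ContinuousLinearMap.ext fun b => by
        rw [← pureExtension_apply hB, hv]; rfl
    have h2 : π.toSpectrum ∈ nonvanishingOn B := by
      rw [mem_nonvanishingOn_iff]
      by_contra! h3
      refine τ.functional_ne_zero (ContinuousLinearMap.ext fun b => ?_)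
      rw [h1, HilbertRep.vectorFunctional_essentialRestriction,
        HilbertRep.vectorFunctional_apply, h3 b b.2]
      simp
    exact ⟨h2, gnsProj_eq_iff.2 ⟨w, h1⟩⟩
  · rintro ⟨h, h1⟩
    obtain ⟨w, hw⟩ := gnsProj_eq_iff.1 h1
    refine gnsProj_eq_iff.2 ⟨π.1.essentialInclusion B w, ?_⟩
    have hw1 := PureState.norm_vector (π.essentialRestriction hB h).2 hw
    have h2 : τ = (π.essentialRestriction hB h).pureState w hw1 := PureState.ext hw
    rw [h2, pureExtension_pureState hB π h w hw1
      (((π.1.essentialInclusion B).norm_map w).trans hw1)]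
    rfl

end EssentialSpace

/-! ### The spectrum of a hereditary subalgebra -/

section Spectrum

open Filter Topology

variable {A : Type u} [NonUnitalCStarAlgebra A] {B : NonUnitalStarSubalgebra ℂ A}

theorem CStarSpectrum.mul_mem_ker_left {x : CStarSpectrum A} {a : A} (ha : a ∈ x.ker) (b : A) :
    b * a ∈ x.ker := by
  obtain ⟨π, rfl⟩ := x.exists_rep
  rw [IrredRep.mem_ker_toSpectrum] at ha ⊢
  rw [map_mul, ha, mul_zero]

theorem CStarSpectrum.mul_mem_ker_right {x : CStarSpectrum A} {a : A} (ha : a ∈ x.ker) (b : A) :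
    a * b ∈ x.ker := by
  obtain ⟨π, rfl⟩ := x.exists_rep
  rw [IrredRep.mem_ker_toSpectrum] at ha ⊢
  rw [map_mul, ha, zero_mul]

variable [PartialOrder A] [StarOrderedRing A] [IsClosed (B : Set A)]

/-- The map `[π_B] ↦ [π]` from the spectrum of a hereditary subalgebra to the spectrum of the
algebra: the class of the GNS representation of a pure state is sent to the class of the GNS
representation of its extension. -/
noncomputable def spectrumExtension (hB : IsHereditary B) (y : CStarSpectrum B) :
    CStarSpectrum A :=
  gnsProj (pureExtension hB (Function.surjInv gnsProj_surjective y))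

theorem spectrumExtension_eq_iff (hB : IsHereditary B) {y : CStarSpectrum B} {π : IrredRep A} :
    spectrumExtension hB y = π.toSpectrum ↔ ∃ h : π.toSpectrum ∈ nonvanishingOn B,
      y = (π.essentialRestriction hB h).toSpectrum := by
  rw [spectrumExtension, gnsProj_pureExtension_eq_iff, Function.surjInv_eq gnsProj_surjective]

theorem gnsProj_pureExtension (hB : IsHereditary B) (τ : PureState B) :
    gnsProj (pureExtension hB τ) = spectrumExtension hB (gnsProj τ) := by
  obtain ⟨π, hπ⟩ := (gnsProj (pureExtension hB τ)).exists_rep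
  have h := (gnsProj_pureExtension_eq_iff hB).1 hπ.symm
  rw [(spectrumExtension_eq_iff hB).2 h, hπ]

theorem spectrumExtension_mem (hB : IsHereditary B) (y : CStarSpectrum B) :
    spectrumExtension hB y ∈ nonvanishingOn B := by
  obtain ⟨π, hπ⟩ := (spectrumExtension hB y).exists_rep
  obtain ⟨h, -⟩ := (spectrumExtension_eq_iff hB).1 hπ.symm
  exact hπ ▸ h

theorem spectrumExtension_injective (hB : IsHereditary B) :
    Function.Injective (spectrumExtension hB) := fun y z h => by
  obtain ⟨π, hπ⟩ := (spectrumExtension hB y).exists_rep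
  obtain ⟨h1, h2⟩ := (spectrumExtension_eq_iff hB).1 hπ.symm
  obtain ⟨h3, h4⟩ := (spectrumExtension_eq_iff hB).1 (h.symm.trans hπ.symm)
  rw [h2, h4]

theorem range_spectrumExtension (hB : IsHereditary B) :
    Set.range (spectrumExtension hB) = nonvanishingOn B := by
  refine Set.Subset.antisymm (Set.range_subset_iff.2 (spectrumExtension_mem hB)) fun x hx => ?_
  obtain ⟨π, rfl⟩ := x.exists_rep
  exact ⟨_, (spectrumExtension_eq_iff hB).2 ⟨hx, rfl⟩⟩

theorem mem_ker_spectrumExtension (hB : IsHereditary B) {y : CStarSpectrum B} {b : B} :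
    (b : A) ∈ (spectrumExtension hB y).ker ↔ b ∈ y.ker := by
  obtain ⟨π, hπ⟩ := (spectrumExtension hB y).exists_rep
  obtain ⟨h1, h2⟩ := (spectrumExtension_eq_iff hB).1 hπ.symm
  rw [← hπ, h2, IrredRep.mem_ker_toSpectrum, IrredRep.mem_ker_toSpectrum]
  exact (π.1.essentialRestriction_hom_eq_zero_iff b).symm

/-- The closed sets of the two spectra correspond to each other, because a set `S ⊆ A` lies in
the kernel of a representation that does not vanish on `B` if and only if `B A S A B` does. -/
theorem isInducing_spectrumExtension (hB : IsHereditary B) :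
    IsInducing (spectrumExtension hB) := by
  refine ⟨TopologicalSpace.ext_iff_isClosed.2 fun F => ?_⟩
  rw [isClosed_induced_iff]
  constructor
  · intro hF
    obtain ⟨T, rfl⟩ := CStarSpectrum.isClosed_iff.1 hF
    refine ⟨_, CStarSpectrum.isClosed_iff.2 ⟨(↑) '' T, rfl⟩, ?_⟩
    ext y
    simp only [Set.mem_preimage, Set.mem_ofPred_eq, Set.image_subset_iff]
    exact forall₂_congr fun b _ => mem_ker_spectrumExtension hB
  · rintro ⟨_, hF, rfl⟩
    obtain ⟨S, rfl⟩ := CStarSpectrum.isClosed_iff.1 hF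
    refine CStarSpectrum.isClosed_iff.2
      ⟨{t : B | ∃ s ∈ S, ∃ a c : A, ∃ d ∈ B, (t : A) = d * a * s * c * d}, ?_⟩
    ext y
    simp only [Set.mem_preimage, Set.mem_ofPred_eq]
    constructor
    · rintro h t ⟨s, hs, a, c, d, hd, ht⟩
      rw [← mem_ker_spectrumExtension hB, ht]
      exact CStarSpectrum.mul_mem_ker_right (CStarSpectrum.mul_mem_ker_right
        (CStarSpectrum.mul_mem_ker_left (h hs) _) _) _
    · intro h s hs
      by_contra hs'
      obtain ⟨d, hd, hd'⟩ := spectrumExtension_mem hB y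
      obtain ⟨a, ha⟩ := CStarSpectrum.ker_prime _ hd' hs'
      obtain ⟨c, hc⟩ := CStarSpectrum.ker_prime _ ha hd'
      have h1 : d * a * s * c * d = d * (a * s * c) * d := by simp only [mul_assoc]
      have hm : d * a * s * c * d ∈ B := by
        rw [h1]
        exact hB.mul_mul_mem hd hd _
      exact hc ((mem_ker_spectrumExtension hB (b := ⟨_, hm⟩)).2 (h ⟨s, hs, a, c, d, hd, rfl⟩))

/-- The homeomorphism `[π_B] ↦ [π]`. -/
noncomputable def spectrumExtensionHomeomorph (hB : IsHereditary B) :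
    CStarSpectrum B ≃ₜ nonvanishingOn B :=
  (Topology.IsEmbedding.mk (isInducing_spectrumExtension hB)
    (spectrumExtension_injective hB)).toHomeomorph.trans
    (Homeomorph.setCongr (range_spectrumExtension hB))

end Spectrum

/-! ### Ideals among the hereditary subalgebras -/

section Ideals

open Filter Topology

variable {A : Type u} [NonUnitalCStarAlgebra A] {B : NonUnitalStarSubalgebra ℂ A}

theorem norm_sub_mul_left_sq {e : A} (he : star e = e) (c : A) :
    ‖c - e * c‖ ^ 2 = ‖c * star c - e * (c * star c) - c * star c * e + e * (c * star c) * e‖ := by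
  rw [sq, ← CStarRing.norm_self_mul_star]
  congr 1
  rw [star_sub, star_mul, he]
  noncomm_ring

theorem norm_sub_mul_right_sq {e : A} (he : star e = e) (c : A) :
    ‖c - c * e‖ ^ 2 = ‖star c * c - e * (star c * c) - star c * c * e + e * (star c * c) * e‖ := by
  have h := norm_sub_mul_left_sq he (star c)
  rw [star_star] at h
  rw [← h, ← norm_star, star_sub, star_mul, he]

/-- Along an approximate unit of `B`, the compressions of an element of `B` by `1 - e` tend to
zero. -/
theorem tendsto_compression {l : Filter B} (hl : l.IsApproximateUnit) (h1 : ∀ᶠ e in l, ‖e‖ ≤ 1)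
    {b : A} (hb : b ∈ B) :
    Tendsto (fun e : B => ‖b - e * b - b * e + e * b * e‖) l (𝓝 0) := by
  have h2 : Tendsto (fun e : B => ‖e * (⟨b, hb⟩ : B) - ⟨b, hb⟩‖) l (𝓝 0) :=
    tendsto_iff_norm_sub_tendsto_zero.1 (hl.tendsto_mul_right (⟨b, hb⟩ : B))
  have h3 := h2.const_mul 2
  rw [mul_zero] at h3
  refine squeeze_zero' (Eventually.of_forall fun e => norm_nonneg _) ?_ h3
  filter_upwards [h1] with e he
  have he' : ‖(e : A)‖ ≤ 1 := he
  change _ ≤ 2 * ‖(e : A) * b - b‖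
  have h4 : b - e * b - b * e + e * b * e = (e * b - b) * e - (e * b - b) := by noncomm_ring
  rw [h4]
  calc _ ≤ ‖(e * b - b) * e‖ + ‖(e : A) * b - b‖ := norm_sub_le _ _
    _ ≤ ‖(e : A) * b - b‖ * 1 + ‖(e : A) * b - b‖ := by
      gcongr
      exact (norm_mul_le _ _).trans (by gcongr)
    _ = _ := by ring

/-- The compression of `x` by `1 - e` is written out, because `A` need not be unital. -/
theorem norm_compression_le {e : A} (he : ‖e‖ ≤ 1) (x : A) :
    ‖x - e * x - x * e + e * x * e‖ ≤ 4 * ‖x‖ := by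
  have h1 : ‖e * x‖ ≤ ‖x‖ := (norm_mul_le _ _).trans (mul_le_of_le_one_left (norm_nonneg _) he)
  have h2 : ‖x * e‖ ≤ ‖x‖ := (norm_mul_le _ _).trans (mul_le_of_le_one_right (norm_nonneg _) he)
  have h3 : ‖e * x * e‖ ≤ ‖x‖ :=
    ((norm_mul_le _ _).trans (mul_le_of_le_one_right (norm_nonneg _) he)).trans h1
  have h4 := norm_add_le (x - e * x - x * e) (e * x * e)
  have h5 := norm_sub_le (x - e * x) (x * e)
  have h6 := norm_sub_le x (e * x)
  linarith

theorem tendsto_zero_of_sq {ι : Type*} {l : Filter ι} {f : ι → ℝ} (hf : ∀ i, 0 ≤ f i)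
    (h : Tendsto (fun i => f i ^ 2) l (𝓝 0)) : Tendsto f l (𝓝 0) := by
  have := (Real.continuous_sqrt.tendsto _).comp h
  rw [Real.sqrt_zero] at this
  exact this.congr fun i => Real.sqrt_sq (hf i)

variable [PartialOrder A] [StarOrderedRing A] [IsClosed (B : Set A)]

/-- An element is in `B` if it is the limit of the elements `ece`, where `e` runs through an
approximate unit of `B`. -/
theorem IsHereditary.mem_of_tendsto (hB : IsHereditary B) {l : Filter B} [l.NeBot]
    (h1 : ∀ᶠ e in l, ‖e‖ ≤ 1) {c : A} (hleft : Tendsto (fun e : B => ‖c - e * c‖) l (𝓝 0))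
    (hright : Tendsto (fun e : B => ‖c - c * e‖) l (𝓝 0)) : c ∈ B := by
  have h2 : Tendsto (fun e : B => (e : A) * c * e) l (𝓝 c) := by
    rw [tendsto_iff_norm_sub_tendsto_zero]
    have h3 := hleft.add hright
    rw [add_zero] at h3
    refine squeeze_zero' (Eventually.of_forall fun e => norm_nonneg _) ?_ h3
    filter_upwards [h1] with e he
    have he' : ‖(e : A)‖ ≤ 1 := he
    have h4 : (e : A) * c * e - c = -((c - e * c) * e + (c - c * e)) := by noncomm_ring
    rw [h4, norm_neg]
    refine (norm_add_le _ _).trans (add_le_add_left ?_ _)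
    exact (norm_mul_le _ _).trans (mul_le_of_le_one_right (norm_nonneg _) he')
  exact (‹IsClosed (B : Set A)›).mem_of_tendsto h2
    (Eventually.of_forall fun e => hB.mul_mul_mem e.2 e.2 c)

/-- A hereditary subalgebra contains `c` if it contains both `cc*` and `c*c`; that is, `B = L ∩ L*`
for the left ideal `L` of the elements `c` with `c*c ∈ B`. -/
theorem IsHereditary.mem_of_star_mul_self_mem (hB : IsHereditary B) {c : A} (h : c * star c ∈ B)
    (h' : star c * c ∈ B) : c ∈ B := by
  obtain ⟨l, hl, hs, h1, hu⟩ := exists_approximateUnit_subalgebra B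
  refine hB.mem_of_tendsto h1 (tendsto_zero_of_sq (fun _ => norm_nonneg _) ?_)
    (tendsto_zero_of_sq (fun _ => norm_nonneg _) ?_)
  · refine (tendsto_compression hu h1 h).congr' ?_
    filter_upwards [hs] with e he
    exact (norm_sub_mul_left_sq (congrArg Subtype.val he) c).symm
  · refine (tendsto_compression hu h1 h').congr' ?_
    filter_upwards [hs] with e he
    exact (norm_sub_mul_right_sq (congrArg Subtype.val he) c).symm

/-- The compression by `1 - e` is monotone. -/
theorem compression_le {e : A} (he : star e = e) {x y : A} (h : x ≤ y) :
    x - e * x - x * e + e * x * e ≤ y - e * y - y * e + e * y * e := by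
  obtain ⟨c, hc⟩ := CStarAlgebra.nonneg_iff_eq_star_mul_self.1 (sub_nonneg.2 h)
  rw [← sub_nonneg]
  have h1 : y = x + star c * c := by rw [← hc]; abel
  have h2 : y - e * y - y * e + e * y * e - (x - e * x - x * e + e * x * e) =
      star (c - c * e) * (c - c * e) := by
    rw [h1, star_sub, star_mul, he]
    noncomm_ring
  rw [h2]
  exact star_mul_self_nonneg _

/-- A positive element that can be approximated by elements that are dominated by elements of `B`
is in `B`. -/
theorem IsHereditary.mem_of_mem_closure (hB : IsHereditary B) {d : A} (hd : 0 ≤ d)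
    (h : d ∈ closure {x : A | ∃ b ∈ B, x + star x ≤ b}) : d ∈ B := by
  obtain ⟨l, hl, hs, h1, hu⟩ := exists_approximateUnit_subalgebra B
  let s := CFC.sqrt d
  have hss : star s = s := (IsSelfAdjoint.of_nonneg (CFC.sqrt_nonneg d)).star_eq
  have hsd : s * s = d := CFC.sqrt_mul_sqrt_self d
  have hds : star d = d := (IsSelfAdjoint.of_nonneg hd).star_eq
  have key : Tendsto (fun e : B => ‖s - s * e‖ ^ 2) l (𝓝 0) := by
    rw [Metric.tendsto_nhds]
    intro ε hε
    obtain ⟨x, ⟨b, hb, hxb⟩, hdx⟩ := Metric.mem_closure_iff.1 h (ε / 16) (by positivity)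
    rw [dist_eq_norm] at hdx
    have h2 := (tendsto_compression hu h1 hb).eventually_lt_const (show 0 < ε / 2 by positivity)
    filter_upwards [h1, h2, hs] with e he he2 hes
    have hes' : star (e : A) = e := congrArg Subtype.val hes
    have he' : ‖(e : A)‖ ≤ 1 := he
    let r := (d - x) + star (d - x)
    have hr : ‖r‖ ≤ ε / 8 := by
      refine (norm_add_le _ _).trans ?_
      rw [norm_star]
      linarith
    have h3 : d + d ≤ b + r := by
      have : d + d = (x + star x) + r := by
        simp only [r, star_sub, hds]
        abel
      rw [this]
      exact add_le_add_left hxb r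
    have h4 := compression_le hes' ((le_add_of_nonneg_left hd).trans h3)
    rw [Real.dist_eq, sub_zero, abs_of_nonneg (sq_nonneg _), norm_sub_mul_right_sq hes', hss, hsd]
    have h5 : 0 ≤ d - e * d - d * e + e * d * e := by
      simpa using compression_le hes' hd
    refine lt_of_le_of_lt (CStarAlgebra.norm_le_norm_of_nonneg_of_le h5 h4) ?_
    have h6 : b + r - e * (b + r) - (b + r) * e + e * (b + r) * e =
        (b - e * b - b * e + e * b * e) + (r - e * r - r * e + e * r * e) := by noncomm_ring
    rw [h6]
    refine (norm_add_le _ _).trans_lt ?_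
    have h7 := norm_compression_le he' r
    linarith
  have hright := tendsto_zero_of_sq (fun _ => norm_nonneg _) key
  have hleft : Tendsto (fun e : B => ‖s - e * s‖) l (𝓝 0) := by
    refine hright.congr' ?_
    filter_upwards [hs] with e he
    have he' : star (e : A) = e := congrArg Subtype.val he
    rw [← norm_star, star_sub, star_mul, he', hss]
  have hsB := hB.mem_of_tendsto h1 hleft hright
  rw [← hsd]
  exact mul_mem hsB hsB

/-- A positive element outside of `B` is detected by a quasi-state that vanishes on `B`. The
Hahn-Banach theorem is applied to the closed cone of limits of elements `x` such that `x + x*` is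
dominated by an element of `B`: a functional that is bounded above on this cone is automatically
positive and vanishes on `B`. -/
theorem IsHereditary.exists_quasiState (hB : IsHereditary B) {d : A} (hd : 0 ≤ d) (hdB : d ∉ B) :
    ∃ φ : A →L[ℂ] ℂ, IsPositiveFunctional φ ∧ ‖φ‖ ≤ 1 ∧ (∀ b ∈ B, φ b = 0) ∧ 0 < (φ d).re := by
  let C : Set A := {x : A | ∃ b ∈ B, x + star x ≤ b}
  have hsmul : ∀ (r : ℝ) (x : A), star (r • x) = r • star x := fun r x => by
    rw [star_smul, star_trivial]
  have hC1 : ∀ x ∈ C, ∀ r : ℝ, 0 ≤ r → r • x ∈ C := by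
    rintro x ⟨b, hb, hxb⟩ r hr
    refine ⟨(r : ℂ) • b, SMulMemClass.smul_mem _ hb, ?_⟩
    rw [hsmul, ← smul_add]
    exact smul_le_smul_of_nonneg_left hxb hr
  have hC2 : ∀ x ∈ C, ∀ y ∈ C, x + y ∈ C := by
    rintro x ⟨b, hb, hxb⟩ y ⟨c, hc, hyc⟩
    refine ⟨b + c, add_mem hb hc, ?_⟩
    rw [star_add, add_add_add_comm]
    exact add_le_add hxb hyc
  have hC : Convex ℝ (closure C) := by
    refine Convex.closure fun x hx y hy s t hs ht _ => hC2 _ (hC1 x hx s hs) _ (hC1 y hy t ht)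
  obtain ⟨f, u, hf1, hf2⟩ := RCLike.geometric_hahn_banach_closed_point (𝕜 := ℂ) hC
    isClosed_closure fun h => hdB (hB.mem_of_mem_closure hd h)
  have h0C : (0 : A) ∈ C := ⟨0, zero_mem _, by simp⟩
  have hu : 0 < u := by
    have := hf1 0 (subset_closure h0C)
    simpa using this
  have hf : ∀ x ∈ C, (f x).re ≤ 0 := fun x hx => by
    by_contra! hcon
    have h1 := hf1 _ (subset_closure (hC1 x hx (u / (f x).re) (by positivity)))
    have h2 : f ((u / (f x).re) • x) = (u / (f x).re : ℝ) • f x :=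
      map_real_smul f f.continuous _ _
    rw [h2] at h1
    simp only [RCLike.re_eq_complex_re, Complex.real_smul, Complex.re_ofReal_mul] at h1
    rw [div_mul_cancel₀ _ hcon.ne'] at h1
    exact lt_irrefl _ h1
  -- skew-adjoint elements are in `C`, hence `f` is Hermitian
  have him : ∀ h : A, star h = h → (f h).im = 0 := fun h hh => by
    have h1 : ∀ z : ℂ, z.re = 0 → z • h ∈ C := fun z hz => ⟨0, zero_mem _, by
      have : star z = -z := by
        apply Complex.ext <;> simp [hz]
      rw [star_smul, hh, this, neg_smul, add_neg_cancel]⟩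
    have h2 := hf _ (h1 Complex.I (by simp))
    have h3 := hf _ (h1 (-Complex.I) (by simp))
    rw [map_smul] at h2 h3
    simp at h2 h3
    linarith
  have hpos : IsPositiveFunctional f := fun a => by
    have h1 : -(star a * a) ∈ C := ⟨0, zero_mem _, by
      have := star_mul_self_nonneg a
      rw [star_neg, star_mul, star_star]
      exact add_nonpos (neg_nonpos.2 this) (neg_nonpos.2 this)⟩
    have h2 := hf _ h1
    rw [map_neg, Complex.neg_re, neg_nonpos] at h2
    rw [Complex.le_def]
    exact ⟨h2, (him _ (by rw [star_mul, star_star])).symm⟩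
  have hfB : ∀ b ∈ B, f b = 0 := fun b hb => by
    obtain ⟨π, v, -, hv⟩ := hpos.exists_cyclic
    have h1 : (f (star b * b)).re ≤ 0 := hf _ ⟨star b * b + star b * b,
      add_mem (mul_mem (star_mem hb) hb) (mul_mem (star_mem hb) hb), by
        rw [star_mul, star_star]⟩
    have h2 : f (star b * b) = 0 := by
      refine le_antisymm ?_ (hpos b)
      rw [Complex.le_def]
      exact ⟨h1, him _ (by rw [star_mul, star_star])⟩
    rw [hv, π.vectorFunctional_star_mul, inner_self_eq_zero] at h2
    rw [hv, π.vectorFunctional_apply, h2, inner_zero_right]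
  have hfd : 0 < (f d).re := hu.trans hf2
  have hf0 : 0 < ‖f‖ := norm_pos_iff.2 fun h => by simp [h] at hfd
  refine ⟨‖f‖⁻¹ • f, hpos.smul (inv_nonneg.2 hf0.le), ?_, fun b hb => ?_, ?_⟩
  · rw [norm_smul, norm_inv, norm_norm, inv_mul_cancel₀ hf0.ne']
  · rw [smul_apply, hfB b hb, smul_zero]
  · rw [smul_apply, Complex.real_smul, Complex.re_ofReal_mul]
    positivity

/-- A positive element outside of `B` is detected by a pure state that vanishes on `B`: the
quasi-states that vanish on `B` are a face of the quasi-states, so the extreme points of the subset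
on which the value at `d` is maximal are pure states. -/
theorem IsHereditary.exists_pureState (hB : IsHereditary B) {d : A} (hd : 0 ≤ d) (hdB : d ∉ B) :
    ∃ ω : PureState A, (∀ b ∈ B, ω.functional b = 0) ∧ ω.functional d ≠ 0 := by
  obtain ⟨φ, hφ, hφ1, hφB, hφd⟩ := hB.exists_quasiState hd hdB
  let F : Set (A → ℂ) := quasiStates A ∩ ⋂ b ∈ B, {f | f b = 0}
  have hFm : ∀ f, f ∈ F ↔ f ∈ quasiStates A ∧ ∀ b ∈ B, f b = 0 := fun f => by simp [F]
  have hF : IsCompact F := isCompact_quasiStates.inter_right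
    (isClosed_biInter fun b _ => isClosed_eq (continuous_apply b) continuous_const)
  have hev : Continuous fun f : A → ℂ => (f d).re :=
    Complex.continuous_re.comp (continuous_apply d)
  obtain ⟨g, hg, hmax⟩ := hF.exists_isMaxOn ⟨φ, (hFm _).2 ⟨⟨φ, hφ, hφ1, rfl⟩, hφB⟩⟩
    hev.continuousOn
  have hgd : 0 < (g d).re := hφd.trans_le (hmax ((hFm _).2 ⟨⟨φ, hφ, hφ1, rfl⟩, hφB⟩))
  let G : Set (A → ℂ) := F ∩ {f | (f d).re = (g d).re}
  have hG : IsCompact G := hF.inter_right (isClosed_eq hev continuous_const)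
  have hext : IsExtreme ℝ (quasiStates A) G := by
    refine ⟨fun f hf => hf.1.1, ?_⟩
    rintro _ ⟨σ, hσ, hσ1, rfl⟩ _ ⟨ρ, hρ, hρ1, rfl⟩ f ⟨hfF, hfd⟩ ⟨s, t, hs, ht, hst, rfl⟩
    have h1 : ∀ (σ ρ : A →L[ℂ] ℂ), IsPositiveFunctional σ → IsPositiveFunctional ρ →
        ∀ s t : ℝ, 0 < s → 0 < t → (∀ b ∈ B, (s • ⇑σ + t • ⇑ρ) b = 0) → ∀ b ∈ B, σ b = 0 := by
      intro σ ρ hσ hρ s t hs ht h b hb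
      obtain ⟨π, v, -, hv⟩ := hσ.exists_cyclic
      have h2 : (s : ℂ) * σ (star b * b) + (t : ℂ) * ρ (star b * b) = 0 :=
        h _ (mul_mem (star_mem hb) hb)
      have h3 := hσ b
      have h4 := hρ b
      have h5 : σ (star b * b) = 0 := by
        have hs' : (0 : ℂ) < s := Complex.zero_lt_real.2 hs
        have ht' : (0 : ℂ) < t := Complex.zero_lt_real.2 ht
        have h6 := ((add_eq_zero_iff_of_nonneg (mul_nonneg hs'.le h3)
          (mul_nonneg ht'.le h4)).1 h2).1
        exact (mul_eq_zero.1 h6).resolve_left hs'.ne'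
      rw [hv, π.vectorFunctional_star_mul, inner_self_eq_zero] at h5
      rw [hv, π.vectorFunctional_apply, h5, inner_zero_right]
    have hB1 := h1 σ ρ hσ hρ s t hs ht ((hFm _).1 hfF).2
    have hB2 := h1 ρ σ hρ hσ t s ht hs (by
      rw [add_comm]; exact ((hFm _).1 hfF).2)
    have hσF : ⇑σ ∈ F := (hFm _).2 ⟨⟨σ, hσ, hσ1, rfl⟩, hB1⟩
    have hρF : ⇑ρ ∈ F := (hFm _).2 ⟨⟨ρ, hρ, hρ1, rfl⟩, hB2⟩
    refine ⟨hσF, ?_⟩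
    have h2 : (σ d).re ≤ (g d).re := hmax hσF
    have h3 : (ρ d).re ≤ (g d).re := hmax hρF
    have h4 : s * (σ d).re + t * (ρ d).re = (g d).re := by
      rw [← hfd]
      simp
    refine le_antisymm h2 ?_
    by_contra! h5
    have h6 : s * (σ d).re + t * (ρ d).re < s * (g d).re + t * (g d).re :=
      add_lt_add_of_lt_of_le (by gcongr) (by gcongr)
    rw [← add_mul, hst, one_mul] at h6
    exact h6.ne h4
  obtain ⟨f, hf⟩ := hG.extremePoints_nonempty ⟨g, hg, rfl⟩
  have hf' := hext.extremePoints_subset_extremePoints hf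
  obtain ⟨ψ, hψ, hψ1, rfl⟩ := hf'.1
  have hψd : (ψ d).re = (g d).re := hf.1.2
  have hψd' : ψ d ≠ 0 := fun h => by
    rw [h, Complex.zero_re] at hψd
    exact hgd.ne hψd
  exact ⟨⟨ψ, isPureState_of_mem_extremePoints hf' fun h => hψd' (by rw [h]; rfl)⟩,
    ((hFm _).1 hf.1.1).2, hψd'⟩

/-- In a representation that does not vanish on `B`, the extended states are the vector states of
the essential space. -/
theorem mem_range_pureExtension_iff (hB : IsHereditary B) {ω : PureState A} {π : IrredRep A}
    (h : π.toSpectrum ∈ nonvanishingOn B) {v : π.1.space}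
    (hv : ω.functional = π.1.vectorFunctional v) :
    ω ∈ Set.range (pureExtension hB) ↔ v ∈ π.1.essentialSpace B := by
  constructor
  · rintro ⟨τ, rfl⟩
    exact mem_essentialSpace_of_pureExtension_eq hB hv
  · intro hvB
    obtain ⟨w, rfl⟩ := π.1.exists_essentialInclusion_eq hvB
    have h1 := PureState.norm_vector π.2 hv
    refine ⟨(π.essentialRestriction hB h).pureState w
      (((π.1.essentialInclusion B).norm_map w).symm.trans h1), ?_⟩
    rw [pureExtension_pureState hB π h w _ h1]
    exact PureState.ext hv.symm

/-- If `B` is an ideal, the essential spaces are invariant under `A`. -/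
theorem IsTwoSidedIdeal.range_pureExtension (hB : IsHereditary B) (hI : IsTwoSidedIdeal B) :
    Set.range (pureExtension hB) = gnsProj ⁻¹' nonvanishingOn B := by
  refine Set.Subset.antisymm (Set.range_subset_iff.2 fun τ => ?_) fun ω hω => ?_
  · rw [Set.mem_preimage, gnsProj_pureExtension]
    exact spectrumExtension_mem hB _
  obtain ⟨π, hπ⟩ := (gnsProj ω).exists_rep
  have h : π.toSpectrum ∈ nonvanishingOn B := hπ ▸ hω
  obtain ⟨v, hv⟩ := gnsProj_eq_iff.1 hπ.symm
  rw [mem_range_pureExtension_iff hB h hv]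
  have htop : π.1.essentialSpace B = ⊤ := by
    refine (π.2.2 _ π.1.isClosed_essentialSpace fun a w hw => ?_).resolve_left fun hbot => ?_
    · have h1 : π.1.essentialSpace B ≤
          (π.1.essentialSpace B).comap (π.1.hom a).toLinearMap := by
        refine π.1.essentialSpace_le (π.1.isClosed_essentialSpace.preimage (π.1.hom a).continuous)
          fun b hb w => ?_
        change π.1.hom a (π.1.hom b w) ∈ π.1.essentialSpace B
        rw [← π.1.hom_mul_apply]
        exact π.1.hom_mem_essentialSpace B (hI a b hb).1 w
      exact h1 hw
    · obtain ⟨b, hb, hb0⟩ := mem_nonvanishingOn_iff.1 h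
      refine hb0 (ContinuousLinearMap.ext fun w => ?_)
      have := π.1.hom_mem_essentialSpace B hb w
      rw [hbot] at this
      exact (Submodule.mem_bot ℂ).1 this
  rw [htop]
  exact Submodule.mem_top

/-- If all pure states that do not vanish on the ideal generated by `B` are extensions of pure
states of `B`, then `B` is an ideal: otherwise, `cc* ∉ B` for some `c = ab` with `b ∈ B`, and a pure
state that vanishes on `B` but not at `cc*` belongs to a representation with `π(B) ≠ 0`. -/
theorem isTwoSidedIdeal_of_range_pureExtension (hB : IsHereditary B)
    (h : Set.range (pureExtension hB) = gnsProj ⁻¹' nonvanishingOn B) : IsTwoSidedIdeal B := by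
  have key : ∀ a, ∀ b ∈ B, a * b * star (a * b) ∈ B := fun a b hb => by
    by_contra hcon
    obtain ⟨ω, hω, hωd⟩ := hB.exists_pureState (mul_star_self_nonneg (a * b)) hcon
    have h1 : gnsProj ω ∈ nonvanishingOn B := by
      obtain ⟨π, hπ⟩ := (gnsProj ω).exists_rep
      obtain ⟨v, hv⟩ := gnsProj_eq_iff.1 hπ.symm
      rw [← hπ, mem_nonvanishingOn_iff]
      refine ⟨b, hb, fun h0 => hωd ?_⟩
      rw [hv, π.1.vectorFunctional_apply, map_mul, map_star, map_mul, h0, mul_zero, zero_mul]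
      exact inner_zero_right v
    have h2 : ω ∈ Set.range (pureExtension hB) := by rw [h]; exact h1
    obtain ⟨τ, rfl⟩ := h2
    refine τ.functional_ne_zero (ContinuousLinearMap.ext fun b => ?_)
    rw [← pureExtension_apply hB, hω b b.2]
    rfl
  have h1 : ∀ a, ∀ b ∈ B, a * b ∈ B := fun a b hb => by
    refine hB.mem_of_star_mul_self_mem (key a b hb) ?_
    have h2 : star (a * b) * (a * b) = star b * (star a * a) * b := by
      rw [star_mul]
      noncomm_ring
    rw [h2]
    exact hB.star_mul_mul_mem hb _
  refine fun a b hb => ⟨h1 a b hb, ?_⟩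
  have h2 := star_mem (h1 (star a) (star b) (star_mem hb))
  rwa [star_mul, star_star, star_star] at h2

end Ideals

/-! ### Local isometries between Kähler charts -/

section KahlerCharts

open Filter Topology

variable {M N P : Type u}

/-- The local form of `KahlerChart.IsHolomorphicIsometric`: near the point `m`, the map `f` is
defined on a neighborhood of the coordinate of `m`, holomorphic, and isometric, in the charts `c`
and `d`. -/
def KahlerChart.IsHolomorphicIsometricAt (c : KahlerChart M) (d : KahlerChart N) (f : M → N)
    (m : M) : Prop :=
  ∃ W : Set c.model, IsOpen W ∧ c.toFun m ∈ W ∧ ∃ τ : c.model → d.model, DifferentiableOn ℂ τ W ∧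
    ∀ z ∈ W, (∃ n ∈ c.source, f n ∈ d.source ∧ c.toFun n = z ∧ d.toFun (f n) = τ z) ∧
      ∀ v w, d.metric (τ z) (fderiv ℂ τ z v) (fderiv ℂ τ z w) = c.metric z v w

namespace KahlerChart

variable {c : KahlerChart M} {d : KahlerChart N} {e : KahlerChart P} {f : M → N} {g : N → P}

theorem IsHolomorphicIsometric.at (h : c.IsHolomorphicIsometric d f) {m : M} (hm : m ∈ c.source)
    (hfm : f m ∈ d.source) : c.IsHolomorphicIsometricAt d f m := by
  obtain ⟨hW, τ, hτ, hm'⟩ := h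
  refine ⟨_, hW, ⟨m, ⟨hm, hfm⟩, rfl⟩, τ, hτ, ?_⟩
  rintro _ ⟨n, hn, rfl⟩
  obtain ⟨h1, h2⟩ := hm' n hn
  refine ⟨⟨n, hn.1, hn.2, rfl, h1.symm⟩, fun v w => ?_⟩
  rw [h1]
  exact h2 v w

/-- A map that is locally holomorphic and isometric in the given charts is so globally. -/
theorem isHolomorphicIsometric_of_at (hc : Set.InjOn c.toFun c.source)
    (h : ∀ m ∈ c.source, f m ∈ d.source → c.IsHolomorphicIsometricAt d f m) :
    c.IsHolomorphicIsometric d f := by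
  classical
  let S := c.toFun '' (c.source ∩ f ⁻¹' d.source)
  let τ : c.model → d.model := fun z =>
    if hz : ∃ n, n ∈ c.source ∩ f ⁻¹' d.source ∧ c.toFun n = z then d.toFun (f hz.choose) else 0
  have hτ : ∀ n ∈ c.source, f n ∈ d.source → τ (c.toFun n) = d.toFun (f n) := fun n hn hfn => by
    have hz : ∃ n', n' ∈ c.source ∩ f ⁻¹' d.source ∧ c.toFun n' = c.toFun n := ⟨n, ⟨hn, hfn⟩, rfl⟩
    simp only [τ]
    rw [dif_pos hz]
    congr 2
    exact hc hz.choose_spec.1.1 hn hz.choose_spec.2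
  have key : ∀ m ∈ c.source, f m ∈ d.source → ∃ W : Set c.model, IsOpen W ∧ c.toFun m ∈ W ∧
      W ⊆ S ∧ DifferentiableAt ℂ τ (c.toFun m) ∧ ∀ v w, d.metric (τ (c.toFun m))
        (fderiv ℂ τ (c.toFun m) v) (fderiv ℂ τ (c.toFun m) w) = c.metric (c.toFun m) v w := by
    intro m hm hfm
    obtain ⟨W, hW, hmW, τ', hτ', h'⟩ := h m hm hfm
    have heq : ∀ z ∈ W, τ z = τ' z := fun z hz => by
      obtain ⟨⟨n, hn, hfn, rfl, h2⟩, -⟩ := h' z hz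
      rw [hτ n hn hfn, h2]
    have heq' : τ =ᶠ[𝓝 (c.toFun m)] τ' := by
      filter_upwards [hW.mem_nhds hmW] with z hz using heq z hz
    refine ⟨W, hW, hmW, fun z hz => ?_, ?_, fun v w => ?_⟩
    · obtain ⟨⟨n, hn, hfn, rfl, -⟩, -⟩ := h' z hz
      exact ⟨n, ⟨hn, hfn⟩, rfl⟩
    · exact ((hτ'.differentiableAt (hW.mem_nhds hmW))).congr_of_eventuallyEq heq'
    · rw [heq'.fderiv_eq, heq _ hmW]
      exact (h' _ hmW).2 v w
  refine ⟨?_, τ, ?_, ?_⟩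
  · rw [isOpen_iff_mem_nhds]
    rintro _ ⟨m, hm, rfl⟩
    obtain ⟨W, hW, hmW, hWS, -⟩ := key m hm.1 hm.2
    exact mem_of_superset (hW.mem_nhds hmW) hWS
  · rintro _ ⟨m, hm, rfl⟩
    obtain ⟨-, -, -, -, hd, -⟩ := key m hm.1 hm.2
    exact hd.differentiableWithinAt
  · intro m hm
    obtain ⟨-, -, -, -, -, hd⟩ := key m hm.1 hm.2
    have h1 := hτ m hm.1 hm.2
    rw [h1] at hd
    exact ⟨h1, hd⟩

/-- The derivatives in the definition are taken in the models of the charts, so the statement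
follows from the chain rule. -/
theorem IsHolomorphicIsometricAt.comp {m : M} (hd : Set.InjOn d.toFun d.source)
    (hm : m ∈ c.source) (hc : Set.InjOn c.toFun c.source)
    (hg : d.IsHolomorphicIsometricAt e g (f m)) (hf : c.IsHolomorphicIsometricAt d f m) :
    c.IsHolomorphicIsometricAt e (g ∘ f) m := by
  obtain ⟨W, hW, hmW, τ, hτ, h⟩ := hf
  obtain ⟨W', hW', hmW', τ', hτ', h'⟩ := hg
  have hτm : τ (c.toFun m) = d.toFun (f m) := by
    obtain ⟨⟨n, hn, hfn, h1, h2⟩, -⟩ := h _ hmW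
    rw [hc hn hm h1] at h2
    exact h2.symm
  refine ⟨W ∩ τ ⁻¹' W', hτ.continuousOn.isOpen_inter_preimage hW hW',
    ⟨hmW, by rw [Set.mem_preimage, hτm]; exact hmW'⟩, τ' ∘ τ,
    hτ'.comp (hτ.mono Set.inter_subset_left) fun z hz => hz.2, ?_⟩
  rintro z ⟨hz, hz'⟩
  obtain ⟨⟨n, hn, hfn, h1, h2⟩, h3⟩ := h z hz
  obtain ⟨⟨n', hn', hfn', h1', h2'⟩, h3'⟩ := h' _ hz'
  have hnn : n' = f n := hd hn' hfn (h1'.trans h2.symm)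
  subst hnn
  refine ⟨⟨n, hn, hfn', h1, h2'⟩, fun v w => ?_⟩
  rw [fderiv_comp z (hτ'.differentiableAt (hW'.mem_nhds hz'))
    (hτ.differentiableAt (hW.mem_nhds hz))]
  exact (h3' _ _).trans (h3 v w)

/-- In the coordinates of a chart and of its pullback along `f`, the map `f` is the identity. -/
theorem isHolomorphicIsometricAt_pullback {c : KahlerChart M} {f : N → M}
    (hf : Function.Surjective f) (hc : IsOpen (c.toFun '' c.source)) {n : N}
    (hn : f n ∈ c.source) : (c.pullback f).IsHolomorphicIsometricAt c f n := by
  refine ⟨c.toFun '' c.source, hc, ⟨f n, hn, rfl⟩, id, differentiableOn_id, ?_⟩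
  rintro _ ⟨m, hm, rfl⟩
  obtain ⟨m, rfl⟩ := hf m
  have h : ∀ (z : c.model) (v w), c.metric z (fderiv ℂ id z v) (fderiv ℂ id z w) =
      c.metric z v w := fun z v w => by rw [fderiv_id]; rfl
  exact ⟨⟨m, hm, hm, rfl, rfl⟩, h _⟩

theorem isHolomorphicIsometricAt_pullback_symm {c : KahlerChart M} (f : N ≃ M)
    (hc : IsOpen (c.toFun '' c.source)) {m : M}
    (hm : m ∈ c.source) : c.IsHolomorphicIsometricAt (c.pullback f) f.symm m := by
  refine ⟨c.toFun '' c.source, hc, ⟨m, hm, rfl⟩, id, differentiableOn_id, ?_⟩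
  rintro _ ⟨m, hm, rfl⟩
  have h : ∀ (z : c.model) (v w), c.metric z (fderiv ℂ id z v) (fderiv ℂ id z w) =
      c.metric z v w := fun z v w => by rw [fderiv_id]; rfl
  refine ⟨⟨m, hm, ?_, rfl, ?_⟩, h _⟩
  · change f (f.symm m) ∈ c.source
    rwa [f.apply_symm_apply]
  · change c.toFun (f (f.symm m)) = _
    rw [f.apply_symm_apply]; rfl

end KahlerChart

section Atlas

variable {K : Set (KahlerChart M)}

theorem IsKahlerManifold.subset_maximalKahlerAtlas (hK : IsKahlerManifold K) :
    K ⊆ maximalKahlerAtlas K := fun c hc =>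
  ⟨hK.isKahler c hc, fun d hd => ⟨hK.compatible c hc d hd, hK.compatible d hd c hc⟩⟩

/-- The charts of the maximal atlas are compatible. -/
theorem IsKahlerManifold.isHolomorphicIsometricAt (hK : IsKahlerManifold K) {c d : KahlerChart M}
    (hc : c ∈ maximalKahlerAtlas K) (hd : d ∈ maximalKahlerAtlas K) {m : M} (hmc : m ∈ c.source)
    (hmd : m ∈ d.source) : c.IsHolomorphicIsometricAt d id m := by
  obtain ⟨e, he, hme⟩ := hK.covers m
  exact ((hd.2 e he).2.at hme hmd).comp (hK.isKahler e he).injOn hmc hc.1.injOn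
    ((hc.2 e he).1.at hmc hme)

theorem IsKahlerManifold.isOpen_image (hK : IsKahlerManifold K) {U : Set M} (hU : IsAtlasOpen K U)
    {c : KahlerChart M} (hc : c ∈ maximalKahlerAtlas K) :
    IsOpen (c.toFun '' (c.source ∩ U)) := by
  rw [isOpen_iff_mem_nhds]
  rintro _ ⟨m, ⟨hm, hmU⟩, rfl⟩
  obtain ⟨e, he, hme⟩ := hK.covers m
  obtain ⟨W, hW, hmW, τ, hτ, h⟩ := (hc.2 e he).1.at hm hme
  have hτm : τ (c.toFun m) = e.toFun m := by
    obtain ⟨⟨n, hn, hfn, h1, h2⟩, -⟩ := h _ hmW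
    rw [hc.1.injOn hn hm h1] at h2
    exact h2.symm
  have h1 : IsOpen (W ∩ τ ⁻¹' (e.toFun '' (e.source ∩ U))) :=
    hτ.continuousOn.isOpen_inter_preimage hW (hU e he)
  refine mem_of_superset (h1.mem_nhds ⟨hmW, ?_⟩) ?_
  · rw [Set.mem_preimage, hτm]
    exact ⟨m, ⟨hme, hmU⟩, rfl⟩
  · rintro z ⟨hz, n', hn', hn'z⟩
    obtain ⟨⟨n, hn, hfn, h2, h3⟩, -⟩ := h z hz
    have : n' = n := (hK.isKahler e he).injOn hn'.1 hfn (hn'z.trans h3.symm)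
    exact ⟨n, ⟨hn, this ▸ hn'.2⟩, h2⟩

/-- A bijection is a holomorphic Kähler isometry if it is so locally, in suitable charts. -/
theorem isHolomorphicKahlerIsometry_of_local {L : Set (KahlerChart N)} (hK : IsKahlerManifold K)
    (hL : IsKahlerManifold L) (f : M ≃ N)
    (h : ∀ m, ∃ c ∈ K, ∃ d ∈ L, m ∈ c.source ∧ f m ∈ d.source ∧
      c.IsHolomorphicIsometricAt d f m ∧ d.IsHolomorphicIsometricAt c f.symm (f m)) :
    IsHolomorphicKahlerIsometry K L f := by
  intro c hc d hd
  have hcK := hK.isKahler c hc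
  have hdL := hL.isKahler d hd
  constructor
  · refine KahlerChart.isHolomorphicIsometric_of_at hcK.injOn fun m hm hfm => ?_
    obtain ⟨c', hc', d', hd', hm', hfm', h1, -⟩ := h m
    have h2 := h1.comp (hK.isKahler c' hc').injOn hm hcK.injOn
      ((hK.compatible c hc c' hc').at hm hm')
    exact ((hL.compatible d' hd' d hd).at hfm' hfm).comp (f := f ∘ id)
      (hL.isKahler d' hd').injOn hm hcK.injOn h2
  · refine KahlerChart.isHolomorphicIsometric_of_at hdL.injOn fun n hn hfn => ?_
    obtain ⟨m, rfl⟩ := f.surjective n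
    have hfn' : m ∈ c.source := by
      rwa [f.symm_apply_apply] at hfn
    obtain ⟨c', hc', d', hd', hm', hfm', -, h1⟩ := h m
    have h2 := h1.comp (hL.isKahler d' hd').injOn hn hdL.injOn
      ((hL.compatible d hd d' hd').at hn hfm')
    have h3 : c'.IsHolomorphicIsometricAt c id ((f.symm ∘ id) (f m)) := by
      rw [Function.comp_apply, id, f.symm_apply_apply]
      exact (hK.compatible c' hc' c hc).at hm' hfn'
    exact h3.comp (f := f.symm ∘ id) (hK.isKahler c' hc').injOn hn hdL.injOn h2

end Atlas

section Pullback

theorem KahlerChart.image_pullback (c : KahlerChart M) (f : N ≃ M) (U : Set M) :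
    (c.pullback f).toFun '' ((c.pullback f).source ∩ f ⁻¹' U) = c.toFun '' (c.source ∩ U) := by
  change (c.toFun ∘ f) '' (f ⁻¹' c.source ∩ f ⁻¹' U) = _
  rw [Set.image_comp, ← Set.preimage_inter, f.image_preimage]

theorem KahlerChart.IsKahler.pullback {c : KahlerChart M} (hc : c.IsKahler) (f : N ≃ M) :
    (c.pullback f).IsKahler := by
  have h1 : (c.pullback f).toFun '' (c.pullback f).source = c.toFun '' c.source := by
    simpa using! c.image_pullback f Set.univ
  refine ⟨fun m hm n hn h => f.injective (hc.injOn hm hn h), ?_, ?_, ?_, ?_, ?_⟩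
  · rw [h1]; exact hc.isOpen_image
  · rw [h1]; exact hc.hermitian
  · rw [h1]; exact hc.pos
  · rw [h1]; exact hc.smooth
  · rw [h1]; exact hc.closed

/-- The pullback of a set of charts along a map. -/
def pullbackAtlas (K : Set (KahlerChart M)) (f : N → M) : Set (KahlerChart N) :=
  {c | ∃ d ∈ K, c = d.pullback f}

theorem IsAtlasOpen.preimage {K : Set (KahlerChart M)} {U : Set M} (hU : IsAtlasOpen K U)
    (f : N ≃ M) : IsAtlasOpen (pullbackAtlas K f) (f ⁻¹' U) := by
  rintro _ ⟨c, hc, rfl⟩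
  rw [c.image_pullback]
  exact hU c hc

theorem IsKahlerManifold.pullback {K : Set (KahlerChart M)} (hK : IsKahlerManifold K) (f : N ≃ M) :
    IsKahlerManifold (pullbackAtlas K f) := by
  refine ⟨fun n => ?_, ?_, ?_, fun m n hmn => ?_⟩
  · obtain ⟨c, hc, hn⟩ := hK.covers (f n)
    exact ⟨_, ⟨c, hc, rfl⟩, hn⟩
  · rintro _ ⟨c, hc, rfl⟩
    exact (hK.isKahler c hc).pullback f
  · rintro _ ⟨c, hc, rfl⟩ _ ⟨d, hd, rfl⟩
    have hcK := hK.isKahler c hc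
    have hdK := hK.isKahler d hd
    refine KahlerChart.isHolomorphicIsometric_of_at (hcK.pullback f).injOn fun n hn hn' => ?_
    have h1 := KahlerChart.isHolomorphicIsometricAt_pullback (c := c) f.surjective
      hcK.isOpen_image (n := n) hn
    have h2 := ((hK.compatible c hc d hd).at (m := f n) hn hn').comp hcK.injOn hn
      (hcK.pullback f).injOn h1
    have h3 := (KahlerChart.isHolomorphicIsometricAt_pullback_symm (c := d) f
      hdK.isOpen_image (m := f n) hn').comp (f := id ∘ f) hdK.injOn hn (hcK.pullback f).injOn h2
    have h4 : f.symm ∘ id ∘ f = id := funext fun n => f.symm_apply_apply n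
    rwa [h4] at h3
  · obtain ⟨U, V, hU, hV, hm, hn, hUV⟩ := hK.hausdorff (f m) (f n) fun h => hmn (f.injective h)
    exact ⟨_, _, hU.preimage f, hV.preimage f, hm, hn, hUV.preimage f⟩

end Pullback

end KahlerCharts

/-! ### Induced Kähler structures -/

section InducedStructure

open Filter Topology

section SesquilinearForms

variable {V W : Type*} [NormedAddCommGroup V] [InnerProductSpace ℂ V] [NormedAddCommGroup W]
  [InnerProductSpace ℂ W]

theorem isBoundedLinearMap_bilinearComp (j : W →ₗᵢ[ℂ] V) :
    IsBoundedLinearMap ℝ fun F : V →L⋆[ℂ] V →L[ℂ] ℂ =>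
      F.bilinearComp j.toContinuousLinearMap j.toContinuousLinearMap := by
  refine IsLinearMap.with_bound ⟨fun F G => ?_, fun r F => ?_⟩ 1 fun F => ?_
  · ext v w; simp
  · ext v w; simp
  · refine ContinuousLinearMap.opNorm_le_bound₂ _ (by positivity) fun v w => ?_
    rw [one_mul, ← j.norm_map v, ← j.norm_map w]
    exact F.le_opNorm₂ _ _

theorem contDiff_bilinearComp (j : W →ₗᵢ[ℂ] V) :
    ContDiff ℝ (⊤ : ℕ∞) fun F : V →L⋆[ℂ] V →L[ℂ] ℂ =>
      F.bilinearComp j.toContinuousLinearMap j.toContinuousLinearMap :=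
  IsBoundedLinearMap.contDiff (𝕜 := ℝ) (E := V →L⋆[ℂ] V →L[ℂ] ℂ) (F := W →L⋆[ℂ] W →L[ℂ] ℂ)
    (isBoundedLinearMap_bilinearComp j)

theorem isBoundedLinearMap_apply (v w : V) :
    IsBoundedLinearMap ℝ fun F : V →L⋆[ℂ] V →L[ℂ] ℂ => F v w := by
  refine IsLinearMap.with_bound ⟨fun _ _ => rfl, fun _ _ => rfl⟩ (‖v‖ * ‖w‖) fun F => ?_
  refine (F.le_opNorm₂ v w).trans (le_of_eq ?_)
  ring

end SesquilinearForms

variable {M N : Type u}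

namespace KahlerChart

variable {c : KahlerChart M} {E : Submodule ℂ c.model} {ι : N → M}

theorem IsAdapted.apply_mem (h : c.IsAdapted (Set.range ι) E) {n : N} (hn : ι n ∈ c.source) :
    c.toFun (ι n) ∈ E := by
  have h1 : c.toFun (ι n) ∈ c.toFun '' (c.source ∩ Set.range ι) := ⟨_, ⟨hn, n, rfl⟩, rfl⟩
  rw [h.2] at h1
  exact h1.1

theorem IsAdapted.exists_eq (h : c.IsAdapted (Set.range ι) E) {z : c.model} (hz : z ∈ E)
    (hz' : z ∈ c.toFun '' c.source) : ∃ n, ι n ∈ c.source ∧ c.toFun (ι n) = z := by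
  have h1 : z ∈ c.toFun '' (c.source ∩ Set.range ι) := by
    rw [h.2]
    exact ⟨hz, hz'⟩
  obtain ⟨_, ⟨hm, n, rfl⟩, h2⟩ := h1
  exact ⟨n, hm, h2⟩

/-- The inclusion of the model of a restricted chart. -/
noncomputable def restrictInclusion (c : KahlerChart M) (E : Submodule ℂ c.model)
    (hE : IsClosed (E : Set c.model)) (ι : N → M) : (c.restrict E hE ι).model →ₗᵢ[ℂ] c.model :=
  E.subtypeₗᵢ

theorem restrictInclusion_mem (hE : IsClosed (E : Set c.model))
    (z : (c.restrict E hE ι).model) : c.restrictInclusion E hE ι z ∈ E := Subtype.property _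

theorem IsAdapted.restrictInclusion_toFun (h : c.IsAdapted (Set.range ι) E) {n : N}
    (hn : ι n ∈ c.source) :
    c.restrictInclusion E h.1 ι ((c.restrict E h.1 ι).toFun n) = c.toFun (ι n) := by
  have h1 : (c.restrict E h.1 ι).toFun n = (⟨c.toFun (ι n), h.apply_mem hn⟩ : E) :=
    dif_pos (h.apply_mem hn)
  rw [h1]
  rfl

theorem metric_restrict (hE : IsClosed (E : Set c.model)) (z : (c.restrict E hE ι).model) (v w) :
    (c.restrict E hE ι).metric z v w = c.metric (c.restrictInclusion E hE ι z)
      (c.restrictInclusion E hE ι v) (c.restrictInclusion E hE ι w) := rfl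

theorem IsAdapted.image_restrict (h : c.IsAdapted (Set.range ι) E) (hι : Set.InjOn c.toFun c.source)
    (U : Set M) :
    (c.restrict E h.1 ι).toFun '' ((c.restrict E h.1 ι).source ∩ ι ⁻¹' U) =
      c.restrictInclusion E h.1 ι ⁻¹' (c.toFun '' (c.source ∩ U)) := by
  ext z
  constructor
  · rintro ⟨n, ⟨hn, hnU⟩, rfl⟩
    exact ⟨ι n, ⟨hn, hnU⟩, (h.restrictInclusion_toFun hn).symm⟩
  · rintro ⟨m, ⟨hm, hmU⟩, hmz⟩
    obtain ⟨n, hn, hnz⟩ := h.exists_eq (restrictInclusion_mem h.1 z) ⟨m, hm, hmz⟩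
    have : ι n = m := hι hn hm (hnz.trans hmz.symm)
    subst this
    refine ⟨n, ⟨hn, hmU⟩, (c.restrictInclusion E h.1 ι).injective ?_⟩
    rw [h.restrictInclusion_toFun hn, hnz]

theorem IsAdapted.image_restrict_source (h : c.IsAdapted (Set.range ι) E)
    (hι : Set.InjOn c.toFun c.source) :
    (c.restrict E h.1 ι).toFun '' (c.restrict E h.1 ι).source =
      c.restrictInclusion E h.1 ι ⁻¹' (c.toFun '' c.source) := by
  have := h.image_restrict hι Set.univ
  simpa using this

/-- The metric of a restricted chart is the composition of the metric with a linear isometry, which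
preserves smoothness, positivity and closedness. -/
theorem IsKahler.restrict (hc : c.IsKahler) (hι : Function.Injective ι)
    (h : c.IsAdapted (Set.range ι) E) : (c.restrict E h.1 ι).IsKahler := by
  let j := c.restrictInclusion E h.1 ι
  have himg := h.image_restrict_source hc.injOn
  have hsm : ContDiffOn ℝ (⊤ : ℕ∞) (fun z => (c.restrict E h.1 ι).metric z)
      (j ⁻¹' (c.toFun '' c.source)) := by
    have hj : ContDiff ℝ (⊤ : ℕ∞) j := (j.toContinuousLinearMap.restrictScalars ℝ).contDiff
    have h1 := hc.smooth.comp hj.contDiffOn (Set.mapsTo_preimage j _)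
    exact (contDiff_bilinearComp j).comp_contDiffOn h1
  refine ⟨fun m hm n hn hmn => ?_, ?_, ?_, ?_, ?_, ?_⟩
  · have h1 := congrArg j hmn
    rw [h.restrictInclusion_toFun hm, h.restrictInclusion_toFun hn] at h1
    exact hι (hc.injOn hm hn h1)
  · rw [himg]
    exact hc.isOpen_image.preimage j.continuous
  · rw [himg]
    intro z hz v w
    rw [metric_restrict, metric_restrict]
    exact hc.hermitian _ hz _ _
  · rw [himg]
    intro z hz
    obtain ⟨r, hr, hr'⟩ := hc.pos _ hz
    refine ⟨r, hr, fun v => ?_⟩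
    rw [metric_restrict, ← j.norm_map v]
    exact hr' _
  · rw [himg]; exact hsm
  · rw [himg]
    intro z hz a v w
    have key : ∀ a v w, fderiv ℝ (fun y => ((c.restrict E h.1 ι).metric y v w).im) z a =
        fderiv ℝ (fun y => (c.metric y (j v) (j w)).im) (j z) (j a) := by
      intro a v w
      have h1 : DifferentiableAt ℝ (fun y => (c.metric y (j v) (j w)).im) (j z) := by
        have h2 : DifferentiableAt ℝ c.metric (j z) :=
          ((hc.smooth.contDiffAt (hc.isOpen_image.mem_nhds hz)).differentiableAt (by simp))
        have h3 : DifferentiableAt ℝ (fun y => c.metric y (j v) (j w)) (j z) :=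
          DifferentiableAt.comp (g := fun F : c.model →L⋆[ℂ] c.model →L[ℂ] ℂ => F (j v) (j w))
            (j z) (isBoundedLinearMap_apply (j v) (j w)).differentiableAt h2
        exact (Complex.imCLM.differentiableAt).comp (j z) h3
      have h2 : HasFDerivAt (fun y => (c.metric (j y) (j v) (j w)).im)
          ((fderiv ℝ (fun y => (c.metric y (j v) (j w)).im) (j z)).comp
            (j.toContinuousLinearMap.restrictScalars ℝ)) z :=
        h1.hasFDerivAt.comp z (j.toContinuousLinearMap.restrictScalars ℝ).hasFDerivAt
      exact congrArg (fun T => T a) h2.fderiv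
    rw [key, key, key]
    exact hc.closed _ hz _ _ _

/-- A transition map `τ` between adapted charts maps `E` to `E'` on its domain, so in the restricted
charts the transition map is `p ∘ τ ∘ j`, where `j` is the inclusion of `E` and `p` is the
orthogonal projection onto `E'`. -/
theorem IsHolomorphicIsometricAt.restrict {d : KahlerChart M} {E' : Submodule ℂ d.model}
    (hc : c.IsKahler) (h : c.IsAdapted (Set.range ι) E)
    (h' : d.IsAdapted (Set.range ι) E') {n : N} (hn : ι n ∈ c.source)
    (hcd : c.IsHolomorphicIsometricAt d id (ι n)) :
    (c.restrict E h.1 ι).IsHolomorphicIsometricAt (d.restrict E' h'.1 ι) id n := by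
  obtain ⟨W, hW, hmW, τ, hτ, h1⟩ := hcd
  let j := c.restrictInclusion E h.1 ι
  let j' := d.restrictInclusion E' h'.1 ι
  have hE' : CompleteSpace E' := h'.1.completeSpace_coe
  let p : d.model →L[ℂ] (d.restrict E' h'.1 ι).model := E'.orthogonalProjectionOnto
  have hp : ∀ z ∈ E', j' (p z) = z := fun z hz => E'.starProjection_eq_self_iff.2 hz
  have hWj : IsOpen (j ⁻¹' W) := hW.preimage j.continuous
  have hτE : ∀ z ∈ j ⁻¹' W, ∃ n, ι n ∈ c.source ∧ ι n ∈ d.source ∧ c.toFun (ι n) = j z ∧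
      d.toFun (ι n) = τ (j z) := fun z hz => by
    obtain ⟨⟨m, hm, hmd, h2, h3⟩, -⟩ := h1 _ hz
    obtain ⟨n, hn, hnz⟩ := h.exists_eq (restrictInclusion_mem h.1 z) ⟨m, hm, h2⟩
    have : ι n = m := hc.injOn hn hm (hnz.trans h2.symm)
    subst this
    exact ⟨n, hn, hmd, hnz, h3⟩
  have hj : ∀ z, HasFDerivAt (𝕜 := ℂ) j j.toContinuousLinearMap z := fun z =>
    j.toContinuousLinearMap.hasFDerivAt
  have hτ' : ∀ z ∈ j ⁻¹' W, j' (p (τ (j z))) = τ (j z) := fun z hz => by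
    obtain ⟨n, -, hnd, -, h3⟩ := hτE z hz
    exact hp _ (h3 ▸ h'.apply_mem hnd)
  have hd1 : ∀ z ∈ j ⁻¹' W, HasFDerivAt (fun z => p (τ (j z)))
      ((p.comp (fderiv ℂ τ (j z))).comp j.toContinuousLinearMap) z := fun z hz =>
    p.hasFDerivAt.comp z
      (((hτ.differentiableAt (hW.mem_nhds hz)).hasFDerivAt).comp z (hj z))
  -- the derivative of `τ` maps `E` to `E'`, since `τ` does
  have hd2 : ∀ z ∈ j ⁻¹' W, ∀ v, j' (fderiv ℂ (fun z => p (τ (j z))) z v) =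
      fderiv ℂ τ (j z) (j v) := fun z hz v => by
    have h2 : HasFDerivAt (fun z => j' (p (τ (j z))))
        (j'.toContinuousLinearMap.comp
          ((p.comp (fderiv ℂ τ (j z))).comp j.toContinuousLinearMap)) z :=
      j'.toContinuousLinearMap.hasFDerivAt.comp z (hd1 z hz)
    have h3 : HasFDerivAt (fun z => τ (j z))
        ((fderiv ℂ τ (j z)).comp j.toContinuousLinearMap) z :=
      ((hτ.differentiableAt (hW.mem_nhds hz)).hasFDerivAt).comp z (hj z)
    have h4 : (fun z => τ (j z)) =ᶠ[𝓝 z] fun z => j' (p (τ (j z))) := by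
      filter_upwards [hWj.mem_nhds hz] with y hy using (hτ' y hy).symm
    have h5 := (h2.congr_of_eventuallyEq h4).unique h3
    rw [(hd1 z hz).fderiv]
    exact congrArg (fun T => T v) h5
  refine ⟨j ⁻¹' W, hWj, ?_, fun z => p (τ (j z)), fun z hz =>
    (hd1 z hz).differentiableAt.differentiableWithinAt, fun z hz => ⟨?_, fun v w => ?_⟩⟩
  · rw [Set.mem_preimage, h.restrictInclusion_toFun hn]
    exact hmW
  · obtain ⟨n, hnc, hnd, h2, h3⟩ := hτE z hz
    refine ⟨n, hnc, hnd, j.injective ?_, j'.injective ?_⟩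
    · rw [h.restrictInclusion_toFun hnc, h2]
    · rw [id, h'.restrictInclusion_toFun hnd, hτ' z hz, h3]
  · rw [metric_restrict, metric_restrict]
    change d.metric (j' (p (τ (j z)))) (j' _) (j' _) = _
    rw [hτ' z hz, hd2 z hz, hd2 z hz]
    exact (h1 _ hz).2 _ _

end KahlerChart

/-- A subset of a Kähler manifold that is a closed linear subspace in suitable charts is a Kähler
manifold with the induced structure. -/
theorem IsKahlerManifold.induced {K : Set (KahlerChart M)} (hK : IsKahlerManifold K) {ι : N → M}
    (hι : Function.Injective ι)
    (h : ∀ n, ∃ c ∈ maximalKahlerAtlas K, ι n ∈ c.source ∧ ∃ E, c.IsAdapted (Set.range ι) E) :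
    IsKahlerManifold (inducedKahlerAtlas K ι) := by
  refine ⟨fun n => ?_, ?_, ?_, fun m n hmn => ?_⟩
  · obtain ⟨c, hc, hn, E, hE⟩ := h n
    exact ⟨_, ⟨c, hc, E, hE, rfl⟩, hn⟩
  · rintro _ ⟨c, hc, E, hE, rfl⟩
    exact hc.1.restrict hι hE
  · rintro _ ⟨c, hc, E, hE, rfl⟩ _ ⟨d, hd, E', hE', rfl⟩
    refine KahlerChart.isHolomorphicIsometric_of_at (hc.1.restrict hι hE).injOn
      fun n hn hn' => ?_
    exact KahlerChart.IsHolomorphicIsometricAt.restrict hc.1 hE hE' hn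
      (hK.isHolomorphicIsometricAt hc hd hn hn')
  · obtain ⟨U, V, hU, hV, hm, hn, hUV⟩ := hK.hausdorff (ι m) (ι n) fun h => hmn (hι h)
    have key : ∀ U : Set M, IsAtlasOpen K U → IsAtlasOpen (inducedKahlerAtlas K ι) (ι ⁻¹' U) := by
      rintro U hU _ ⟨c, hc, E, hE, rfl⟩
      rw [hE.image_restrict hc.1.injOn]
      exact (hK.isOpen_image hU hc).preimage (c.restrictInclusion E hE.1 ι).continuous
    exact ⟨_, _, key U hU, key V hV, hm, hn, hUV.preimage ι⟩

end InducedStructure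

/-! ### The Fubini-Study metric -/

section FubiniStudy

open Filter Topology

variable {H : Type u} [NormedAddCommGroup H] [InnerProductSpace ℂ H]

theorem fubiniStudy_conj (z v w : H) :
    fubiniStudy z v w = (starRingEnd ℂ) (fubiniStudy z w v) := by
  rw [fubiniStudy_apply, fubiniStudy_apply]
  simp only [map_sub, map_mul, map_div₀, map_add, map_pow, map_one, map_ofNat, Complex.conj_ofReal,
    inner_conj_symm]
  ring

/-- By the Cauchy-Schwarz inequality, the metric is bounded below by a multiple of the norm. -/
theorem le_re_fubiniStudy (z v : H) :
    2 / (1 + ‖z‖ ^ 2) ^ 2 * ‖v‖ ^ 2 ≤ (fubiniStudy z v v).re := by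
  have h1 : fubiniStudy z v v =
      ((2 / (1 + ‖z‖ ^ 2) * ‖v‖ ^ 2 - 2 / (1 + ‖z‖ ^ 2) ^ 2 * ‖⟪z, v⟫_ℂ‖ ^ 2 : ℝ) : ℂ) := by
    rw [fubiniStudy_apply, inner_self_eq_norm_sq_to_K, ← inner_conj_symm v z,
      mul_comm (starRingEnd ℂ _), Complex.mul_conj, Complex.normSq_eq_norm_sq]
    push_cast
    rfl
  rw [h1, Complex.ofReal_re]
  have h2 : ‖⟪z, v⟫_ℂ‖ ^ 2 ≤ ‖z‖ ^ 2 * ‖v‖ ^ 2 := by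
    rw [← mul_pow]
    have := norm_inner_le_norm (𝕜 := ℂ) z v
    gcongr
  have h3 : (0 : ℝ) < 1 + ‖z‖ ^ 2 := by positivity
  have h4 : 2 / (1 + ‖z‖ ^ 2) * ‖v‖ ^ 2 =
      2 / (1 + ‖z‖ ^ 2) ^ 2 * ((1 + ‖z‖ ^ 2) * ‖v‖ ^ 2) := by
    field_simp
  rw [h4, ← mul_sub]
  gcongr
  linarith

theorem contDiff_fubiniStudy : ContDiff ℝ (⊤ : ℕ∞) (fubiniStudy : H → H →L⋆[ℂ] H →L[ℂ] ℂ) := by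
  have hN : ContDiff ℝ (⊤ : ℕ∞) fun z : H => 1 + (‖z‖ : ℂ) ^ 2 := by
    have h1 : ContDiff ℝ (⊤ : ℕ∞) fun z : H => ((‖z‖ ^ 2 : ℝ) : ℂ) :=
      Complex.ofRealCLM.contDiff.comp (contDiff_norm_sq ℂ)
    have h2 : (fun z : H => 1 + (‖z‖ : ℂ) ^ 2) = fun z : H => 1 + ((‖z‖ ^ 2 : ℝ) : ℂ) := by
      funext z; push_cast; rfl
    rw [h2]
    exact contDiff_const.add h1
  have hN0 : ∀ z : H, 1 + (‖z‖ : ℂ) ^ 2 ≠ 0 := fun z => by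
    have : (0 : ℝ) < 1 + ‖z‖ ^ 2 := by positivity
    exact_mod_cast this.ne'
  have hB : IsBoundedBilinearMap ℝ fun p : H × H =>
      (ContinuousLinearMap.toSpanSingleton ℂ (innerSL ℂ p.1)).comp
        ((innerSL ℂ (E := H)).flip p.2) := by
    refine ⟨?_, ?_, ?_, ?_, ?_⟩
    · intro x y z; ext v w; simp
    · intro c x y; ext v w
      simp
      ring
    · intro x y z; ext v w; simp
    · intro c x y; ext v w
      simp
      ring
    · refine ⟨1, one_pos, fun x y => ?_⟩
      refine ContinuousLinearMap.opNorm_le_bound₂ _ (by positivity) fun v w => ?_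
      simp only [ContinuousLinearMap.comp_apply, ContinuousLinearMap.flip_apply,
        ContinuousLinearMap.toSpanSingleton_apply, smul_apply, norm_smul, innerSL_apply_apply]
      calc _ ≤ (‖v‖ * ‖y‖) * (‖x‖ * ‖w‖) :=
            mul_le_mul (norm_inner_le_norm _ _) (norm_inner_le_norm _ _) (norm_nonneg _)
              (by positivity)
        _ = _ := by ring
  have hd : ContDiff ℝ (⊤ : ℕ∞) fun z : H => (z, z) := contDiff_id.prodMk contDiff_id
  have h1 := (IsBoundedBilinearMap.contDiff (𝕜 := ℝ) (E := H) (F := H)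
    (G := H →L⋆[ℂ] H →L[ℂ] ℂ) (n := (⊤ : ℕ∞)) hB).comp hd
  have h2 : ContDiff ℝ (⊤ : ℕ∞) fun z : H => 2 / (1 + (‖z‖ : ℂ) ^ 2) :=
    by
    simp only [div_eq_mul_inv]
    exact contDiff_const.mul (hN.inv hN0)
  have h3 : ContDiff ℝ (⊤ : ℕ∞) fun z : H => 2 / (1 + (‖z‖ : ℂ) ^ 2) ^ 2 :=
    by
    simp only [div_eq_mul_inv]
    exact contDiff_const.mul ((hN.pow 2).inv fun z => pow_ne_zero _ (hN0 z))
  have hS : IsBoundedBilinearMap ℝ fun p : ℂ × (H →L⋆[ℂ] H →L[ℂ] ℂ) => p.1 • p.2 := by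
    refine ⟨?_, ?_, ?_, ?_, ?_⟩
    · intro c d F; ext v w; exact add_mul c d (F v w)
    · intro r c F; ext v w; exact smul_mul_assoc r c (F v w)
    · intro c F G; ext v w; exact mul_add c (F v w) (G v w)
    · intro r c F; ext v w; exact mul_smul_comm r c (F v w)
    · refine ⟨1, one_pos, fun c F => ?_⟩
      refine ContinuousLinearMap.opNorm_le_bound₂ _ (by positivity) fun v w => ?_
      simp only [smul_apply, norm_smul]
      rw [one_mul, mul_assoc, mul_assoc, ← mul_assoc ‖F‖]
      gcongr
      exact F.le_opNorm₂ v w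
  have hS' := IsBoundedBilinearMap.contDiff (𝕜 := ℝ) (E := ℂ) (F := H →L⋆[ℂ] H →L[ℂ] ℂ)
    (G := H →L⋆[ℂ] H →L[ℂ] ℂ) (n := (⊤ : ℕ∞)) hS
  exact (hS'.comp (h2.prodMk contDiff_const)).sub (hS'.comp (h3.prodMk h1))

/-- The derivative of a coefficient of the fundamental form of the Fubini-Study metric, computed as
the derivative of a rational function along the line `t ↦ z + t a`. -/
theorem fderiv_im_fubiniStudy (z a v w : H) :
    fderiv ℝ (fun y => (fubiniStudy y v w).im) z a =
      -(4 * (⟪z, a⟫_ℂ).re / (1 + ‖z‖ ^ 2) ^ 2) * (⟪v, w⟫_ℂ).im +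
        8 * (⟪z, a⟫_ℂ).re / (1 + ‖z‖ ^ 2) ^ 3 * (⟪v, z⟫_ℂ * ⟪z, w⟫_ℂ).im -
        2 / (1 + ‖z‖ ^ 2) ^ 2 * (⟪v, a⟫_ℂ * ⟪z, w⟫_ℂ + ⟪v, z⟫_ℂ * ⟪a, w⟫_ℂ).im := by
  have hdiff : DifferentiableAt ℝ (fun y => (fubiniStudy y v w).im) z := by
    have h2 : DifferentiableAt ℝ (fubiniStudy : H → H →L⋆[ℂ] H →L[ℂ] ℂ) z :=
      contDiff_fubiniStudy.contDiffAt.differentiableAt (by simp)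
    have h3 : DifferentiableAt ℝ (fun y => fubiniStudy y v w) z :=
      DifferentiableAt.comp (g := fun F : H →L⋆[ℂ] H →L[ℂ] ℂ => F v w)
        z (isBoundedLinearMap_apply v w).differentiableAt h2
    exact (Complex.imCLM.differentiableAt).comp z h3
  have h1 : HasDerivAt (fun t : ℝ => z + t • a) a 0 := by
    simpa using ((hasDerivAt_id (0 : ℝ)).smul_const a).const_add z
  have h2 : HasDerivAt (fun t : ℝ => (fubiniStudy (z + t • a) v w).im)
      (fderiv ℝ (fun y => (fubiniStudy y v w).im) z a) 0 := by
    have h3 : HasFDerivAt (fun y => (fubiniStudy y v w).im)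
        (fderiv ℝ (fun y => (fubiniStudy y v w).im) z) (z + (0 : ℝ) • a) := by
      rw [zero_smul, add_zero]; exact hdiff.hasFDerivAt
    exact h3.comp_hasDerivAt 0 h1
  set s := (⟪z, a⟫_ℂ).re
  have hN : ∀ t : ℝ, ‖z + t • a‖ ^ 2 = ‖z‖ ^ 2 + 2 * t * s + t ^ 2 * ‖a‖ ^ 2 := fun t => by
    rw [norm_add_sq (𝕜 := ℂ), norm_smul, mul_pow, Real.norm_eq_abs, sq_abs]
    have : ⟪z, t • a⟫_ℂ = t * ⟪z, a⟫_ℂ := by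
      rw [← Complex.coe_smul, inner_smul_right]
    rw [this, RCLike.re_eq_complex_re, Complex.re_ofReal_mul]
    ring
  have hg : ∀ t : ℝ, (fubiniStudy (z + t • a) v w).im =
      2 / (1 + (‖z‖ ^ 2 + 2 * t * s + t ^ 2 * ‖a‖ ^ 2)) * (⟪v, w⟫_ℂ).im -
      2 / (1 + (‖z‖ ^ 2 + 2 * t * s + t ^ 2 * ‖a‖ ^ 2)) ^ 2 *
        ((⟪v, z⟫_ℂ * ⟪z, w⟫_ℂ).im + t * (⟪v, a⟫_ℂ * ⟪z, w⟫_ℂ + ⟪v, z⟫_ℂ * ⟪a, w⟫_ℂ).im +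
          t ^ 2 * (⟪v, a⟫_ℂ * ⟪a, w⟫_ℂ).im) := fun t => by
    rw [fubiniStudy_apply, ← hN t]
    have h4 : (2 / (1 + (‖z + t • a‖ : ℂ) ^ 2)) = ((2 / (1 + ‖z + t • a‖ ^ 2) : ℝ) : ℂ) := by
      push_cast; rfl
    have h5 : (2 / (1 + (‖z + t • a‖ : ℂ) ^ 2) ^ 2) =
        ((2 / (1 + ‖z + t • a‖ ^ 2) ^ 2 : ℝ) : ℂ) := by
      push_cast; rfl
    have h6 : ⟪v, z + t • a⟫_ℂ = ⟪v, z⟫_ℂ + t * ⟪v, a⟫_ℂ := by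
      rw [inner_add_right, ← Complex.coe_smul, inner_smul_right]
    have h7 : ⟪z + t • a, w⟫_ℂ = ⟪z, w⟫_ℂ + t * ⟪a, w⟫_ℂ := by
      rw [inner_add_left, ← Complex.coe_smul, inner_smul_left, Complex.conj_ofReal]
    rw [h4, h5, h6, h7, Complex.sub_im, Complex.im_ofReal_mul, Complex.im_ofReal_mul]
    simp only [Complex.mul_im, Complex.add_re, Complex.add_im, Complex.mul_re, Complex.ofReal_re,
      Complex.ofReal_im]
    ring
  have hn : (0 : ℝ) < 1 + ‖z‖ ^ 2 := by positivity
  -- the coefficients are generalized to real numbers before the derivative is computed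
  have h3 : ∀ p b₀ b₁ b₂ : ℝ, HasDerivAt (fun t : ℝ =>
      2 / (1 + (‖z‖ ^ 2 + 2 * t * s + t ^ 2 * ‖a‖ ^ 2)) * p -
      2 / (1 + (‖z‖ ^ 2 + 2 * t * s + t ^ 2 * ‖a‖ ^ 2)) ^ 2 * (b₀ + t * b₁ + t ^ 2 * b₂))
      (-(4 * s / (1 + ‖z‖ ^ 2) ^ 2) * p + 8 * s / (1 + ‖z‖ ^ 2) ^ 3 * b₀ -
        2 / (1 + ‖z‖ ^ 2) ^ 2 * b₁) 0 := by
    intro p b₀ b₁ b₂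
    have hid := hasDerivAt_id (0 : ℝ)
    have e1 : HasDerivAt (fun t : ℝ => 1 + (‖z‖ ^ 2 + 2 * t * s + t ^ 2 * ‖a‖ ^ 2)) (2 * s) 0 := by
      have := ((((hid.const_mul 2).mul_const s).const_add (‖z‖ ^ 2)).add
        ((hid.pow 2).mul_const (‖a‖ ^ 2))).const_add 1
      simpa using this
    have e2 : HasDerivAt (fun t : ℝ => b₀ + t * b₁ + t ^ 2 * b₂) b₁ 0 := by
      have := ((hid.mul_const b₁).const_add b₀).add ((hid.pow 2).mul_const b₂)
      exact this.congr_deriv (by simp)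
    have e3 := (((hasDerivAt_const (0 : ℝ) (2 : ℝ)).div e1 (by simpa using hn.ne')).mul_const p).sub
      (((hasDerivAt_const (0 : ℝ) (2 : ℝ)).div (e1.pow 2)
        (by simpa using pow_ne_zero 2 hn.ne')).mul e2)
    refine e3.congr_deriv ?_
    simp
    field_simp
    ring
  have h4 := h3 (⟪v, w⟫_ℂ).im (⟪v, z⟫_ℂ * ⟪z, w⟫_ℂ).im
    (⟪v, a⟫_ℂ * ⟪z, w⟫_ℂ + ⟪v, z⟫_ℂ * ⟪a, w⟫_ℂ).im (⟪v, a⟫_ℂ * ⟪a, w⟫_ℂ).im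
  rw [← funext hg] at h4
  exact h2.unique h4

/-- The fundamental form of the Fubini-Study metric is closed. -/
theorem fubiniStudy_closed (z a v w : H) :
    fderiv ℝ (fun y => (fubiniStudy y v w).im) z a +
      fderiv ℝ (fun y => (fubiniStudy y w a).im) z v +
        fderiv ℝ (fun y => (fubiniStudy y a v).im) z w = 0 := by
  rw [fderiv_im_fubiniStudy, fderiv_im_fubiniStudy, fderiv_im_fubiniStudy,
    ← inner_conj_symm v z, ← inner_conj_symm w z, ← inner_conj_symm a z,
    ← inner_conj_symm v a, ← inner_conj_symm a w, ← inner_conj_symm w v]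
  simp only [Complex.add_im, Complex.mul_im, Complex.conj_re, Complex.conj_im]
  ring

/-- The Fubini-Study metric in homogeneous coordinates: a Hermitian form in the tangent vectors `v`
and `w` at the point `[x]` of projective space, which vanishes in the direction of `x`. -/
noncomputable def homogeneousFubiniStudy (x v w : H) : ℂ :=
  2 * (⟪v, w⟫_ℂ * ⟪x, x⟫_ℂ - ⟪v, x⟫_ℂ * ⟪x, w⟫_ℂ) / ⟪x, x⟫_ℂ ^ 2

/-- The homogeneous form of the metric does not depend on the representing vector. -/
theorem homogeneousFubiniStudy_smul {x : H} (hx : x ≠ 0) (v w : H) {k : ℂ} (hk : k ≠ 0)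
    (μ ν : ℂ) : homogeneousFubiniStudy (k • x) (k • v + μ • x) (k • w + ν • x) =
      homogeneousFubiniStudy x v w := by
  have hx' : ⟪x, x⟫_ℂ ≠ 0 := inner_self_ne_zero.2 hx
  have hk' : (starRingEnd ℂ) k ≠ 0 := (map_ne_zero _).2 hk
  unfold homogeneousFubiniStudy
  simp only [inner_add_left, inner_add_right, inner_smul_left, inner_smul_right]
  field_simp
  ring

/-- The coordinate `z` of the affine chart at `ξ` stands for the point `[ξ + z]`. -/
theorem fubiniStudy_eq_homogeneous {ξ : H} (hξ : ‖ξ‖ = 1) (z v w : (ℂ ∙ ξ)ᗮ) :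
    fubiniStudy z v w = homogeneousFubiniStudy (ξ + z) (v : H) (w : H) := by
  have h0 : ∀ y : (ℂ ∙ ξ)ᗮ, ⟪ξ, (y : H)⟫_ℂ = 0 := fun y =>
    Submodule.mem_orthogonal_singleton_iff_inner_right.1 y.2
  have h0' : ∀ y : (ℂ ∙ ξ)ᗮ, ⟪(y : H), ξ⟫_ℂ = 0 := fun y =>
    Submodule.mem_orthogonal_singleton_iff_inner_left.1 y.2
  have h1 : ⟪ξ + (z : H), ξ + z⟫_ℂ = 1 + (‖z‖ : ℂ) ^ 2 := by
    rw [inner_add_left, inner_add_right, inner_add_right, h0, h0', inner_self_eq_norm_sq_to_K,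
      inner_self_eq_norm_sq_to_K, hξ]
    simp
  have h2 : (1 + (‖z‖ : ℂ) ^ 2) ≠ 0 := by
    have : (0 : ℝ) < 1 + ‖z‖ ^ 2 := by positivity
    exact_mod_cast this.ne'
  rw [fubiniStudy_apply, homogeneousFubiniStudy, h1, inner_add_left, inner_add_right, h0, h0',
    zero_add, zero_add, Submodule.coe_inner, Submodule.coe_inner, Submodule.coe_inner]
  field_simp

end FubiniStudy

/-! ### Affine charts of projective space -/

section ProjectiveCharts

open Filter Topology
open scoped LinearAlgebra.Projectivization

variable {H : Type u} [NormedAddCommGroup H] [InnerProductSpace ℂ H]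

theorem inner_unit_add {ξ : H} (hξ : ‖ξ‖ = 1) (z : (ℂ ∙ ξ)ᗮ) : ⟪ξ, ξ + z⟫_ℂ = 1 := by
  rw [inner_add_right, Submodule.mem_orthogonal_singleton_iff_inner_right.1 z.2,
    inner_self_eq_norm_sq_to_K, hξ]
  simp

theorem unit_add_ne_zero {ξ : H} (hξ : ‖ξ‖ = 1) (z : (ℂ ∙ ξ)ᗮ) : ξ + z ≠ 0 := fun h => by
  have := inner_unit_add hξ z
  rw [h, inner_zero_right] at this
  exact zero_ne_one this

/-- The point of projective space with the coordinate `z` in the chart at `ξ`. -/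
noncomputable def projectivePoint {ξ : H} (hξ : ‖ξ‖ = 1) (z : (ℂ ∙ ξ)ᗮ) : ℙ ℂ H :=
  Projectivization.mk ℂ (ξ + z) (unit_add_ne_zero hξ z)

theorem coe_orthogonalProjectionOnto_smul {ξ : H} (hξ : ‖ξ‖ = 1) {x : H} (hx : ⟪ξ, x⟫_ℂ ≠ 0) :
    (((ℂ ∙ ξ)ᗮ.orthogonalProjectionOnto ((⟪ξ, x⟫_ℂ)⁻¹ • x) : (ℂ ∙ ξ)ᗮ) : H) =
      (⟪ξ, x⟫_ℂ)⁻¹ • x - ξ := by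
  have h1 : (⟪ξ, x⟫_ℂ)⁻¹ • x - ξ ∈ (ℂ ∙ ξ)ᗮ := by
    rw [Submodule.mem_orthogonal_singleton_iff_inner_right, inner_sub_right, inner_smul_right,
      inv_mul_cancel₀ hx, inner_self_eq_norm_sq_to_K, hξ]
    simp
  have h2 : (ℂ ∙ ξ)ᗮ.orthogonalProjectionOnto ξ = 0 :=
    Submodule.orthogonalProjectionOnto_orthogonal_apply_eq_zero
      (Submodule.mem_span_singleton_self ξ)
  have h3 : (ℂ ∙ ξ)ᗮ.orthogonalProjectionOnto ((⟪ξ, x⟫_ℂ)⁻¹ • x) =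
      (ℂ ∙ ξ)ᗮ.orthogonalProjectionOnto ((⟪ξ, x⟫_ℂ)⁻¹ • x - ξ) := by
    rw [map_sub, h2, sub_zero]
  rw [h3]
  exact Submodule.starProjection_eq_self_iff.2 h1

/-- The square of the modulus of the inner product with `x` of a unit vector that represents a
point of projective space. -/
noncomputable def transitionProbability (x : H) (q : ℙ ℂ H) : ℝ := ‖⟪x, q.rep⟫_ℂ‖ ^ 2 / ‖q.rep‖ ^ 2

theorem transitionProbability_mk (x : H) {y : H} (hy : y ≠ 0) :
    transitionProbability x (Projectivization.mk ℂ y hy) = ‖⟪x, y⟫_ℂ‖ ^ 2 / ‖y‖ ^ 2 := by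
  obtain ⟨a, ha⟩ := Projectivization.exists_smul_eq_mk_rep ℂ y hy
  have ha0 : ‖(a : ℂ)‖ ≠ 0 := norm_ne_zero_iff.2 a.ne_zero
  rw [transitionProbability, ← ha, Units.smul_def, inner_smul_right, norm_mul, norm_smul, mul_pow,
    mul_pow, mul_div_mul_left _ _ (pow_ne_zero 2 ha0)]

theorem continuous_transitionProbability (x : H) {ξ : H} (hξ : ‖ξ‖ = 1) :
    Continuous fun z : (ℂ ∙ ξ)ᗮ => transitionProbability x (projectivePoint hξ z) := by
  simp only [projectivePoint, transitionProbability_mk]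
  refine Continuous.div (by fun_prop) (by fun_prop) fun z => ?_
  exact pow_ne_zero 2 (norm_ne_zero_iff.2 (unit_add_ne_zero hξ z))

variable [CompleteSpace H]

theorem mk_mem_projectiveChart_source {ξ x : H} (hx : x ≠ 0) :
    Projectivization.mk ℂ x hx ∈ (projectiveChart ξ).source ↔ ⟪ξ, x⟫_ℂ ≠ 0 := by
  obtain ⟨a, ha⟩ := Projectivization.exists_smul_eq_mk_rep ℂ x hx
  change ⟪ξ, (Projectivization.mk ℂ x hx).rep⟫_ℂ ≠ 0 ↔ _
  rw [← ha, Units.smul_def, inner_smul_right]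
  simp

theorem projectiveChart_mk {ξ x : H} (hx : x ≠ 0) :
    (projectiveChart ξ).toFun (Projectivization.mk ℂ x hx) =
      (ℂ ∙ ξ)ᗮ.orthogonalProjectionOnto ((⟪ξ, x⟫_ℂ)⁻¹ • x) := by
  obtain ⟨a, ha⟩ := Projectivization.exists_smul_eq_mk_rep ℂ x hx
  change (ℂ ∙ ξ)ᗮ.orthogonalProjectionOnto ((⟪ξ, (Projectivization.mk ℂ x hx).rep⟫_ℂ)⁻¹ •
    (Projectivization.mk ℂ x hx).rep) = _
  rw [← ha, Units.smul_def, inner_smul_right, smul_smul, mul_inv]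
  congr 2
  rw [mul_comm (a : ℂ)⁻¹, mul_assoc, inv_mul_cancel₀ a.ne_zero, mul_one]

theorem projectivePoint_mem_source {ξ : H} (hξ : ‖ξ‖ = 1) (z : (ℂ ∙ ξ)ᗮ) :
    projectivePoint hξ z ∈ (projectiveChart ξ).source := by
  rw [projectivePoint, mk_mem_projectiveChart_source, inner_unit_add hξ]
  exact one_ne_zero

theorem projectiveChart_projectivePoint {ξ : H} (hξ : ‖ξ‖ = 1) (z : (ℂ ∙ ξ)ᗮ) :
    (projectiveChart ξ).toFun (projectivePoint hξ z) = z := by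
  rw [projectivePoint, projectiveChart_mk]
  refine Subtype.ext ?_
  have h1 : ⟪ξ, ξ + (z : H)⟫_ℂ ≠ 0 := by
    rw [inner_unit_add hξ]
    exact one_ne_zero
  rw [coe_orthogonalProjectionOnto_smul hξ h1, inner_unit_add hξ]
  simp

theorem projectivePoint_projectiveChart {ξ : H} (hξ : ‖ξ‖ = 1) {q : ℙ ℂ H}
    (hq : q ∈ (projectiveChart ξ).source) :
    projectivePoint hξ ((projectiveChart ξ).toFun q) = q := by
  induction q using Projectivization.ind with
  | h x hx =>
    rw [mk_mem_projectiveChart_source] at hq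
    have h1 : projectivePoint hξ ((projectiveChart ξ).toFun (Projectivization.mk ℂ x hx)) =
        projectivePoint hξ ((ℂ ∙ ξ)ᗮ.orthogonalProjectionOnto ((⟪ξ, x⟫_ℂ)⁻¹ • x)) := by
      rw [projectiveChart_mk]
    rw [h1, projectivePoint, Projectivization.mk_eq_mk_iff']
    refine ⟨(⟪ξ, x⟫_ℂ)⁻¹, ?_⟩
    rw [coe_orthogonalProjectionOnto_smul hξ hq]
    abel

theorem image_projectiveChart {ξ : H} (hξ : ‖ξ‖ = 1) (U : Set (ℙ ℂ H)) :
    (projectiveChart ξ).toFun '' ((projectiveChart ξ).source ∩ U) =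
      {z : (ℂ ∙ ξ)ᗮ | projectivePoint hξ z ∈ U} := by
  ext z
  constructor
  · rintro ⟨q, ⟨hq, hqU⟩, rfl⟩
    change projectivePoint hξ ((projectiveChart ξ).toFun q) ∈ U
    rwa [projectivePoint_projectiveChart hξ hq]
  · intro hz
    exact ⟨_, ⟨projectivePoint_mem_source hξ z, hz⟩, projectiveChart_projectivePoint hξ z⟩

theorem image_projectiveChart_source {ξ : H} (hξ : ‖ξ‖ = 1) :
    (projectiveChart ξ).toFun '' (projectiveChart ξ).source = Set.univ := by
  have := image_projectiveChart hξ Set.univ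
  rw [Set.inter_univ] at this
  rw [this]
  exact Set.eq_univ_of_forall fun z => Set.mem_univ _

theorem isKahler_projectiveChart {ξ : H} (hξ : ‖ξ‖ = 1) : (projectiveChart ξ).IsKahler := by
  have himg := image_projectiveChart_source hξ
  refine ⟨fun p hp q hq h => ?_, ?_, ?_, ?_, ?_, ?_⟩
  · rw [← projectivePoint_projectiveChart hξ hp, ← projectivePoint_projectiveChart hξ hq]
    exact congrArg (projectivePoint hξ) h
  · rw [himg]; exact isOpen_univ
  · exact fun z _ v w => fubiniStudy_conj (H := (ℂ ∙ ξ)ᗮ) z v w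
  · intro z _
    exact ⟨2 / (1 + ‖z‖ ^ 2) ^ 2, by positivity, le_re_fubiniStudy (H := (ℂ ∙ ξ)ᗮ) z⟩
  · exact (contDiff_fubiniStudy (H := (ℂ ∙ ξ)ᗮ)).contDiffOn
  · exact fun z _ a v w => fubiniStudy_closed (H := (ℂ ∙ ξ)ᗮ) z a v w

/-- The transition map between two affine charts of projective space is holomorphic and preserves
the Fubini-Study metric, because the metric has the same homogeneous form in both charts. -/
theorem isHolomorphicIsometricAt_projectiveChart {ξ η : H} (hξ : ‖ξ‖ = 1) (hη : ‖η‖ = 1)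
    {q : ℙ ℂ H} (hq : q ∈ (projectiveChart ξ).source) (hq' : q ∈ (projectiveChart η).source) :
    (projectiveChart ξ).IsHolomorphicIsometricAt (projectiveChart η) id q := by
  let T := (ℂ ∙ ξ)ᗮ
  let p := (ℂ ∙ η)ᗮ.orthogonalProjectionOnto
  let W : Set T := {z | ⟪η, ξ + (z : H)⟫_ℂ ≠ 0}
  have hW : IsOpen W := isOpen_ne_fun (by fun_prop) continuous_const
  let σ : T → H := fun z => (⟪η, ξ + (z : H)⟫_ℂ)⁻¹ • (ξ + (z : H))
  let L : T →L[ℂ] ℂ := (innerSL ℂ η).comp T.subtypeL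
  let μ : T → T → ℂ := fun z v => -((⟪η, ξ + (z : H)⟫_ℂ) ^ 2)⁻¹ * ⟪η, (v : H)⟫_ℂ
  have hσ : ∀ z ∈ W, ∃ D : T →L[ℂ] H, HasFDerivAt σ D z ∧
      ∀ v, D v = (⟪η, ξ + (z : H)⟫_ℂ)⁻¹ • (v : H) + μ z v • (ξ + (z : H)) := fun z hz => by
    have h1 : HasFDerivAt (fun z : T => ξ + (z : H)) T.subtypeL z :=
      T.subtypeL.hasFDerivAt.const_add ξ
    have h2 : HasFDerivAt (fun z : T => ⟪η, ξ + (z : H)⟫_ℂ) L z :=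
      (innerSL ℂ η).hasFDerivAt.comp z h1
    have h3 := (hasDerivAt_inv hz).comp_hasFDerivAt z h2
    exact ⟨_, h3.smul h1, fun v => rfl⟩
  have hmem : ∀ z ∈ W, ∀ v : T,
      (⟪η, ξ + (z : H)⟫_ℂ)⁻¹ • (v : H) + μ z v • (ξ + (z : H)) ∈ (ℂ ∙ η)ᗮ := fun z hz v => by
    have hz' : ⟪η, ξ + (z : H)⟫_ℂ ≠ 0 := hz
    rw [Submodule.mem_orthogonal_singleton_iff_inner_right, inner_add_right (η),
      inner_smul_right, inner_smul_right]
    simp only [μ]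
    field_simp
    ring
  have hp : ∀ y ∈ (ℂ ∙ η)ᗮ, ((p y : (ℂ ∙ η)ᗮ) : H) = y := fun y hy =>
    Submodule.starProjection_eq_self_iff.2 hy
  have hd : ∀ z ∈ W, DifferentiableAt ℂ (fun z => p (σ z)) z ∧ ∀ v,
      ((fderiv ℂ (fun z => p (σ z)) z v : (ℂ ∙ η)ᗮ) : H) =
        (⟪η, ξ + (z : H)⟫_ℂ)⁻¹ • (v : H) + μ z v • (ξ + (z : H)) := fun z hz => by
    obtain ⟨D, hD, hDv⟩ := hσ z hz
    have h1 : HasFDerivAt (fun z => p (σ z)) (p.comp D) z := p.hasFDerivAt.comp z hD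
    refine ⟨h1.differentiableAt, fun v => ?_⟩
    rw [h1.fderiv, ContinuousLinearMap.comp_apply, hDv]
    exact hp _ (hmem z hz v)
  have hmetric : ∀ z ∈ W, ∀ v w : T, fubiniStudy (p (σ z)) (fderiv ℂ (fun z => p (σ z)) z v)
      (fderiv ℂ (fun z => p (σ z)) z w) = fubiniStudy z v w := fun z hz v w => by
    obtain ⟨-, h1⟩ := hd z hz
    have hz' : ⟪η, ξ + (z : H)⟫_ℂ ≠ 0 := hz
    have h2 : η + ((p (σ z) : (ℂ ∙ η)ᗮ) : H) = (⟪η, ξ + (z : H)⟫_ℂ)⁻¹ • (ξ + (z : H)) := by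
      rw [coe_orthogonalProjectionOnto_smul hη hz']
      abel
    rw [fubiniStudy_eq_homogeneous hη, h1 v, h1 w, h2,
      homogeneousFubiniStudy_smul (unit_add_ne_zero hξ z) _ _ (inv_ne_zero hz'),
      fubiniStudy_eq_homogeneous hξ]
  refine ⟨W, hW, ?_, fun z => p (σ z), fun z hz => (hd z hz).1.differentiableWithinAt,
    fun z hz => ⟨⟨projectivePoint hξ z, projectivePoint_mem_source hξ z, ?_,
      projectiveChart_projectivePoint hξ z, projectiveChart_mk _⟩, fun v w => ?_⟩⟩
  · rw [← projectivePoint_projectiveChart hξ hq] at hq'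
    exact (mk_mem_projectiveChart_source _).1 hq'
  · exact (mk_mem_projectiveChart_source _).2 hz
  · exact hmetric z hz v w

/-- The Hausdorff axiom holds because the transition probabilities are continuous functions that
separate the points of projective space. -/
theorem isKahlerManifold_projectiveAtlas : IsKahlerManifold (projectiveAtlas H) := by
  refine ⟨fun q => ?_, ?_, ?_, fun p q hpq => ?_⟩
  · induction q using Projectivization.ind with
    | h x hx =>
      have hx' : (‖x‖ : ℂ) ≠ 0 := by exact_mod_cast norm_ne_zero_iff.2 hx
      refine ⟨_, ⟨(‖x‖ : ℂ)⁻¹ • x, ?_, rfl⟩, ?_⟩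
      · rw [norm_smul, norm_inv, Complex.norm_real, norm_norm,
          inv_mul_cancel₀ (norm_ne_zero_iff.2 hx)]
      · rw [mk_mem_projectiveChart_source, inner_smul_left]
        exact mul_ne_zero (by simpa using hx) (inner_self_ne_zero.2 hx)
  · rintro _ ⟨ξ, hξ, rfl⟩
    exact isKahler_projectiveChart hξ
  · rintro _ ⟨ξ, hξ, rfl⟩ _ ⟨η, hη, rfl⟩
    exact KahlerChart.isHolomorphicIsometric_of_at (isKahler_projectiveChart hξ).injOn
      fun q hq hq' => isHolomorphicIsometricAt_projectiveChart hξ hη hq hq'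
  · -- separate the points by the transition probability with the first one
    induction p using Projectivization.ind with
    | h x hx =>
    induction q using Projectivization.ind with
    | h y hy =>
      have hx' : 0 < ‖x‖ := norm_pos_iff.2 hx
      have hy' : 0 < ‖y‖ := norm_pos_iff.2 hy
      have h1 : transitionProbability x (Projectivization.mk ℂ x hx) = ‖x‖ ^ 2 := by
        rw [transitionProbability_mk, inner_self_eq_norm_sq_to_K]
        simp
        field_simp
      have h2 : transitionProbability x (Projectivization.mk ℂ y hy) < ‖x‖ ^ 2 := by
        rw [transitionProbability_mk, div_lt_iff₀ (by positivity), ← mul_pow]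
        have h3 : ‖⟪x, y⟫_ℂ‖ < ‖x‖ * ‖y‖ := by
          refine lt_of_le_of_ne (norm_inner_le_norm x y) fun h => hpq ?_
          obtain ⟨r, hr, hyr⟩ := (norm_inner_eq_norm_iff hx hy).1 h
          rw [Projectivization.mk_eq_mk_iff']
          exact ⟨r⁻¹, by rw [hyr, smul_smul, inv_mul_cancel₀ hr, one_smul]⟩
        gcongr
      obtain ⟨s, hs1, hs2⟩ := exists_between h2
      refine ⟨{q | s < transitionProbability x q}, {q | transitionProbability x q < s}, ?_, ?_,
        by rw [Set.mem_ofPred_eq, h1]; exact hs2, hs1, ?_⟩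
      · rintro _ ⟨ξ, hξ, rfl⟩
        rw [image_projectiveChart hξ]
        exact isOpen_lt continuous_const (continuous_transitionProbability x hξ)
      · rintro _ ⟨ξ, hξ, rfl⟩
        rw [image_projectiveChart hξ]
        exact isOpen_lt (continuous_transitionProbability x hξ) continuous_const
      · exact Set.disjoint_left.2 fun q hq hq' =>
          lt_asymm (a := s) (b := transitionProbability x q) hq hq'

end ProjectiveCharts

/-! ### Maps of projective spaces given by isometric linear maps -/

section ProjectiveSubspaces

open Filter Topology
open scoped LinearAlgebra.Projectivization

variable {H₁ H₂ : Type u} [NormedAddCommGroup H₁] [InnerProductSpace ℂ H₁]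
  [NormedAddCommGroup H₂] [InnerProductSpace ℂ H₂] (V : H₁ →ₗᵢ[ℂ] H₂)

/-- The map of projective spaces of a linear isometry. -/
noncomputable def projectiveMap : ℙ ℂ H₁ → ℙ ℂ H₂ := Projectivization.map V.toLinearMap V.injective

theorem projectiveMap_mk {x : H₁} (hx : x ≠ 0) (hx' : V x ≠ 0) :
    projectiveMap V (Projectivization.mk ℂ x hx) = Projectivization.mk ℂ (V x) hx' := rfl

theorem mk_mem_range_projectiveMap {y : H₂} (hy : y ≠ 0) :
    Projectivization.mk ℂ y hy ∈ Set.range (projectiveMap V) ↔ y ∈ Set.range V := by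
  constructor
  · rintro ⟨q, hq⟩
    induction q using Projectivization.ind with
    | h x hx =>
      have hx' : V x ≠ 0 := fun h => hx (V.injective (h.trans (map_zero V).symm))
      rw [projectiveMap_mk V hx hx', Projectivization.mk_eq_mk_iff'] at hq
      obtain ⟨a, ha⟩ := hq
      have ha0 : a ≠ 0 := fun h => hx' (by rw [← ha, h, zero_smul])
      exact ⟨a⁻¹ • x, by rw [map_smul, ← ha, smul_smul, inv_mul_cancel₀ ha0, one_smul]⟩
  · rintro ⟨x, rfl⟩
    have hx : x ≠ 0 := fun h => hy (by rw [h, map_zero])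
    exact ⟨Projectivization.mk ℂ x hx, rfl⟩

/-- The restriction of `V` to the orthogonal complements of `ξ` and `V ξ`. -/
noncomputable def orthogonalMap (ξ : H₁) : (ℂ ∙ ξ)ᗮ →ₗᵢ[ℂ] (ℂ ∙ V ξ)ᗮ where
  toLinearMap := (V.toLinearMap.comp (ℂ ∙ ξ)ᗮ.subtype).codRestrict (ℂ ∙ V ξ)ᗮ fun z => by
    rw [Submodule.mem_orthogonal_singleton_iff_inner_right]
    change ⟪V ξ, V (z : H₁)⟫_ℂ = 0
    rw [V.inner_map_map]
    exact Submodule.mem_orthogonal_singleton_iff_inner_right.1 z.2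
  norm_map' z := V.norm_map (z : H₁)

theorem mem_range_orthogonalMap {ξ : H₁} {z : (ℂ ∙ V ξ)ᗮ} :
    z ∈ LinearMap.range (orthogonalMap V ξ).toLinearMap ↔ V ξ + (z : H₂) ∈ Set.range V := by
  constructor
  · rintro ⟨w, rfl⟩
    exact ⟨ξ + (w : H₁), map_add V _ _⟩
  · rintro ⟨x, hx⟩
    have h1 : (z : H₂) = V (x - ξ) := by rw [map_sub, hx]; abel
    have h2 : x - ξ ∈ (ℂ ∙ ξ)ᗮ := by
      rw [Submodule.mem_orthogonal_singleton_iff_inner_right, ← V.inner_map_map, ← h1]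
      exact Submodule.mem_orthogonal_singleton_iff_inner_right.1 z.2
    exact ⟨⟨x - ξ, h2⟩, Subtype.ext h1.symm⟩

theorem projectiveMap_projectivePoint {ξ : H₁} (hξ : ‖ξ‖ = 1) (hξ' : ‖V ξ‖ = 1)
    (z : (ℂ ∙ ξ)ᗮ) : projectiveMap V (projectivePoint hξ z) =
      projectivePoint hξ' (orthogonalMap V ξ z) := by
  have h1 : V (ξ + (z : H₁)) ≠ 0 := fun h =>
    unit_add_ne_zero hξ z (V.injective (h.trans (map_zero V).symm))
  rw [projectivePoint, projectiveMap_mk V _ h1, projectivePoint]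
  congr 1
  exact map_add V _ _

/-- The hypothesis, here and below, is the commutativity of the square formed by `ι ∘ f`, by the map
of projective spaces, and by the identifications `g₁` and `g₂` of the fibers with these projective
spaces. -/
theorem range_eq_preimage_projectiveMap {V : H₁ →ₗᵢ[ℂ] H₂} {F₁ F₂ G : Type*}
    {g₁ : F₁ ≃ ℙ ℂ H₁} {g₂ : F₂ ≃ ℙ ℂ H₂} {ι : G → F₂} {f : F₁ ≃ G}
    (h : ∀ e, g₂ (ι (f e)) = projectiveMap V (g₁ e)) :
    Set.range ι = g₂ ⁻¹' Set.range (projectiveMap V) := by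
  ext q
  constructor
  · rintro ⟨n, rfl⟩
    obtain ⟨e, rfl⟩ := f.surjective n
    exact ⟨g₁ e, (h e).symm⟩
  · rintro ⟨p, hp⟩
    obtain ⟨e, rfl⟩ := g₁.surjective p
    exact ⟨f e, g₂.injective ((h e).trans hp)⟩

variable [CompleteSpace H₁]

theorem isClosed_range_orthogonalMap (ξ : H₁) :
    IsClosed (LinearMap.range (orthogonalMap V ξ).toLinearMap : Set (ℂ ∙ V ξ)ᗮ) :=
  (orthogonalMap V ξ).isometry.isClosedEmbedding.isClosed_range

variable [CompleteSpace H₂]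

theorem isAtlasOpen_compl_range_projectiveMap :
    IsAtlasOpen (projectiveAtlas H₂) (Set.range (projectiveMap V))ᶜ := by
  rintro _ ⟨η, hη, rfl⟩
  rw [image_projectiveChart hη]
  have h1 : {z : (ℂ ∙ η)ᗮ | projectivePoint hη z ∈ (Set.range (projectiveMap V))ᶜ} =
      {z : (ℂ ∙ η)ᗮ | η + (z : H₂) ∈ (Set.range V)ᶜ} := by
    ext z
    exact not_congr (mk_mem_range_projectiveMap V _)
  have h2 : IsClosed (Set.range V) := V.isometry.isClosedEmbedding.isClosed_range
  have h3 : Continuous fun z : (ℂ ∙ η)ᗮ => η + (z : H₂) := by fun_prop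
  rw [h1]
  exact h2.isOpen_compl.preimage h3

/-- In the affine chart at `V ξ`, the image of the projective space of `H₁` is the closed linear
subspace `V(ξᗮ)`. -/
theorem isAdapted_projectiveChart {ξ : H₁} (hξ : ‖V ξ‖ = 1) :
    (projectiveChart (V ξ)).IsAdapted (Set.range (projectiveMap V))
      (LinearMap.range (orthogonalMap V ξ).toLinearMap) := by
  refine ⟨isClosed_range_orthogonalMap V ξ, ?_⟩
  rw [image_projectiveChart hξ, image_projectiveChart_source hξ, Set.inter_univ]
  ext z
  exact (mk_mem_range_projectiveMap V _).trans (mem_range_orthogonalMap V).symm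

theorem KahlerChart.IsAdapted.pullback {M N : Type u} {c : KahlerChart M} {U : Set M}
    {E : Submodule ℂ c.model} (h : c.IsAdapted U E) (f : N ≃ M) :
    (c.pullback f).IsAdapted (f ⁻¹' U) E := by
  refine ⟨h.1, ?_⟩
  rw [c.image_pullback]
  refine h.2.trans ?_
  have := c.image_pullback f Set.univ
  rw [Set.preimage_univ, Set.inter_univ, Set.inter_univ] at this
  rw [← this]
  rfl

theorem projectiveMap_mem_source {ξ : H₁} (hξ : ‖ξ‖ = 1) {q : ℙ ℂ H₁}
    (hq : q ∈ (projectiveChart ξ).source) :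
    projectiveMap V q ∈ (projectiveChart (V ξ)).source := by
  have hξ' : ‖V ξ‖ = 1 := (V.norm_map ξ).trans hξ
  obtain ⟨z, rfl⟩ : ∃ z, projectivePoint hξ z = q := ⟨_, projectivePoint_projectiveChart hξ hq⟩
  rw [projectiveMap_projectivePoint V hξ hξ']
  exact projectivePoint_mem_source hξ' _

variable {F₁ F₂ G : Type u} {g₁ : F₁ ≃ ℙ ℂ H₁} {g₂ : F₂ ≃ ℙ ℂ H₂} {ι : G → F₂} {f : F₁ ≃ G}
  {V}

theorem isAdapted_pullback_projectiveChart (h : ∀ e, g₂ (ι (f e)) = projectiveMap V (g₁ e))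
    {ξ : H₁} (hξ : ‖V ξ‖ = 1) :
    ((projectiveChart (V ξ)).pullback g₂).IsAdapted (Set.range ι)
      (LinearMap.range (orthogonalMap V ξ).toLinearMap) := by
  rw [range_eq_preimage_projectiveMap h]
  exact (isAdapted_projectiveChart V hξ).pullback g₂

theorem exists_adapted_projectiveChart (h : ∀ e, g₂ (ι (f e)) = projectiveMap V (g₁ e)) (e : F₁) :
    ∃ ξ : H₁, ‖ξ‖ = 1 ∧ ‖V ξ‖ = 1 ∧ g₁ e ∈ (projectiveChart ξ).source ∧
      g₂ (ι (f e)) ∈ (projectiveChart (V ξ)).source := by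
  obtain ⟨_, ⟨ξ, hξ, rfl⟩, hq⟩ := isKahlerManifold_projectiveAtlas.covers (g₁ e)
  exact ⟨ξ, hξ, (V.norm_map ξ).trans hξ, hq, by rw [h]; exact projectiveMap_mem_source V hξ hq⟩

theorem isClosedKahlerSubmanifold_range (h : ∀ e, g₂ (ι (f e)) = projectiveMap V (g₁ e)) :
    IsClosedKahlerSubmanifold (pullbackAtlas (projectiveAtlas H₂) g₂) (Set.range ι) := by
  constructor
  · rw [range_eq_preimage_projectiveMap h]
    exact (isAtlasOpen_compl_range_projectiveMap V).preimage g₂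
  · rintro _ ⟨n, rfl⟩
    obtain ⟨e, rfl⟩ := f.surjective n
    obtain ⟨ξ, hξ, hξ', hq, hq'⟩ := exists_adapted_projectiveChart h e
    exact ⟨_, (isKahlerManifold_projectiveAtlas.pullback g₂).subset_maximalKahlerAtlas
      ⟨_, ⟨V ξ, hξ', rfl⟩, rfl⟩, hq', _, isAdapted_pullback_projectiveChart h hξ'⟩

theorem isKahlerManifold_induced_projectiveAtlas
    (h : ∀ e, g₂ (ι (f e)) = projectiveMap V (g₁ e)) (hι : Function.Injective ι) :
    IsKahlerManifold (inducedKahlerAtlas (pullbackAtlas (projectiveAtlas H₂) g₂) ι) :=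
  (isKahlerManifold_projectiveAtlas.pullback g₂).induced hι fun n =>
    (isClosedKahlerSubmanifold_range h).2 (ι n) ⟨n, rfl⟩

/-- The projective space of `H₁` is holomorphically isometric to its image in the projective space
of `H₂`: in the charts at `ξ` and `V ξ`, the isometry is the linear map `V`. -/
theorem isHolomorphicKahlerIsometry_projectiveMap
    (h : ∀ e, g₂ (ι (f e)) = projectiveMap V (g₁ e)) (hι : Function.Injective ι) :
    IsHolomorphicKahlerIsometry (pullbackAtlas (projectiveAtlas H₁) g₁)
      (inducedKahlerAtlas (pullbackAtlas (projectiveAtlas H₂) g₂) ι) f := by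
  refine isHolomorphicKahlerIsometry_of_local (isKahlerManifold_projectiveAtlas.pullback g₁)
    (isKahlerManifold_induced_projectiveAtlas h hι) f fun e => ?_
  obtain ⟨ξ, hξ, hξ', hq, hq'⟩ := exists_adapted_projectiveChart h e
  have hE := isAdapted_pullback_projectiveChart h hξ'
  let c := (projectiveChart ξ).pullback g₁
  let d' := (projectiveChart (V ξ)).pullback g₂
  let d := d'.restrict _ hE.1 ι
  let T : (ℂ ∙ ξ)ᗮ ≃ₗᵢ[ℂ] LinearMap.range (orthogonalMap V ξ).toLinearMap :=
    (orthogonalMap V ξ).equivRange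
  let τ : c.model ≃ₗᵢ[ℂ] d.model := T
  -- the points with given coordinates
  let n : c.model → F₁ := fun z => g₁.symm (projectivePoint hξ z)
  have hn1 : ∀ z, n z ∈ c.source := fun z => by
    change g₁ (g₁.symm _) ∈ (projectiveChart ξ).source
    rw [g₁.apply_symm_apply]
    exact projectivePoint_mem_source hξ z
  have hn2 : ∀ z, c.toFun (n z) = z := fun z => by
    change (projectiveChart ξ).toFun (g₁ (g₁.symm _)) = z
    rw [g₁.apply_symm_apply]
    exact projectiveChart_projectivePoint hξ z
  have hn3 : ∀ z, g₂ (ι (f (n z))) = projectivePoint hξ' (orthogonalMap V ξ z) := fun z => by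
    rw [h]
    change projectiveMap V (g₁ (g₁.symm _)) = _
    rw [g₁.apply_symm_apply]
    exact projectiveMap_projectivePoint V hξ hξ' z
  have hn4 : ∀ z, f (n z) ∈ d.source := fun z => by
    change g₂ (ι (f (n z))) ∈ (projectiveChart (V ξ)).source
    rw [hn3]
    exact projectivePoint_mem_source hξ' _
  have hn5 : ∀ z, d.toFun (f (n z)) = τ z := fun z => by
    refine (d'.restrictInclusion _ hE.1 ι).injective ?_
    rw [hE.restrictInclusion_toFun (hn4 z)]
    change (projectiveChart (V ξ)).toFun (g₂ (ι (f (n z)))) = orthogonalMap V ξ z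
    rw [hn3]
    exact projectiveChart_projectivePoint hξ' _
  have hm : ∀ z v w, d.metric (τ z) (τ v) (τ w) = c.metric z v w := fun z v w => by
    let z' : (ℂ ∙ ξ)ᗮ := z
    let v' : (ℂ ∙ ξ)ᗮ := v
    let w' : (ℂ ∙ ξ)ᗮ := w
    change fubiniStudy (orthogonalMap V ξ z') (orthogonalMap V ξ v') (orthogonalMap V ξ w') =
      fubiniStudy z' v' w'
    simp only [fubiniStudy_apply, LinearIsometry.inner_map_map, LinearIsometry.norm_map]
  have hd : ∀ z, fderiv ℂ τ z = (τ : c.model →L[ℂ] d.model) := fun z =>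
    (τ : c.model →L[ℂ] d.model).fderiv
  have hd' : ∀ z, fderiv ℂ τ.symm z = (τ.symm : d.model →L[ℂ] c.model) := fun z =>
    (τ.symm : d.model →L[ℂ] c.model).fderiv
  refine ⟨c, ⟨_, ⟨ξ, hξ, rfl⟩, rfl⟩, d,
    ⟨d', (isKahlerManifold_projectiveAtlas.pullback g₂).subset_maximalKahlerAtlas
      ⟨_, ⟨V ξ, hξ', rfl⟩, rfl⟩, _, hE, rfl⟩, hq, hq', ?_, ?_⟩
  · refine ⟨Set.univ, isOpen_univ, Set.mem_univ _, τ,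
      (τ : c.model →L[ℂ] d.model).differentiable.differentiableOn, fun z _ =>
      ⟨⟨n z, hn1 z, hn4 z, hn2 z, hn5 z⟩, fun v w => ?_⟩⟩
    rw [hd]
    exact hm z v w
  · refine ⟨Set.univ, isOpen_univ, Set.mem_univ _, τ.symm,
      (τ.symm : d.model →L[ℂ] c.model).differentiable.differentiableOn, fun z _ =>
      ⟨⟨f (n (τ.symm z)), hn4 _, ?_, ?_, ?_⟩, fun v w => ?_⟩⟩
    · rw [f.symm_apply_apply]
      exact hn1 _
    · rw [hn5, τ.apply_symm_apply]
    · rw [f.symm_apply_apply, hn2]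
    · rw [hd']
      refine (hm _ _ _).symm.trans ?_
      change d.metric (τ (τ.symm z)) (τ (τ.symm v)) (τ (τ.symm w)) = d.metric z v w
      rw [τ.apply_symm_apply, τ.apply_symm_apply, τ.apply_symm_apply]

end ProjectiveSubspaces

/-! ### The bundle of pure states -/

section Fibers

open scoped LinearAlgebra.Projectivization

variable {A : Type u} [NonUnitalCStarAlgebra A]

/-- The point `[v]` that corresponds to a pure state `⟨v, π(·)v⟩` does not depend on the choice of
the vector. -/
theorem fiberToProjective_eq_mk {x : CStarSpectrum A} {π : IrredRep A} (h : π.toSpectrum = x)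
    (ω : {ω : PureState A // gnsProj ω = x}) {v : π.1.space} (hv : v ≠ 0)
    (hω : ω.1.functional = π.1.vectorFunctional v) :
    fiberToProjective x π h ω = Projectivization.mk ℂ v hv := by
  rw [fiberToProjective, Projectivization.mk_eq_mk_iff']
  have hs := (exists_vector_of_gnsProj_eq ω.1 π (ω.2.trans h.symm)).choose_spec
  obtain ⟨c, hc⟩ := π.2.exists_smul_eq_of_vectorFunctional_eq hv hs.1
    (hω.symm.trans (ContinuousLinearMap.ext hs.2))
  exact ⟨c, hc.symm⟩

theorem fiberToProjective_bijective {x : CStarSpectrum A} {π : IrredRep A}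
    (h : π.toSpectrum = x) : Function.Bijective (fiberToProjective x π h) := by
  have hvec : ∀ ω : {ω : PureState A // gnsProj ω = x}, ∃ v : π.1.space, v ≠ 0 ∧ ‖v‖ = 1 ∧
      ω.1.functional = π.1.vectorFunctional v := fun ω => by
    obtain ⟨v, hv0, hv⟩ := exists_vector_of_gnsProj_eq ω.1 π (ω.2.trans h.symm)
    have hv' : ω.1.functional = π.1.vectorFunctional v := ContinuousLinearMap.ext hv
    exact ⟨v, hv0, PureState.norm_vector π.2 hv', hv'⟩
  constructor
  · intro ω ω' hωω'
    obtain ⟨v, hv0, hv1, hv⟩ := hvec ω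
    obtain ⟨w, hw0, hw1, hw⟩ := hvec ω'
    rw [fiberToProjective_eq_mk h ω hv0 hv, fiberToProjective_eq_mk h ω' hw0 hw,
      Projectivization.mk_eq_mk_iff'] at hωω'
    obtain ⟨c, rfl⟩ := hωω'
    have hc : ‖c‖ = 1 := by rwa [norm_smul, hw1, mul_one] at hv1
    refine Subtype.ext (PureState.ext ?_)
    rw [hv, hw, π.1.vectorFunctional_smul c hc]
  · intro q
    induction q using Projectivization.ind with
    | h x hx =>
      have hx' : ‖x‖ ≠ 0 := norm_ne_zero_iff.2 hx
      have hx1 : ‖(‖x‖ : ℂ)⁻¹ • x‖ = 1 := by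
        rw [norm_smul, norm_inv, Complex.norm_real, norm_norm, inv_mul_cancel₀ hx']
      refine ⟨⟨π.pureState _ hx1, (π.gnsProj_pureState _ hx1).trans h⟩, ?_⟩
      rw [fiberToProjective_eq_mk h _ (v := (‖x‖ : ℂ)⁻¹ • x)
        (fun h0 => by rw [h0, norm_zero] at hx1; exact zero_ne_one hx1) rfl,
        Projectivization.mk_eq_mk_iff']
      exact ⟨_, rfl⟩

/-- The identification of a fiber of the bundle of pure states with a projective space. -/
noncomputable def fiberEquiv (x : CStarSpectrum A) (π : IrredRep A) (h : π.toSpectrum = x) :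
    {ω : PureState A // gnsProj ω = x} ≃ ℙ ℂ π.1.space :=
  Equiv.ofBijective _ (fiberToProjective_bijective h)

/-- The pure states over the spectrum are a uniform Kähler bundle. -/
theorem isUniformKahlerBundle_pureStateBundle (A : Type u) [NonUnitalCStarAlgebra A] :
    (pureStateBundle A).IsUniformKahlerBundle where
  continuous_proj := continuous_gnsProj
  isOpenMap_proj := isOpenMap_gnsProj
  surjective_proj := gnsProj_surjective
  isKahlerManifold x := isKahlerManifold_projectiveAtlas.pullback
    (fiberEquiv x (Quotient.out x) (Quotient.out_eq x))

end Fibers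

/-! ### The subbundle of a hereditary subalgebra -/

section HereditarySubbundle

open Topology
open scoped LinearAlgebra.Projectivization

variable {A : Type u} [NonUnitalCStarAlgebra A] [PartialOrder A] [StarOrderedRing A]
  {B : NonUnitalStarSubalgebra ℂ A} [IsClosed (B : Set A)] (hB : IsHereditary B)

/-- The subbundle of the extensions of the pure states of a hereditary subalgebra. -/
noncomputable def hereditarySubbundle : (pureStateBundle A).Sub where
  total := Set.range (pureExtension hB)
  base := nonvanishingOn B
  mapsTo := by
    rintro _ ⟨τ, rfl⟩
    change gnsProj (pureExtension hB τ) ∈ nonvanishingOn B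
    rw [gnsProj_pureExtension]
    exact spectrumExtension_mem hB _

/-- The extension of pure states, as a homeomorphism onto the total space of the subbundle. -/
noncomputable def totalHomeomorph : PureState B ≃ₜ (hereditarySubbundle hB).total :=
  pureExtensionHomeomorph hB

/-- The map `[π_B] ↦ [π]`, as a homeomorphism onto the base of the subbundle. -/
noncomputable def baseHomeomorph : CStarSpectrum B ≃ₜ (hereditarySubbundle hB).base :=
  spectrumExtensionHomeomorph hB

theorem proj_totalHomeomorph (τ : PureState B) :
    (hereditarySubbundle hB).toBundle.proj (totalHomeomorph hB τ) =
      baseHomeomorph hB (gnsProj τ) :=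
  Subtype.ext (gnsProj_pureExtension hB τ)

/-- The extension of pure states on a fiber. -/
noncomputable def extensionFiberEquiv (y : CStarSpectrum B) : {τ : PureState B // gnsProj τ = y} ≃
    {e : (hereditarySubbundle hB).total //
      (hereditarySubbundle hB).toBundle.proj e = baseHomeomorph hB y} :=
  (totalHomeomorph hB).toEquiv.subtypeEquiv fun τ => by
    change _ ↔ (hereditarySubbundle hB).toBundle.proj (totalHomeomorph hB τ) = _
    rw [proj_totalHomeomorph]
    exact (baseHomeomorph hB).injective.eq_iff.symm

/-- On each fiber, the extension of pure states is the map of projective spaces given by an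
isometric linear map, namely an equivalence of the representation with `π_B`, composed with the
inclusion of the essential space. -/
theorem exists_isometry_fiber (y : CStarSpectrum B) :
    ∃ V : (Quotient.out y : IrredRep B).1.space →ₗᵢ[ℂ]
        (Quotient.out (baseHomeomorph hB y).1 : IrredRep A).1.space,
      ∀ τ, fiberEquiv (baseHomeomorph hB y).1 (Quotient.out (baseHomeomorph hB y).1)
        (Quotient.out_eq _) ((hereditarySubbundle hB).fiberInclusion _
          (extensionFiberEquiv hB y τ)) =
        projectiveMap V (fiberEquiv y (Quotient.out y) (Quotient.out_eq y) τ) := by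
  set x := (baseHomeomorph hB y).1 with hx
  let σ : IrredRep B := Quotient.out y
  let π : IrredRep A := Quotient.out x
  have hσ : σ.toSpectrum = y := Quotient.out_eq y
  have hπ : π.toSpectrum = x := Quotient.out_eq x
  obtain ⟨hmem, hy⟩ := (spectrumExtension_eq_iff hB).1 (hπ.symm ▸ rfl :
    spectrumExtension hB y = π.toSpectrum)
  obtain ⟨U, hU⟩ : σ.1.UnitarilyEquiv (π.1.essentialRestriction B) :=
    Quotient.exact (hσ.trans hy)
  let V : σ.1.space →ₗᵢ[ℂ] π.1.space := (π.1.essentialInclusion B).comp U.toLinearIsometry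
  refine ⟨V, fun τ => ?_⟩
  obtain ⟨v, hv0, hv⟩ := exists_vector_of_gnsProj_eq τ.1 σ (τ.2.trans hσ.symm)
  have hv' : τ.1.functional = σ.1.vectorFunctional v := ContinuousLinearMap.ext hv
  have hv1 : ‖v‖ = 1 := PureState.norm_vector σ.2 hv'
  have hU1 : ‖U v‖ = 1 := (U.norm_map v).trans hv1
  have hV1 : ‖V v‖ = 1 := (V.norm_map v).trans hv1
  have hV0 : V v ≠ 0 := fun h => by
    rw [h, norm_zero] at hV1
    exact zero_ne_one hV1
  have h1 : τ.1 = (π.essentialRestriction hB hmem).pureState (U v) hU1 := by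
    refine PureState.ext (ContinuousLinearMap.ext fun b => ?_)
    rw [hv b, ← U.inner_map_map, hU]
    rfl
  have h2 : (pureExtension hB τ.1).functional = π.1.vectorFunctional (V v) := by
    rw [h1, pureExtension_pureState hB π hmem (U v) hU1 hV1]
    rfl
  have h3 := fiberToProjective_eq_mk hσ τ hv0 hv'
  have h4 := fiberToProjective_eq_mk hπ ((hereditarySubbundle hB).fiberInclusion _
          (extensionFiberEquiv hB y τ)) hV0 h2
  refine h4.trans ?_
  change _ = projectiveMap V (fiberToProjective y σ hσ τ)
  rw [h3]
  rfl

theorem fiberInclusion_injective (x : (hereditarySubbundle hB).base) :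
    Function.Injective ((hereditarySubbundle hB).fiberInclusion x) := fun _ _ h =>
  Subtype.ext (Subtype.ext (congrArg (fun e => e.1) h))

theorem isClosedKahlerSubmanifold_range_fiberInclusion (y : CStarSpectrum B) :
    IsClosedKahlerSubmanifold ((pureStateBundle A).atlas (baseHomeomorph hB y).1)
      (Set.range ((hereditarySubbundle hB).fiberInclusion (baseHomeomorph hB y))) := by
  obtain ⟨V, hV⟩ := exists_isometry_fiber hB y
  exact isClosedKahlerSubmanifold_range hV

/-- The projection of the subbundle is conjugate to that of the bundle of `B` by homeomorphisms,
hence continuous and open. -/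
theorem isUniformKahlerBundle_hereditarySubbundle :
    (hereditarySubbundle hB).toBundle.IsUniformKahlerBundle := by
  have h1 : (hereditarySubbundle hB).toBundle.proj =
      baseHomeomorph hB ∘ gnsProj ∘ (totalHomeomorph hB).symm := by
    funext e
    obtain ⟨τ, rfl⟩ := (totalHomeomorph hB).surjective e
    rw [proj_totalHomeomorph]
    change _ = baseHomeomorph hB (gnsProj ((totalHomeomorph hB).symm (totalHomeomorph hB τ)))
    rw [Homeomorph.symm_apply_apply]
  refine ⟨?_, ?_, ?_, fun x => ?_⟩
  · rw [h1]
    exact (baseHomeomorph hB).continuous.comp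
      (continuous_gnsProj.comp (totalHomeomorph hB).symm.continuous)
  · rw [h1]
    exact (baseHomeomorph hB).isOpenMap.comp
      (isOpenMap_gnsProj.comp (totalHomeomorph hB).symm.isOpenMap)
  · rw [h1]
    exact (baseHomeomorph hB).surjective.comp
      (gnsProj_surjective.comp (totalHomeomorph hB).symm.surjective)
  · obtain ⟨y, rfl⟩ := (baseHomeomorph hB).surjective x
    obtain ⟨V, hV⟩ := exists_isometry_fiber hB y
    exact isKahlerManifold_induced_projectiveAtlas hV (fiberInclusion_injective hB _)

theorem isKahlerSubbundle_hereditarySubbundle : (hereditarySubbundle hB).IsKahlerSubbundle := by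
  refine ⟨isUniformKahlerBundle_pureStateBundle A, isUniformKahlerBundle_hereditarySubbundle hB,
    fun x hx => ?_⟩
  obtain ⟨y, hy⟩ := (baseHomeomorph hB).surjective ⟨x, hx⟩
  have hy' : (baseHomeomorph hB y).1 = x := congrArg Subtype.val hy
  subst hy'
  convert isClosedKahlerSubmanifold_range_fiberInclusion hB y using 1
  ext e
  constructor
  · intro he
    exact ⟨⟨⟨e.1, he⟩, Subtype.ext e.2⟩, rfl⟩
  · rintro ⟨e, rfl⟩
    exact e.1.2

theorem isClosedKahlerSubmanifold_pureExtension (y : CStarSpectrum B) :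
    IsClosedKahlerSubmanifold ((pureStateBundle A).atlas (baseHomeomorph hB y).1)
      {e | ∃ τ : PureState B, gnsProj τ = y ∧ e.1 = pureExtension hB τ} := by
  convert isClosedKahlerSubmanifold_range_fiberInclusion hB y using 1
  ext e
  constructor
  · rintro ⟨τ, hτ, he⟩
    exact ⟨extensionFiberEquiv hB y ⟨τ, hτ⟩, Subtype.ext he.symm⟩
  · rintro ⟨e, rfl⟩
    obtain ⟨τ, rfl⟩ := (extensionFiberEquiv hB y).surjective e
    exact ⟨τ.1, τ.2, rfl⟩

theorem isUniformKahlerIso_pureExtension :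
    IsUniformKahlerIso (pureStateBundle B) (hereditarySubbundle hB).toBundle (totalHomeomorph hB)
      (baseHomeomorph hB) := by
  refine ⟨proj_totalHomeomorph hB, fun y => ⟨extensionFiberEquiv hB y, fun _ => rfl, ?_⟩⟩
  obtain ⟨V, hV⟩ := exists_isometry_fiber hB y
  exact isHolomorphicKahlerIsometry_projectiveMap hV (fiberInclusion_injective hB _)

theorem isTwoSidedIdeal_iff_range_pureExtension :
    IsTwoSidedIdeal B ↔ Set.range (pureExtension hB) = gnsProj ⁻¹' nonvanishingOn B :=
  ⟨fun h => h.range_pureExtension hB, isTwoSidedIdeal_of_range_pureExtension hB⟩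

end HereditarySubbundle

theorem theorem2p13 {A : Type u} [NonUnitalCStarAlgebra A] [PartialOrder A] [StarOrderedRing A]
    (B : NonUnitalStarSubalgebra ℂ A) [IsClosed (B : Set A)] (hB : IsHereditary B)
    (hB0 : B ≠ ⊥) :
    ∃ (Ξ : PureState B → PureState A) (S : (pureStateBundle A).Sub)
      (ψ : PureState B ≃ₜ S.total) (φ : CStarSpectrum B ≃ₜ S.base),
      -- `Ξ` is the unique extension of pure states, and `S = (Ξ(P(B)), p_A, Â^B)`
      IsUniqueExtensionMap B Ξ ∧ S.total = Set.range Ξ ∧ S.base = nonvanishingOn B ∧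
      -- `φ` is the bijection `[π_B] ↦ [π]`
      (∀ (σ : IrredRep B) (π : IrredRep A), (φ σ.toSpectrum).1 = π.toSpectrum ↔
        π.toSpectrum ∈ nonvanishingOn B ∧ σ.1.UnitarilyEquiv (π.1.essentialRestriction B)) ∧
      -- `S` is a Kähler subbundle
      S.IsKahlerSubbundle ∧
      -- the image under `Ξ` of the fiber over `[π_B]` is a closed Kähler submanifold of the fiber
      -- over `[π]`
      (∀ y : CStarSpectrum B, IsClosedKahlerSubmanifold
        ((pureStateBundle A).atlas (φ y).1)
        {e | ∃ τ : PureState B, gnsProj τ = y ∧ e.1 = Ξ τ}) ∧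
      -- `(Ξ, φ)` is a uniform Kähler isomorphism of the bundle of `B` with `S`
      (pureStateBundle B).IsUniformKahlerBundle ∧
      (∀ τ, (ψ τ).1 = Ξ τ) ∧
      IsUniformKahlerIso (pureStateBundle B) S.toBundle ψ φ ∧
      -- ideals
      (IsTwoSidedIdeal B ↔ S = (pureStateBundle A).restrict (nonvanishingOn B)) := by
  refine ⟨pureExtension hB, hereditarySubbundle hB, totalHomeomorph hB, baseHomeomorph hB,
    isUniqueExtensionMap_pureExtension hB, rfl, rfl, fun σ π => ?_,
    isKahlerSubbundle_hereditarySubbundle hB, isClosedKahlerSubmanifold_pureExtension hB,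
    isUniformKahlerBundle_pureStateBundle B, fun _ => rfl, isUniformKahlerIso_pureExtension hB, ?_⟩
  · refine (spectrumExtension_eq_iff hB).trans ⟨?_, ?_⟩
    · rintro ⟨h1, h2⟩
      exact ⟨h1, Quotient.exact h2⟩
    · rintro ⟨h1, h2⟩
      exact ⟨h1, Quotient.sound h2⟩
  · rw [isTwoSidedIdeal_iff_range_pureExtension hB]
    constructor
    · intro h
      exact KahlerBundle.Sub.ext h rfl
    · intro h
      exact congrArg KahlerBundle.Sub.total h
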